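/- **Setting.** Let $m\ge 1$, $x_0<x_1<\dots<x_m$, $a=x_0$, $b=x_m$, $I_i=[x_{i-1},x_i)$ for $i<m$ and $I_m=[x_{m-1},x_m]$. For $i=1,\dots,m$ let $p_i\ge 0$ be an integer and let $w^{(i)}_0,\dots,w^{(i)}_{p_i}$ be positive functions on $[x_{i-1},x_i]$ with $w^{(i)}_j\in C^{p_i-j}$ and $w^{(i)}_0=1$. Let $\mathbb T^{(i)}$ be the span of the generalized powers $u^{(i)}_j(x)=w^{(i)}_0(x)\int_{x_{i-1}}^x w^{(i)}_1(y_1)\int_{x_{i-1}}^{y_1}\cdots\int_{x_{i-1}}^{y_{j-1}}w^{(i)}_j(y_j)\,dy_j\cdots dy_1$, $0\le j\le p_i$. Let $r_0=r_m=-1$ and let $r_1,\dots,r_{m-1}$ be integers with $-1\le r_i\le\min\{p_i,p_{i+1}\}$. Functions on $[a,b]$ are extended by $0$ to $\mathbb R$. Write $D_\pm^k f(x)$ for the one-sided limits of $D^kf$ at $x$, and $J_{x,k}(f)=D_-^kf(x)-D_+^kf(x)$. The spline space $\mathbb S_{\mathbf r}$ consists of all $s:[a,b]\to\mathbb R$ with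 $s|_{I_i}\in\mathbb T^{(i)}|_{I_i}$ for all $i$ and $J_{x_i,j}(s)=0$ for $1\le i\le m-1$, $0\le j\le r_i$. Put $M=\sum_{i=1}^m(p_i+1)$, $O=\sum_{i=1}^{m-1}(r_i+1)$, $N=M-O$. **GTB-spline basis.** Let $(u_k)_{k=1}^N$ list $x_i$, $i=0,\dots,m-1$, in order, $p_{i+1}-r_i$ times each, and let $(v_k)_{k=1}^N$ list $x_i$, $i=1,\dots,m$, in order, $p_i-r_i$ times each. If $u_k=x_i$ and $v_k=x_j$, put $r_u(k)=p_{i+1}-1-\max\{l\ge0:u_k=u_{k+l}\}$ and $r_v(k)=p_j-1-\max\{l\ge 0:v_k=v_{k-l}\}$. A GTB-spline basis of $\mathbb S_{\mathbf r}$ is a basis $(B_k)_{k=1}^N$ of $\mathbb S_{\mathbf r}$ such that $B_k>0$ on $(u_k,v_k)$; $B_k=0$ outside $[u_k,v_k]$; $\sum_kB_k=1$ on $[a,b]$; $B_k$ is exactly $C^{r_u(k)}$ at $u_k$ and exactly $C^{r_v(k)}$ at $v_k$ ($f$ is exactly $C^r$ at $x$ if $J_{x,j}(f)=0$ for $0\le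 j\le r$ and $J_{x,r+1}(f)\ne0$); and, for every $i$, the restrictions to $I_i$ of the $B_k$ with $\mu(i)-p_i\le k\le\mu(i)$, where $\mu(i)=\sum_{j=0}^{i-1}(p_{j+1}-r_j)$, span $\mathbb T^{(i)}|_{I_i}$. **Global Bernstein basis.** For fixed $i$ put $p=p_i$, $w_j=w_j^{(i)}$, $b_{0,0}=w_p$ and, for $1\le q\le p$ and $0\le j\le q$, $b_{j,q}(x)=w_{p-q}(x)\,[\,F_{j-1}(x)-F_j(x)\,]$ with $F_{-1}=1$, $F_q=0$ and $F_l(x)=\int_{x_{i-1}}^xb_{l,q-1}\big/\int_{x_{i-1}}^{x_i}b_{l,q-1}$ for $0\le l\le q-1$. The global Bernstein functions $b_1,\dots,b_M$ are the functions equal to $b^{(i)}_{j}=b_{j,p_i}$ on $I_i$ and to $0$ elsewhere, for $(i,j)$, $1\le i\le m$, $0\le j\le p_i$, in lexicographic order. **Algorithm 1** ($\mathrm{nullspace}$). Input $\mathbf a\in\mathbb R^n$; output an $(n-1)\times n$ matrix $\tilde C$. Start with $\tilde C=0$, $k=1$. While $k<n$ and $\mathbf a(k)=0$: $\tilde C(k,k)\leftarrow1$,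 $k\leftarrow k+1$. Then $\tilde C(k,k)\leftarrow1$. While $k+1<n$ and $\mathbf a(k+1)\neq0$: $\tilde C(k,k+1)\leftarrow-\tilde C(k,k)\,\mathbf a(k)/\mathbf a(k+1)$, $\tilde C(k+1,k+1)\leftarrow1-\tilde C(k,k+1)$, $k\leftarrow k+1$. While $k<n$: $\tilde C(k,k+1)\leftarrow1$, $k\leftarrow k+1$. (Writes outside the matrix are ignored.) **Algorithm 2** (extraction). Input $A\in\mathbb R^{M\times O}$. Start with $C$ the $M\times M$ identity matrix. For $\rho=1,\dots,O$: let $\tilde C_\rho=\mathrm{nullspace}(A(:,\rho))$ and replace $C$ by $\tilde C_\rho C$ and $A$ by $\tilde C_\rho A$. Output $C=\tilde C_O\cdots\tilde C_1\in\mathbb R^{N\times M}$. **Theorem (Bézier extraction).** Assume that the weights are admissible, i.e. $D_-^lw_j^{(i)}(x_i)=D_+^lw_j^{(i+1)}(x_i)$ for $1\le i\le m-1$, $0\le j\le r_i$, $0\le l\le r_i-j$; or, more generally, that for every $\rho=0,\dots,O$ the spline space defined by the first $\rho$ of the constraints $J_{x_i,j}(s)=0$ (pairs $(i,j)$, $1\le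 i\le m-1$, $0\le j\le r_i$, in lexicographic order), with the correspondingly reduced smoothness vector, has a GTB-spline basis. Let $A\in\mathbb R^{M\times O}$ be the matrix whose $\rho$-th column consists of the numbers $J_{x_i,j}(b_l)$, $l=1,\dots,M$, where $(i,j)$ is the $\rho$-th such pair, and let $C\in\mathbb R^{N\times M}$ be the output of Algorithm 2 for $A$. Then $\mathbb S_{\mathbf r}$ has a GTB-spline basis, and every GTB-spline basis $(B_k)_{k=1}^N$ of $\mathbb S_{\mathbf r}$ satisfies $$B_k(x)=\sum_{l=1}^MC_{kl}\,b_l(x),\qquad k=1,\dots,N,\quad x\in[a,b].$$ In particular the GTB-spline basis is unique, and it is the image of the global Bernstein basis under $C$. -/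

import Mathlib

namespace GTSpline

/-! ### The two algorithms -/

/-- Overwrite one entry of a matrix memory. -/
def write (C : ℕ → ℕ → ℝ) (i j : ℕ) (c : ℝ) : ℕ → ℕ → ℝ :=
  fun i' j' => if i' = i ∧ j' = j then c else C i' j'

/-- First loop of the nullspace routine for a vector `a` of length `n`. Rows and columns are counted
from `0`, so that the usual counter is `k + 1`. -/
noncomputable def loopA (n : ℕ) (a : ℕ → ℝ) (k : ℕ) (C : ℕ → ℕ → ℝ) : ℕ × (ℕ → ℕ → ℝ) :=
  if k + 1 < n ∧ a k = 0 then loopA n a (k + 1) (write C k k 1) else (k, C)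
termination_by n - k

/-- Second loop of the nullspace routine. -/
noncomputable def loopC (n : ℕ) (a : ℕ → ℝ) (k : ℕ) (C : ℕ → ℕ → ℝ) : ℕ × (ℕ → ℕ → ℝ) :=
  if k + 2 < n ∧ a (k + 1) ≠ 0 then
    let C₁ := write C k (k + 1) (-C k k * a k / a (k + 1))
    let C₂ := write C₁ (k + 1) (k + 1) (1 - C₁ k (k + 1))
    loopC n a (k + 1) C₂
  else (k, C)
termination_by n - k

/-- Third loop of the nullspace routine. -/
noncomputable def loopB (n k : ℕ) (C : ℕ → ℕ → ℝ) : ℕ → ℕ → ℝ :=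
  if k + 1 < n then loopB n (k + 1) (write C k (k + 1) 1) else C
termination_by n - k

/-- The nullspace routine: input a vector of length `n`, output an `(n - 1) × n` matrix. -/
noncomputable def nullspace {n : ℕ} (a : Fin n → ℝ) : Matrix (Fin (n - 1)) (Fin n) ℝ :=
  let a₀ : ℕ → ℝ := fun k => if h : k < n then a ⟨k, h⟩ else 0
  let sA := loopA n a₀ 0 (fun _ _ => 0)
  let sC := loopC n a₀ sA.1 (write sA.2 sA.1 sA.1 1)
  let C := loopB n sC.1 sC.2
  fun i j => C i j

/-- The pair of matrices (extraction operator so far, updated input matrix) after `ρ` passes through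
the loop of the extraction algorithm. -/
noncomputable def extractionState {M O : ℕ} (A : Matrix (Fin M) (Fin O) ℝ) :
    (ρ : ℕ) → ρ ≤ O → Matrix (Fin (M - ρ)) (Fin M) ℝ × Matrix (Fin (M - ρ)) (Fin O) ℝ
  | 0, _ => ((1 : Matrix (Fin M) (Fin M) ℝ), A)
  | ρ + 1, h =>
    let s := extractionState A ρ (Nat.le_of_succ_le h)
    let Ct : Matrix (Fin (M - (ρ + 1))) (Fin (M - ρ)) ℝ := nullspace (fun k => s.2 k ⟨ρ, h⟩)
    (Ct * s.1, Ct * s.2)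

/-- The extraction algorithm. -/
noncomputable def extractionOperator {M O : ℕ} (A : Matrix (Fin M) (Fin O) ℝ) :
    Matrix (Fin (M - O)) (Fin M) ℝ :=
  (extractionState A O le_rfl).1

/-! ### One-sided derivatives -/

/-- `D₋ᵏ f(x)`, the limit from the left of the `k`-th derivative. -/
noncomputable def leftDeriv (k : ℕ) (f : ℝ → ℝ) (x : ℝ) : ℝ :=
  Filter.limUnder (nhdsWithin x (Set.Iio x)) (iteratedDeriv k f)

/-- `D₊ᵏ f(x)`, the limit from the right of the `k`-th derivative. -/
noncomputable def rightDeriv (k : ℕ) (f : ℝ → ℝ) (x : ℝ) : ℝ :=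
  Filter.limUnder (nhdsWithin x (Set.Ioi x)) (iteratedDeriv k f)

/-- The jump of the `k`-th derivative at `x`. -/
noncomputable def jump (x : ℝ) (k : ℕ) (f : ℝ → ℝ) : ℝ :=
  leftDeriv k f x - rightDeriv k f x

/-- `f` is exactly `C^r` at `x` (where `r ≥ -1`, and `C^{-1}` means discontinuous). -/
def IsExactlyC (f : ℝ → ℝ) (x : ℝ) (r : ℤ) : Prop :=
  (∀ j : ℕ, (j : ℤ) ≤ r → jump x j f = 0) ∧ jump x (r + 1).toNat f ≠ 0

/-! ### Consecutive blocks: positions `0, 1, 2, …` are split into blocks of sizes `s 0, s 1, …` -/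

/-- Total size of the first `i` blocks. -/
def blockStart (s : ℕ → ℕ) (i : ℕ) : ℕ := ∑ k ∈ Finset.range i, s k

/-- The block that contains position `n`. -/
noncomputable def blockOf (s : ℕ → ℕ) (n : ℕ) : ℕ := sInf {i | n < blockStart s (i + 1)}

/-- The place, counted from `0`, of position `n` inside its block. -/
noncomputable def offset (s : ℕ → ℕ) (n : ℕ) : ℕ := n - blockStart s (blockOf s n)

/-- Number of smoothness constraints at `x (i+1)`. -/
def constraintSizes (r : ℕ → ℤ) (i : ℕ) : ℕ := (r (i + 1) + 1).toNat

/-- The smoothness vector that imposes only the first `ρ` constraints of `r`, where the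
constraints (order of derivative `j ≤ r i` at the breakpoint `x i`) are taken in lexicographic order
of `(i, j)`. -/
def truncate (r : ℕ → ℤ) (ρ : ℕ) (i : ℕ) : ℤ :=
  (min (r i + 1).toNat (ρ - blockStart (constraintSizes r) (i - 1)) : ℕ) - 1

/-! ### Generalized powers and Bernstein functions of one weight system -/

/-- `genPow w c j s` is `w_s(x) ∫_c^x w_{s+1}(y₁) ∫_c^{y₁} ⋯ ∫_c^{y_{j-1}} w_{s+j}(y_j) dy_j ⋯ dy₁`;
the generalized power `u_j` is the case `s = 0`. -/
noncomputable def genPow (w : ℕ → ℝ → ℝ) (c : ℝ) : ℕ → ℕ → ℝ → ℝ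
  | 0, s => w s
  | j + 1, s => fun x => w s x * ∫ y in c..x, genPow w c j (s + 1) y

/-- The Bernstein functions `b_{j,q}`, `0 ≤ j ≤ q ≤ p`, of the weights `w_0, …, w_p` on `[c, d]`. -/
noncomputable def localBernstein (w : ℕ → ℝ → ℝ) (p : ℕ) (c d : ℝ) : ℕ → ℕ → ℝ → ℝ
  | 0, _ => w p
  | q + 1, j => fun x =>
    let f : ℕ → ℝ → ℝ := fun i y =>
      localBernstein w p c d q i y / ∫ t in c..d, localBernstein w p c d q i t
    w (p - (q + 1)) x *
      (if j = 0 then 1 - ∫ y in c..x, f 0 y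
       else if j < q + 1 then ∫ y in c..x, (f (j - 1) y - f j y)
       else ∫ y in c..x, f q y)

/-- Breakpoints `x 0 < x 1 < ⋯ < x m` and, on each interval `[x (i-1), x i]`, `1 ≤ i ≤ m`, a degree
`p i` and positive weights `w i 0, …, w i (p i)` of smoothness `C^{p i - j}`. Values of `x`, `p`, `w`
outside these ranges play no role. -/
structure Data where
  m : ℕ
  one_le_m : 1 ≤ m
  x : ℕ → ℝ
  x_lt : ∀ i < m, x i < x (i + 1)
  p : ℕ → ℕ
  w : ℕ → ℕ → ℝ → ℝ
  w_pos : ∀ i, 1 ≤ i → i ≤ m → ∀ j ≤ p i, ∀ y ∈ Set.Icc (x (i - 1)) (x i), 0 < w i j y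
  w_smooth : ∀ i, 1 ≤ i → i ≤ m → ∀ j ≤ p i,
    ContDiffOn ℝ ((p i - j : ℕ) : ℕ∞) (w i j) (Set.Icc (x (i - 1)) (x i))

namespace Data

variable (D : Data)

/-- `w_0 = 1` on every interval. -/
def IsNormalized : Prop :=
  ∀ i, 1 ≤ i → i ≤ D.m → ∀ y ∈ Set.Icc (D.x (i - 1)) (D.x i), D.w i 0 y = 1

/-- The elements of the partition: half open, except for the last one. -/
def I (i : ℕ) : Set ℝ :=
  if i = D.m then Set.Icc (D.x (i - 1)) (D.x i) else Set.Ico (D.x (i - 1)) (D.x i)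

/-- The ECT-space of the `i`-th interval, restricted to `I i`. -/
noncomputable def T (i : ℕ) : Submodule ℝ (D.I i → ℝ) :=
  Submodule.span ℝ {f | ∃ j ≤ D.p i, f = (D.I i).domRestrict (genPow (D.w i) (D.x (i - 1)) j 0)}

/-- Smoothness vectors `(r_0, …, r_m)`. -/
def IsSmoothness (r : ℕ → ℤ) : Prop :=
  r 0 = -1 ∧ r D.m = -1 ∧
    ∀ i, 1 ≤ i → i < D.m → -1 ≤ r i ∧ r i ≤ min (D.p i : ℤ) (D.p (i + 1) : ℤ)

/-- The weights are admissible for the smoothness vector `r`. -/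
def Admissible (r : ℕ → ℤ) : Prop :=
  ∀ i, 1 ≤ i → i < D.m → ∀ j : ℕ, (j : ℤ) ≤ r i → ∀ l : ℕ, (l : ℤ) ≤ r i - j →
    leftDeriv l (D.w i j) (D.x i) = rightDeriv l (D.w (i + 1) j) (D.x i)

/-- The generalized Tchebycheffian splines of smoothness `r`. A function on `[x 0, x m]` is
represented by its extension by zero to the real line. -/
def splineSpace (r : ℕ → ℤ) : Set (ℝ → ℝ) :=
  {s | (∀ y ∉ Set.Icc (D.x 0) (D.x D.m), s y = 0) ∧
    (∀ i, 1 ≤ i → i ≤ D.m → (D.I i).domRestrict s ∈ D.T i) ∧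
    ∀ i, 1 ≤ i → i < D.m → ∀ j : ℕ, (j : ℤ) ≤ r i → jump (D.x i) j s = 0}

/-- Number of Bernstein functions of the `(i+1)`-st interval. -/
def bernSizes (i : ℕ) : ℕ := D.p (i + 1) + 1

/-- Dimension of the space of discontinuous splines. -/
abbrev M : ℕ := blockStart D.bernSizes D.m

/-- Number of smoothness constraints. -/
abbrev O (r : ℕ → ℤ) : ℕ := blockStart (constraintSizes r) (D.m - 1)

/-- Dimension of the spline space. -/
abbrev N (r : ℕ → ℤ) : ℕ := D.M - D.O r

/-- The global Bernstein function with index `l`, where `l = 0, …, M - 1` runs through the pairs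
`(i, j)`, `1 ≤ i ≤ m`, `0 ≤ j ≤ p i`, in lexicographic order. -/
noncomputable def bernstein (l : ℕ) : ℝ → ℝ :=
  let i := blockOf D.bernSizes l + 1
  (D.I i).indicator
    (localBernstein (D.w i) (D.p i) (D.x (i - 1)) (D.x i) (D.p i) (offset D.bernSizes l))

/-- The input of the extraction algorithm: column `ρ = 0, …, O - 1` holds the jumps of the global
Bernstein functions for the `ρ`-th pair `(i, j)`, `1 ≤ i < m`, `0 ≤ j ≤ r i`, in lexicographic
order. -/
noncomputable def jumpMatrix (r : ℕ → ℤ) : Matrix (Fin D.M) (Fin (D.O r)) ℝ :=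
  fun l ρ => jump (D.x (blockOf (constraintSizes r) ρ + 1)) (offset (constraintSizes r) ρ)
    (D.bernstein l)

/-! The knots `u_k` and `v_k`, with `k` counted from `0`. -/

/-- Multiplicity of `x i` in the first knot vector, `0 ≤ i < m`. -/
def uSizes (r : ℕ → ℤ) (i : ℕ) : ℕ := ((D.p (i + 1) : ℤ) - r i).toNat

/-- Multiplicity of `x (i+1)` in the second knot vector, `0 ≤ i < m`. -/
def vSizes (r : ℕ → ℤ) (i : ℕ) : ℕ := ((D.p (i + 1) : ℤ) - r (i + 1)).toNat

/-- The index `i` with `u_k = x i`. -/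
noncomputable def uIdx (r : ℕ → ℤ) (k : ℕ) : ℕ := blockOf (D.uSizes r) k

/-- The index `j` with `v_k = x j`. -/
noncomputable def vIdx (r : ℕ → ℤ) (k : ℕ) : ℕ := blockOf (D.vSizes r) k + 1

/-- First knot vector. -/
noncomputable def u (r : ℕ → ℤ) (k : ℕ) : ℝ := D.x (D.uIdx r k)

/-- Second knot vector. -/
noncomputable def v (r : ℕ → ℤ) (k : ℕ) : ℝ := D.x (D.vIdx r k)

/-- Smoothness at the start of the support: `p_{i+1} - 1 - max {l ≥ 0 : u_k = u_{k+l}}`. -/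
noncomputable def ru (r : ℕ → ℤ) (k : ℕ) : ℤ :=
  (D.p (D.uIdx r k + 1) : ℤ) - 1 - (sSup {l : ℕ | k + l < D.N r ∧ D.u r k = D.u r (k + l)} : ℕ)

/-- Smoothness at the end of the support: `p_j - 1 - max {l ≥ 0 : v_k = v_{k-l}}`. -/
noncomputable def rv (r : ℕ → ℤ) (k : ℕ) : ℤ :=
  (D.p (D.vIdx r k) : ℤ) - 1 - (sSup {l : ℕ | l ≤ k ∧ D.v r k = D.v r (k - l)} : ℕ)

/-- `μ(i) = ∑_{j=0}^{i-1} (p_{j+1} - r_j)`. -/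
def uCount (r : ℕ → ℤ) (i : ℕ) : ℤ := ∑ j ∈ Finset.range i, ((D.p (j + 1) : ℤ) - r j)

/-- `B` is a GTB-spline basis of the spline space of smoothness `r`. Since `k` is counted from `0`,
the usual index of `B k` is `k + 1`. -/
structure IsGTBBasis (r : ℕ → ℤ) (B : Fin (D.N r) → ℝ → ℝ) : Prop where
  linearIndependent : LinearIndependent ℝ B
  span_eq : (Submodule.span ℝ (Set.range B) : Set (ℝ → ℝ)) = D.splineSpace r
  pos : ∀ k : Fin (D.N r), ∀ y ∈ Set.Ioo (D.u r k) (D.v r k), 0 < B k y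
  support : ∀ k : Fin (D.N r), ∀ y ∉ Set.Icc (D.u r k) (D.v r k), B k y = 0
  partition_of_unity : ∀ y ∈ Set.Icc (D.x 0) (D.x D.m), ∑ k, B k y = 1
  start_smooth : ∀ k : Fin (D.N r), IsExactlyC (B k) (D.u r k) (D.ru r k)
  end_smooth : ∀ k : Fin (D.N r), IsExactlyC (B k) (D.v r k) (D.rv r k)
  local_span : ∀ i, 1 ≤ i → i ≤ D.m →
    Submodule.span ℝ {f | ∃ k : Fin (D.N r), D.uCount r i - D.p i ≤ (k : ℕ) + 1 ∧
      (k : ℕ) + 1 ≤ D.uCount r i ∧ f = (D.I i).domRestrict (B k)} = D.T i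

end Data

end GTSpline

/-!
The proof rests on a combinatorial description of the bases in question. If `c i` smoothness
constraints hold at `x i`, then the `k`-th basis function starts at `x i`, with a first jump in the
derivative of order `s`, exactly if `k = cntV c i + s`, and it ends at `x j`, with a first jump of order
`s`, exactly if `k + 1 + s = cntU c j`. No two functions share start and order, and no two share end and
order; so the first and the last coefficient of a linear combination can be read off from its start and
its end (`Data.HasEnds.coeff_of_starts`, `Data.HasEnds.coeff_of_stops`). In particular a basis of this
kind that sums to `1` is unique (`Data.HasEnds.unique`).

*Extraction.* Let one constraint, of order `c i₀` at `x i₀`, be added. The starts and ends before and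
after differ so little that every new function is a combination `α k • B k + β k • B (k + 1)` of two
consecutive old ones (`Data.CanAdd.exists_bidiagonal`). Partition of unity on both sides makes all column
sums of this bidiagonal matrix equal to `1` (`Data.CanAdd.column_sums`), and each row annihilates the
vector of the jumps that the new constraint forbids. The nonzero entries of that vector are consecutive,
and these conditions leave only one matrix, which is the one that the nullspace routine writes down
(`nullspace_eq`, `Data.CanAdd.eq_nullspace`). Without constraints the basis consists of the global
Bernstein functions (`Data.isGtb_bernBasis`), whose positivity is a zero count by Rolle's theorem
(`IsChain.card_zeros_le`). Induction on the number of constraints gives `Data.extraction`: if a basis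
exists after every pass, the algorithm computes its coefficients.

*Existence for admissible weights.* The same induction constructs the bases. It has to be shown that the
coefficients `α k` and `1 - α (k + 1)` are nonnegative, so that the new functions are positive on their
supports. A spline basis alone does not carry enough information for this; generalized differentiation
provides it. The generalized derivatives of the basis functions are differences, with positive factors,
of functions of a next level, these have generalized derivatives of the same form, and so on, up to a
level at which only two functions have a jump at `x i₀`, with values `1` and `-1`. Going down again, the
jumps alternate in sign at every level (`JumpTable.sign`), and that is what bounds the coefficients
(`JumpTable.coeff_pos`, `JumpTable.coeff_lt_one`). Only the values of these functions at the breakpoints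
matter, and they are recorded in a `Data.Tower`. The Bernstein functions of all levels form a tower
(`Data.tower_bernLevel`), and a step of the construction turns a tower into a tower
(`Data.Tower.step`). Admissibility enters only here: it makes the first jump of an ordinary derivative a
positive multiple of the jump of the generalized derivative of the same order
(`Data.CanAdd.exists_jump_eq`), which rests on a computation with the derivatives at one point
(`IsJet.deriv_eq`). That the combinations obtained in this way are a basis again is `Data.IsGtb.step`.
-/

namespace GTSpline
open Set Filter Topology

/-! ### One-sided derivatives of functions that are smooth up to the breakpoint -/

/-- The one-sided limit of a derivative at an endpoint is the derivative within the closed interval of a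
smooth continuation; this replaces limits by values in all later computations. -/
lemma tendsto_iteratedDeriv_of_eqOn_Ioo {c d e : ℝ} {l : ℕ} {f g : ℝ → ℝ} (hcd : c < d)
    (he : e ∈ Icc c d) (hg : ContDiffOn ℝ l g (Icc c d)) (hfg : EqOn f g (Ioo c d)) :
    Tendsto (iteratedDeriv l f) (𝓝[Ioo c d] e) (𝓝 (iteratedDerivWithin l g (Icc c d) e)) := by
  have h1 : EqOn (iteratedDeriv l f) (iteratedDerivWithin l g (Icc c d)) (Ioo c d) := by
    intro y hy
    have hsub : Ioo c d ⊆ Icc c d := Ioo_subset_Icc_self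
    rw [← iteratedDerivWithin_of_isOpen isOpen_Ioo hy, iteratedDerivWithin_congr hfg hy]
    have h2 : (Ioo c d : Set ℝ) =ᶠ[𝓝 y] Icc c d := by
      filter_upwards [isOpen_Ioo.mem_nhds hy] with z hz
      exact propext ⟨fun h => hsub h, fun _ => hz⟩
    rw [iteratedDerivWithin, iteratedDerivWithin, iteratedFDerivWithin_congr_set h2]
  have h3 := (hg.continuousOn_iteratedDerivWithin le_rfl (uniqueDiffOn_Icc hcd)) e he
  exact (h3.mono_left (nhdsWithin_mono _ Ioo_subset_Icc_self)).congr'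
    (eventually_nhdsWithin_of_forall fun y hy => (h1 hy).symm)

lemma leftDeriv_eq {c e : ℝ} {l : ℕ} {f g : ℝ → ℝ} (hce : c < e)
    (hg : ContDiffOn ℝ l g (Icc c e)) (hfg : EqOn f g (Ioo c e)) :
    leftDeriv l f e = iteratedDerivWithin l g (Icc c e) e := by
  have h := tendsto_iteratedDeriv_of_eqOn_Ioo hce (right_mem_Icc.2 hce.le) hg hfg
  rw [nhdsWithin_Ioo_eq_nhdsLT hce] at h
  exact h.limUnder_eq

lemma rightDeriv_eq {e d : ℝ} {l : ℕ} {f g : ℝ → ℝ} (hed : e < d)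
    (hg : ContDiffOn ℝ l g (Icc e d)) (hfg : EqOn f g (Ioo e d)) :
    rightDeriv l f e = iteratedDerivWithin l g (Icc e d) e := by
  have h := tendsto_iteratedDeriv_of_eqOn_Ioo hed (left_mem_Icc.2 hed.le) hg hfg
  rw [nhdsWithin_Ioo_eq_nhdsGT hed] at h
  exact h.limUnder_eq

/-- Functions that agree on the open interval `(c, d)` with a function that is `C^l` on the closed
interval. -/
def smoothUpTo (c d : ℝ) (l : ℕ) : Submodule ℝ (ℝ → ℝ) where
  carrier := {f | ∃ g, ContDiffOn ℝ l g (Icc c d) ∧ EqOn f g (Ioo c d)}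
  add_mem' := by
    rintro f₁ f₂ ⟨g₁, h₁, e₁⟩ ⟨g₂, h₂, e₂⟩
    exact ⟨g₁ + g₂, h₁.add h₂, fun y hy => by simp [e₁ hy, e₂ hy]⟩
  zero_mem' := ⟨0, contDiffOn_const, fun _ _ => rfl⟩
  smul_mem' := by
    rintro a f ⟨g, h, e⟩
    exact ⟨a • g, h.const_smul a, fun y hy => by simp [e hy]⟩

lemma leftDeriv_add {c e : ℝ} (hce : c < e) {l : ℕ} {f₁ f₂ : ℝ → ℝ} (h₁ : f₁ ∈ smoothUpTo c e l)
    (h₂ : f₂ ∈ smoothUpTo c e l) :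
    leftDeriv l (f₁ + f₂) e = leftDeriv l f₁ e + leftDeriv l f₂ e := by
  obtain ⟨g₁, h₁, e₁⟩ := h₁
  obtain ⟨g₂, h₂, e₂⟩ := h₂
  rw [leftDeriv_eq hce h₁ e₁, leftDeriv_eq hce h₂ e₂,
    leftDeriv_eq (g := g₁ + g₂) hce (h₁.add h₂) fun y hy => by simp [e₁ hy, e₂ hy]]
  have he := right_mem_Icc.2 hce.le
  exact iteratedDerivWithin_add he (uniqueDiffOn_Icc hce) (h₁ e he) (h₂ e he)

lemma rightDeriv_add {e d : ℝ} (hed : e < d) {l : ℕ} {f₁ f₂ : ℝ → ℝ} (h₁ : f₁ ∈ smoothUpTo e d l)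
    (h₂ : f₂ ∈ smoothUpTo e d l) :
    rightDeriv l (f₁ + f₂) e = rightDeriv l f₁ e + rightDeriv l f₂ e := by
  obtain ⟨g₁, h₁, e₁⟩ := h₁
  obtain ⟨g₂, h₂, e₂⟩ := h₂
  rw [rightDeriv_eq hed h₁ e₁, rightDeriv_eq hed h₂ e₂,
    rightDeriv_eq (g := g₁ + g₂) hed (h₁.add h₂) fun y hy => by simp [e₁ hy, e₂ hy]]
  have he := left_mem_Icc.2 hed.le
  exact iteratedDerivWithin_add he (uniqueDiffOn_Icc hed) (h₁ e he) (h₂ e he)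

lemma leftDeriv_smul {c e : ℝ} (hce : c < e) {l : ℕ} {f : ℝ → ℝ} (a : ℝ)
    (h : f ∈ smoothUpTo c e l) : leftDeriv l (a • f) e = a * leftDeriv l f e := by
  obtain ⟨g, h, e₁⟩ := h
  rw [leftDeriv_eq hce h e₁,
    leftDeriv_eq (g := a • g) hce (h.const_smul a) fun y hy => by simp [e₁ hy]]
  simp

lemma rightDeriv_smul {e d : ℝ} (hed : e < d) {l : ℕ} {f : ℝ → ℝ} (a : ℝ)
    (h : f ∈ smoothUpTo e d l) : rightDeriv l (a • f) e = a * rightDeriv l f e := by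
  obtain ⟨g, h, e₁⟩ := h
  rw [rightDeriv_eq hed h e₁,
    rightDeriv_eq (g := a • g) hed (h.const_smul a) fun y hy => by simp [e₁ hy]]
  simp

/-- Functions whose `l`-th derivative has limits from both sides at `e`, because they are smooth up
to `e` on `(c, e)` and on `(e, d)`; the jump at `e` is linear on this space. -/
def jumpSmooth (c e d : ℝ) (l : ℕ) : Submodule ℝ (ℝ → ℝ) := smoothUpTo c e l ⊓ smoothUpTo e d l

/-- The jump of the `l`-th derivative as a linear map. -/
noncomputable def jumpLM {c e d : ℝ} (hce : c < e) (hed : e < d) (l : ℕ) :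
    jumpSmooth c e d l →ₗ[ℝ] ℝ where
  toFun f := jump e l f
  map_add' f g := by
    simp only [jump, Submodule.coe_add, leftDeriv_add hce f.2.1 g.2.1,
      rightDeriv_add hed f.2.2 g.2.2]
    ring
  map_smul' a f := by
    simp only [jump, Submodule.coe_smul, leftDeriv_smul hce a f.2.1, rightDeriv_smul hed a f.2.2,
      RingHom.id_apply, smul_eq_mul]
    ring

lemma jump_sum {c e d : ℝ} (hce : c < e) (hed : e < d) {l : ℕ} {ι : Type*} (s : Finset ι)
    (a : ι → ℝ) (f : ι → ℝ → ℝ) (hf : ∀ k ∈ s, a k ≠ 0 → f k ∈ jumpSmooth c e d l) :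
    jump e l (∑ k ∈ s, a k • f k) = ∑ k ∈ s, a k * jump e l (f k) := by
  classical
  let f' : ι → jumpSmooth c e d l := fun k =>
    if h : f k ∈ jumpSmooth c e d l then ⟨f k, h⟩ else 0
  have h1 : ∀ k ∈ s, a k • f k = ((a k • f' k : jumpSmooth c e d l) : ℝ → ℝ) := by
    intro k hk
    by_cases h0 : a k = 0
    · simp [h0]
    · simp [f', hf k hk h0]
  rw [Finset.sum_congr rfl h1, ← Submodule.coe_sum]
  change jumpLM hce hed l _ = _
  rw [map_sum]
  refine Finset.sum_congr rfl fun k hk => ?_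
  rw [map_smul, smul_eq_mul]
  by_cases h0 : a k = 0
  · simp [h0]
  · congr 1
    change jump e l (f' k) = _
    simp [f', hf k hk h0]

lemma jump_add_smul {c e d : ℝ} (hce : c < e) (hed : e < d) {l : ℕ} (a b : ℝ) {f g : ℝ → ℝ}
    (hf : f ∈ jumpSmooth c e d l) (hg : g ∈ jumpSmooth c e d l) :
    jump e l (a • f + b • g) = a * jump e l f + b * jump e l g := by
  have := jump_sum hce hed (l := l) Finset.univ ![a, b] ![f, g]
    (by intro k _ _; fin_cases k <;> simpa)
  simpa [Fin.sum_univ_two] using this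

lemma smoothUpTo_of_eqOn_zero {c d : ℝ} {l : ℕ} {f : ℝ → ℝ} (h : ∀ y ∈ Ioo c d, f y = 0) :
    f ∈ smoothUpTo c d l := ⟨0, contDiffOn_const, h⟩

lemma leftDeriv_eq_zero {c e : ℝ} (hce : c < e) {l : ℕ} {f : ℝ → ℝ}
    (h : ∀ y ∈ Ioo c e, f y = 0) : leftDeriv l f e = 0 := by
  rw [leftDeriv_eq (g := 0) hce contDiffOn_const h]
  simp

lemma rightDeriv_eq_zero {e d : ℝ} (hed : e < d) {l : ℕ} {f : ℝ → ℝ}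
    (h : ∀ y ∈ Ioo e d, f y = 0) : rightDeriv l f e = 0 := by
  rw [rightDeriv_eq (g := 0) hed contDiffOn_const h]
  simp

/-! ### Chains of generalized derivatives on one interval -/

/-- `g q, g (q+1), …, g p` is a chain of generalized derivatives for the weights `w` on `[c, d]`:
`(g i)' = w (i+1) * g (i+1)`, where `g i = 0` for `i > p`. If `f = w 0 * g 0`, then `g i` is `1 / w i`
times the `i`-th generalized derivative of `f`. -/
structure IsChain (w : ℕ → ℝ → ℝ) (p : ℕ) (c d : ℝ) (q : ℕ) (g : ℕ → ℝ → ℝ) : Prop where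
  deriv : ∀ i, q ≤ i → i ≤ p → ∀ y ∈ Icc c d,
    HasDerivWithinAt (g i) (w (i + 1) y * g (i + 1) y) (Icc c d) y
  zero : ∀ i, p < i → g i = 0

namespace IsChain

variable {w : ℕ → ℝ → ℝ} {p : ℕ} {c d : ℝ} {q : ℕ} {g : ℕ → ℝ → ℝ}

lemma succ (h : IsChain w p c d q g) : IsChain w p c d (q + 1) g :=
  ⟨fun i hi => h.deriv i (by omega), h.zero⟩

lemma continuousOn (h : IsChain w p c d q g) {i : ℕ} (hi : q ≤ i) :
    ContinuousOn (g i) (Icc c d) := by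
  by_cases hp : i ≤ p
  · exact fun y hy => (h.deriv i hi hp y hy).continuousWithinAt
  · rw [h.zero i (by omega)]
    exact continuousOn_const

lemma hasDerivAt (h : IsChain w p c d q g) {i : ℕ} (hi : q ≤ i) (hp : i ≤ p) {y : ℝ}
    (hy : y ∈ Ioo c d) : HasDerivAt (g i) (w (i + 1) y * g (i + 1) y) y :=
  (h.deriv i hi hp y (Ioo_subset_Icc_self hy)).hasDerivAt (Icc_mem_nhds hy.1 hy.2)

lemma add {g' : ℕ → ℝ → ℝ} (h : IsChain w p c d q g) (h' : IsChain w p c d q g') :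
    IsChain w p c d q (g + g') := by
  refine ⟨fun i hi hp y hy => ?_, fun i hi => by simp [h.zero i hi, h'.zero i hi]⟩
  refine ((h.deriv i hi hp y hy).add (h'.deriv i hi hp y hy)).congr_deriv ?_
  simp [mul_add]

lemma smul (a : ℝ) (h : IsChain w p c d q g) : IsChain w p c d q (a • g) := by
  refine ⟨fun i hi hp y hy => ?_, fun i hi => by simp [h.zero i hi]⟩
  refine ((h.deriv i hi hp y hy).const_smul a).congr_deriv ?_
  simp [mul_left_comm]

lemma eqOn_zero (h : IsChain w p c d q g) (hcd : c < d)
    (hw : ∀ i ≤ p, ∀ y ∈ Icc c d, 0 < w i y) (h0 : ∀ y ∈ Icc c d, g q y = 0) (i : ℕ) :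
    ∀ y ∈ Icc c d, g (q + i) y = 0 := by
  induction i generalizing q with
  | zero => exact h0
  | succ i ih =>
    rw [show q + (i + 1) = q + 1 + i by ring]
    refine ih h.succ fun y hy => ?_
    by_cases hq : q + 1 ≤ p
    · have h1 := h.deriv q le_rfl (by omega) y hy
      have h2 : HasDerivWithinAt (g q) 0 (Icc c d) y :=
        (hasDerivWithinAt_const y (Icc c d) (0 : ℝ)).congr h0 (h0 y hy)
      have h3 := (uniqueDiffOn_Icc hcd y hy).eq_deriv _ h1 h2
      exact (mul_eq_zero.1 h3).resolve_left (hw _ hq y hy).ne'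
    · rw [h.zero _ (by omega)]; rfl

lemma eqOn_const (h : IsChain w p c d q g) (hcd : c < d) (hq : q ≤ p)
    (h0 : ∀ y ∈ Icc c d, g (q + 1) y = 0) {y z : ℝ} (hy : y ∈ Icc c d) (hz : z ∈ Icc c d) :
    g q y = g q z := by
  refine (convex_Icc c d).is_const_of_fderivWithin_eq_zero (𝕜 := ℝ) (f := g q)
    (fun x hx => (h.deriv q le_rfl hq x hx).differentiableWithinAt) (fun x hx => ?_) hy hz
  have := h.deriv q le_rfl hq x hx
  rw [h0 x hx, mul_zero] at this
  have h2 := this.hasFDerivWithinAt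
  rw [h2.fderivWithin (uniqueDiffOn_Icc hcd x hx)]
  ext; simp

end IsChain

/-- Rolle's theorem for a finite set of zeros. The last condition on `z` says that the new zeros lie below
the greatest old one, which keeps the next zero apart from them in the induction. -/
lemma exists_finset_deriv_eq_zero {c d : ℝ} {f f' : ℝ → ℝ} (hf : ContinuousOn f (Icc c d))
    (hf' : ∀ y ∈ Ioo c d, HasDerivAt f (f' y) y) (Z : Finset ℝ) (hZ : ∀ z ∈ Z, z ∈ Icc c d)
    (h0 : ∀ z ∈ Z, f z = 0) :
    ∃ Z' : Finset ℝ, (∀ z ∈ Z', z ∈ Ioo c d ∧ f' z = 0 ∧ ∃ y ∈ Z, z < y) ∧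
      Z.card ≤ Z'.card + 1 := by
  induction Z using Finset.induction_on_max with
  | empty => exact ⟨∅, by simp, by simp⟩
  | insert a s hs ih =>
    rcases s.eq_empty_or_nonempty with rfl | hne
    · exact ⟨∅, by simp, by simp⟩
    obtain ⟨Z', hZ', hcard⟩ := ih (fun z hz => hZ z (Finset.mem_insert_of_mem hz))
      (fun z hz => h0 z (Finset.mem_insert_of_mem hz))
    have hm := s.max'_mem hne
    have hma := hs _ hm
    have hmI := hZ _ (Finset.mem_insert_of_mem hm)
    have haI := hZ a (Finset.mem_insert_self _ _)
    obtain ⟨e, he, he0⟩ := exists_hasDerivAt_eq_zero hma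
      (hf.mono (Icc_subset_Icc hmI.1 haI.2))
      (by rw [h0 _ (Finset.mem_insert_of_mem hm), h0 a (Finset.mem_insert_self _ _)])
      (fun x hx => hf' x ⟨hmI.1.trans_lt hx.1, hx.2.trans_le haI.2⟩)
    have hnot : e ∉ Z' := by
      intro h
      obtain ⟨-, -, y, hy, hlt⟩ := hZ' e h
      exact absurd (he.1.trans hlt) (not_lt.2 (s.le_max' y hy))
    refine ⟨insert e Z', ?_, ?_⟩
    · intro z hz
      rcases Finset.mem_insert.1 hz with rfl | hz
      · exact ⟨⟨hmI.1.trans_lt he.1, he.2.trans_le haI.2⟩, he0, a, Finset.mem_insert_self _ _, he.2⟩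
      · obtain ⟨h1, h2, y, hy, hlt⟩ := hZ' z hz
        exact ⟨h1, h2, y, Finset.mem_insert_of_mem hy, hlt⟩
    · rw [Finset.card_insert_of_notMem hnot]
      exact (Finset.card_insert_le _ _).trans (by omega)

/-- The zero count in an extended Tchebycheff space of dimension `Q + 1`: a nonzero element that
vanishes to the order `a` at `c` and to the order `b` at `d` has at most `Q - a - b` zeros between. -/
lemma IsChain.card_zeros_le {w : ℕ → ℝ → ℝ} {p : ℕ} {c d : ℝ} (hcd : c < d)
    (hw : ∀ i ≤ p, ∀ y ∈ Icc c d, 0 < w i y) {g : ℕ → ℝ → ℝ} (Q : ℕ) :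
    ∀ q, q + Q = p → IsChain w p c d q g → ∀ a b, (∀ i < a, g (q + i) c = 0) →
      (∀ i < b, g (q + i) d = 0) → ∀ Z : Finset ℝ, (∀ z ∈ Z, z ∈ Ioo c d ∧ g q z = 0) →
      (∃ y ∈ Icc c d, g q y ≠ 0) → Z.card + a + b ≤ Q := by
  have hc : c ∈ Icc c d := left_mem_Icc.2 hcd.le
  have hd : d ∈ Icc c d := right_mem_Icc.2 hcd.le
  -- if the derivative vanishes, `g q` is a nonzero constant
  have key : ∀ q Q, q + Q = p → IsChain w p c d q g → ∀ a b, (∀ i < a, g (q + i) c = 0) →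
      (∀ i < b, g (q + i) d = 0) → ∀ Z : Finset ℝ, (∀ z ∈ Z, z ∈ Ioo c d ∧ g q z = 0) →
      (∃ y ∈ Icc c d, g q y ≠ 0) → (∀ y ∈ Icc c d, g (q + 1) y = 0) → Z.card + a + b ≤ Q := by
    intro q Q hq hg a b ha hb Z hZ ⟨y, hy, hy0⟩ h1
    have hconst : ∀ z ∈ Icc c d, g q z ≠ 0 := fun z hz h =>
      hy0 (by rw [hg.eqOn_const hcd (by omega) h1 hy hz, h])
    have ha0 : a = 0 := by
      by_contra h
      exact hconst c hc (by simpa using ha 0 (by omega))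
    have hb0 : b = 0 := by
      by_contra h
      exact hconst d hd (by simpa using hb 0 (by omega))
    have hZ0 : Z = ∅ := by
      rw [Finset.eq_empty_iff_forall_notMem]
      exact fun z hz => hconst z (Ioo_subset_Icc_self (hZ z hz).1) (hZ z hz).2
    simp [ha0, hb0, hZ0]
  induction Q with
  | zero =>
    intro q hq hg a b ha hb Z hZ hne
    refine key q 0 hq hg a b ha hb Z hZ hne fun y _ => ?_
    rw [hg.zero _ (by omega)]; rfl
  | succ Q ih =>
    intro q hq hg a b ha hb Z hZ hne
    by_cases h1 : ∀ y ∈ Icc c d, g (q + 1) y = 0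
    · exact key q (Q + 1) hq hg a b ha hb Z hZ hne h1
    push Not at h1
    classical
    -- Rolle's theorem is applied to the zeros in between together with those endpoints that are zeros;
    -- the order of vanishing at these drops by one
    let A : Finset ℝ := if a = 0 then ∅ else {c}
    let B : Finset ℝ := if b = 0 then ∅ else {d}
    have hZA : Disjoint Z A := by
      rw [Finset.disjoint_left]
      intro z hz hA
      by_cases ha0 : a = 0
      · simp [A, ha0] at hA
      · simp only [A, ha0, if_false, Finset.mem_singleton] at hA
        exact absurd (hZ z hz).1.1 (by rw [hA]; exact lt_irrefl _)
    have hZB : Disjoint (Z ∪ A) B := by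
      rw [Finset.disjoint_left]
      intro z hz hB
      by_cases hb0 : b = 0
      · simp [B, hb0] at hB
      · simp only [B, hb0, if_false, Finset.mem_singleton] at hB
        rcases Finset.mem_union.1 hz with hz | hz
        · exact absurd (hZ z hz).1.2 (by rw [hB]; exact lt_irrefl _)
        · by_cases ha0 : a = 0
          · simp [A, ha0] at hz
          · simp only [A, ha0, if_false, Finset.mem_singleton] at hz
            exact hcd.ne (hz.symm.trans hB)
    have hmem : ∀ z ∈ Z ∪ A ∪ B, z ∈ Icc c d ∧ g q z = 0 := by
      intro z hz
      rcases Finset.mem_union.1 hz with hz | hz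
      · rcases Finset.mem_union.1 hz with hz | hz
        · exact ⟨Ioo_subset_Icc_self (hZ z hz).1, (hZ z hz).2⟩
        · by_cases ha0 : a = 0
          · simp [A, ha0] at hz
          · simp only [A, ha0, if_false, Finset.mem_singleton] at hz
            subst hz
            exact ⟨hc, by simpa using ha 0 (by omega)⟩
      · by_cases hb0 : b = 0
        · simp [B, hb0] at hz
        · simp only [B, hb0, if_false, Finset.mem_singleton] at hz
          subst hz
          exact ⟨hd, by simpa using hb 0 (by omega)⟩
    obtain ⟨Z', hZ', hcard⟩ := exists_finset_deriv_eq_zero (hg.continuousOn le_rfl)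
      (fun y hy => hg.hasDerivAt le_rfl (by omega) hy) (Z ∪ A ∪ B) (fun z hz => (hmem z hz).1)
      (fun z hz => (hmem z hz).2)
    have := ih (q + 1) (by omega) hg.succ (a - 1) (b - 1)
      (fun i hi => by rw [show q + 1 + i = q + (i + 1) by ring]; exact ha _ (by omega))
      (fun i hi => by rw [show q + 1 + i = q + (i + 1) by ring]; exact hb _ (by omega)) Z'
      (fun z hz => ⟨(hZ' z hz).1, (mul_eq_zero.1 (hZ' z hz).2.1).resolve_left
        (hw _ (by omega) z (Ioo_subset_Icc_self (hZ' z hz).1)).ne'⟩) h1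
    rw [Finset.card_union_of_disjoint hZB, Finset.card_union_of_disjoint hZA] at hcard
    have hA : A.card + (a - 1) = a := by
      by_cases ha0 : a = 0 <;> simp [A, ha0]; omega
    have hB : B.card + (b - 1) = b := by
      by_cases hb0 : b = 0 <;> simp [B, hb0]; omega
    omega

/-- An element whose first nonzero generalized derivative at `c` is positive is positive just after
`c`. -/
lemma IsChain.exists_pos_near_left {w : ℕ → ℝ → ℝ} {p : ℕ} {c d : ℝ} (hcd : c < d)
    (hw : ∀ i ≤ p, ∀ y ∈ Icc c d, 0 < w i y) {g : ℕ → ℝ → ℝ} (a : ℕ) :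
    ∀ q, q + a ≤ p → IsChain w p c d q g → (∀ i < a, g (q + i) c = 0) → 0 < g (q + a) c →
      ∃ e ∈ Ioc c d, ∀ y ∈ Ioo c e, 0 < g q y := by
  have hc : c ∈ Icc c d := left_mem_Icc.2 hcd.le
  induction a with
  | zero =>
    intro q hq hg _ hpos
    have h1 : ∀ᶠ y in 𝓝[Icc c d] c, 0 < g q y :=
      (hg.continuousOn le_rfl c hc).eventually (lt_mem_nhds hpos)
    rw [nhdsWithin_Icc_eq_nhdsGE hcd] at h1
    obtain ⟨e, he, hsub⟩ := (mem_nhdsGE_iff_exists_Ico_subset' hcd).1 h1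
    refine ⟨min e d, ⟨lt_min he hcd, min_le_right _ _⟩, fun y hy => ?_⟩
    exact hsub ⟨hy.1.le, hy.2.trans_le (min_le_left _ _)⟩
  | succ a ih =>
    intro q hq hg h0 hpos
    obtain ⟨e, he, hpe⟩ := ih (q + 1) (by omega) hg.succ
      (fun i hi => by rw [show q + 1 + i = q + (i + 1) by ring]; exact h0 _ (by omega))
      (by rw [show q + 1 + a = q + (a + 1) by ring]; exact hpos)
    refine ⟨e, he, fun y hy => ?_⟩
    have hmono : StrictMonoOn (g q) (Icc c e) := by
      refine strictMonoOn_of_deriv_pos (convex_Icc c e)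
        ((hg.continuousOn le_rfl).mono (Icc_subset_Icc_right he.2)) fun x hx => ?_
      rw [interior_Icc] at hx
      have hx' : x ∈ Ioo c d := ⟨hx.1, hx.2.trans_le he.2⟩
      rw [(hg.hasDerivAt le_rfl (by omega) hx').deriv]
      exact mul_pos (hw _ (by omega) x (Ioo_subset_Icc_self hx')) (hpe x hx)
    have := hmono (left_mem_Icc.2 he.1.le) (Ioo_subset_Icc_self hy) hy.1
    rwa [show g q c = 0 by simpa using h0 0 (by omega)] at this

/-- Elements with the maximal number of zeros at the endpoints are positive in between. -/
lemma IsChain.pos_of_zeros {w : ℕ → ℝ → ℝ} {p : ℕ} {c d : ℝ} (hcd : c < d)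
    (hw : ∀ i ≤ p, ∀ y ∈ Icc c d, 0 < w i y) {g : ℕ → ℝ → ℝ} {q a b : ℕ} (hq : q + a + b = p)
    (hg : IsChain w p c d q g) (ha : ∀ i < a, g (q + i) c = 0) (hb : ∀ i < b, g (q + i) d = 0)
    (hpos : 0 < g (q + a) c) : ∀ y ∈ Ioo c d, 0 < g q y := by
  have hc : c ∈ Icc c d := left_mem_Icc.2 hcd.le
  have hne : ∃ y ∈ Icc c d, g q y ≠ 0 := by
    by_contra! h
    exact hpos.ne' (hg.eqOn_zero hcd hw h a c hc)
  have hnz : ∀ y ∈ Ioo c d, g q y ≠ 0 := by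
    intro y hy h0
    have := IsChain.card_zeros_le hcd hw (a + b) q (by omega) hg a b ha hb {y}
      (by simpa using ⟨hy, h0⟩) hne
    simp at this
  obtain ⟨e, he, hpe⟩ := IsChain.exists_pos_near_left hcd hw a q (by omega) hg ha hpos
  intro y hy
  by_contra! hle
  -- a sign change between a point close to `c` and `y` would produce a zero too many
  obtain ⟨z, hz⟩ : ∃ z, z ∈ Ioo c (min e y) := nonempty_Ioo.2 (lt_min he.1 hy.1)
  have hze := hpe z ⟨hz.1, hz.2.trans_le (min_le_left _ _)⟩
  have hzy : z < y := hz.2.trans_le (min_le_right _ _)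
  have hcont : ContinuousOn (g q) (Icc z y) :=
    (hg.continuousOn le_rfl).mono (Icc_subset_Icc hz.1.le hy.2.le)
  obtain ⟨x, hx, hx0⟩ := intermediate_value_Icc' hzy.le hcont ⟨hle, hze.le⟩
  exact hnz x ⟨hz.1.trans_le hx.1, hx.2.trans_lt hy.2⟩ hx0

/-! ### Bernstein functions of one interval -/

/-- The Bernstein functions of the weights `w q, …, w p`, indexed by `q ≤ s ≤ p` and extended by zero
to all other `s`. With the index `s` instead of `s - q`, the generalized derivative of the `s`-th
function of level `q` combines the functions `s` and `s + 1` of level `q + 1`. -/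
noncomputable def bern (w : ℕ → ℝ → ℝ) (p : ℕ) (c d : ℝ) (q s : ℕ) : ℝ → ℝ :=
  if q ≤ s ∧ s ≤ p then localBernstein w p c d (p - q) (s - q) else 0

/-- The normalizing factor `1 / ∫ bern (q+1) s`, and `1` if that function is zero. -/
noncomputable def bernGamma (w : ℕ → ℝ → ℝ) (p : ℕ) (c d : ℝ) (q s : ℕ) : ℝ :=
  if 0 < ∫ t in c..d, bern w p c d (q + 1) s t then (∫ t in c..d, bern w p c d (q + 1) s t)⁻¹
  else 1

/-- The chain of generalized derivatives of `bern q s`, with index `δ` counted from `0`. -/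
noncomputable def bernChain (w : ℕ → ℝ → ℝ) (p : ℕ) (c d : ℝ) : ℕ → ℕ → ℕ → ℝ → ℝ
  | 0, q, s => fun y => bern w p c d q s y / w q y
  | δ + 1, q, s => fun y =>
    bernGamma w p c d q s * bernChain w p c d δ (q + 1) s y -
      bernGamma w p c d q (s + 1) * bernChain w p c d δ (q + 1) (s + 1) y

/-- An interval with positive weights `w 0, …, w p`, with `w j` of class `C^{p - j}`. -/
structure IsWeights (w : ℕ → ℝ → ℝ) (p : ℕ) (c d : ℝ) : Prop where
  lt : c < d
  pos : ∀ j ≤ p, ∀ y ∈ Icc c d, 0 < w j y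
  smooth : ∀ j ≤ p, ContDiffOn ℝ (p - j : ℕ) (w j) (Icc c d)

/-- The fundamental theorem of calculus within a closed interval, for an integrand that is continuous only
there. -/
lemma hasDerivWithinAt_integral {c d : ℝ} (hcd : c < d) {f : ℝ → ℝ}
    (hf : ContinuousOn f (Icc c d)) {y : ℝ} (hy : y ∈ Icc c d) :
    HasDerivWithinAt (fun y => ∫ t in c..y, f t) (f y) (Icc c d) y := by
  have h1 : Continuous (IccExtend hcd.le ((Icc c d).domRestrict f)) :=
    (continuousOn_iff_continuous_domRestrict.1 hf).Icc_extend'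
  have h2 := (intervalIntegral.integral_hasDerivAt_right (h1.intervalIntegrable c y)
    h1.stronglyMeasurable.stronglyMeasurableAtFilter h1.continuousAt).hasDerivWithinAt (s := Icc c d)
  have h3 : ∀ z ∈ Icc c d, IccExtend hcd.le ((Icc c d).domRestrict f) z = f z := fun z hz => by
    rw [IccExtend_of_mem _ _ hz]; rfl
  rw [h3 y hy] at h2
  have h4 : ∀ z ∈ Icc c d, ∫ t in c..z, f t =
      ∫ t in c..z, IccExtend hcd.le ((Icc c d).domRestrict f) t := fun z hz =>
    intervalIntegral.integral_congr fun t ht => by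
      rw [uIcc_of_le hz.1] at ht
      exact (h3 t ⟨ht.1, ht.2.trans hz.2⟩).symm
  exact h2.congr h4 (h4 y hy)

section

variable {w : ℕ → ℝ → ℝ} {p : ℕ} {c d : ℝ}

lemma bernGamma_pos (q s : ℕ) : 0 < bernGamma w p c d q s := by
  unfold bernGamma
  split_ifs with h
  · exact inv_pos.2 h
  · exact one_pos

lemma bern_eq_zero {q s : ℕ} (h : ¬ (q ≤ s ∧ s ≤ p)) : bern w p c d q s = 0 := if_neg h

lemma IsWeights.continuousOn (h : IsWeights w p c d) {j : ℕ} (hj : j ≤ p) :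
    ContinuousOn (w j) (Icc c d) := (h.smooth j hj).continuousOn

/-- The normalized integral of `bern (q+1) s`. -/
noncomputable def bernInt (w : ℕ → ℝ → ℝ) (p : ℕ) (c d : ℝ) (q s : ℕ) (y : ℝ) : ℝ :=
  bernGamma w p c d q s * ∫ t in c..y, bern w p c d (q + 1) s t

/-- There is no function `bern (q+1) s` for these `s`. -/
lemma bernInt_eq_zero {q s : ℕ} (h : ¬ (q < s ∧ s ≤ p)) (y : ℝ) : bernInt w p c d q s y = 0 := by
  simp [bernInt, bern_eq_zero (w := w) (c := c) (d := d) (q := q + 1) (s := s) h]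

/-- The properties of the Bernstein functions of level `q` that the induction on `q` provides. -/
structure BernGood (w : ℕ → ℝ → ℝ) (p : ℕ) (c d : ℝ) (q : ℕ) : Prop where
  eq : ∀ s, q ≤ s → s ≤ p → ∀ y ∈ Icc c d, bern w p c d q s y =
    w q y * ((if s = q then 1 else 0) + bernInt w p c d q s y - bernInt w p c d q (s + 1) y)
  int : ∀ s, q < s → s ≤ p → bernInt w p c d q s d = 1
  cont : ∀ s, ContinuousOn (bern w p c d q s) (Icc c d)
  left : ∀ s, bern w p c d q s c = if s = q then w q c else 0
  right : ∀ s, bern w p c d q s d = if s = p then w q d else 0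
  deriv : ∀ s, ∀ y ∈ Icc c d, HasDerivWithinAt (bernChain w p c d 0 q s)
    (bernGamma w p c d q s * bern w p c d (q + 1) s y -
      bernGamma w p c d q (s + 1) * bern w p c d (q + 1) (s + 1) y) (Icc c d) y
  pos : ∀ s, q ≤ s → s ≤ p → ∀ y ∈ Ioo c d, 0 < bern w p c d q s y

lemma bernChain_eq_zero {δ q : ℕ} (h : p < q + δ) (s : ℕ) : bernChain w p c d δ q s = 0 := by
  induction δ generalizing q s with
  | zero =>
    funext y
    simp [bernChain, bern_eq_zero (w := w) (c := c) (d := d) (q := q) (s := s)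
      (p := p) (by omega)]
  | succ δ ih =>
    funext y
    simp [bernChain, ih (q := q + 1) (by omega)]

/-- A family is a chain of generalized derivatives as soon as the derivatives of the functions
`bern q s / w q` are as stated in `BernGood.deriv`. -/
lemma isChain_bernChain (hw : IsWeights w p c d) {q₀ : ℕ}
    (hd : ∀ q, q₀ ≤ q → q ≤ p → ∀ s, ∀ y ∈ Icc c d, HasDerivWithinAt (bernChain w p c d 0 q s)
    (bernGamma w p c d q s * bern w p c d (q + 1) s y -
      bernGamma w p c d q (s + 1) * bern w p c d (q + 1) (s + 1) y) (Icc c d) y) (s : ℕ) :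
    IsChain w p c d q₀ (fun i => bernChain w p c d (i - q₀) q₀ s) := by
  have key : ∀ δ q, q₀ ≤ q → q + δ ≤ p → ∀ s, ∀ y ∈ Icc c d,
      HasDerivWithinAt (bernChain w p c d δ q s)
        (w (q + δ + 1) y * bernChain w p c d (δ + 1) q s y) (Icc c d) y := by
    intro δ
    induction δ with
    | zero =>
      intro q hq hp s y hy
      refine (hd q hq (by omega) s y hy).congr_deriv ?_
      by_cases h : q + 1 ≤ p
      · have := (hw.pos (q + 1) h y hy).ne'
        simp only [bernChain, add_zero]
        field_simp
      · simp [bernChain, bern_eq_zero (w := w) (c := c) (d := d) (q := q + 1) (p := p)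
          (s := s) (by omega), bern_eq_zero (w := w) (c := c) (d := d) (q := q + 1) (p := p)
          (s := s + 1) (by omega)]
    | succ δ ih =>
      intro q hq hp s y hy
      have h1 := ih (q + 1) (by omega) (by omega) s y hy
      have h2 := ih (q + 1) (by omega) (by omega) (s + 1) y hy
      refine ((h1.const_mul (bernGamma w p c d q s)).sub
        (h2.const_mul (bernGamma w p c d q (s + 1)))).congr_deriv ?_
      rw [show q + (δ + 1) + 1 = q + 1 + δ + 1 by ring]
      simp only [bernChain]
      ring
  refine ⟨fun i hi hp y hy => ?_, fun i hi => bernChain_eq_zero (by omega) s⟩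
  have := key (i - q₀) q₀ le_rfl (by omega) s y hy
  rwa [show q₀ + (i - q₀) + 1 = i + 1 by omega, show i - q₀ + 1 = i + 1 - q₀ by omega] at this

/-- The order of vanishing at the left endpoint. The hypothesis on the values at that endpoint is restricted
to the levels from `q₀` on because these are the levels that a downward induction has treated. -/
lemma bernChain_left_eq_zero {q₀ : ℕ}
    (hl : ∀ q, q₀ ≤ q → q ≤ p → ∀ s, bern w p c d q s c = if s = q then w q c else 0)
    (δ : ℕ) : ∀ q, q₀ ≤ q → ∀ s, q + δ < s → bernChain w p c d δ q s c = 0 := by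
  induction δ with
  | zero =>
    intro q hq s hs
    by_cases h : q ≤ p
    · simp [bernChain, hl q hq h, show s ≠ q by omega]
    · rw [bernChain_eq_zero (by omega)]; rfl
  | succ δ ih =>
    intro q hq s hs
    simp [bernChain, ih (q + 1) (by omega) s (by omega), ih (q + 1) (by omega) (s + 1) (by omega)]

/-- The first generalized derivative that does not vanish at the left endpoint is positive there. -/
lemma bernChain_left_pos (hw : IsWeights w p c d) {q₀ : ℕ}
    (hl : ∀ q, q₀ ≤ q → q ≤ p → ∀ s, bern w p c d q s c = if s = q then w q c else 0)
    (δ : ℕ) : ∀ q, q₀ ≤ q → q + δ ≤ p → 0 < bernChain w p c d δ q (q + δ) c := by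
  induction δ with
  | zero =>
    intro q hq hp
    have := hw.pos q hp c (left_mem_Icc.2 hw.lt.le)
    simp [bernChain, hl q hq (by omega), this.ne']
  | succ δ ih =>
    intro q hq hp
    simp only [bernChain]
    rw [bernChain_left_eq_zero hl δ (q + 1) (by omega) (q + (δ + 1) + 1) (by omega),
      show q + (δ + 1) = q + 1 + δ by ring]
    have := ih (q + 1) (by omega) (by omega)
    have h2 := bernGamma_pos (w := w) (p := p) (c := c) (d := d) q (q + 1 + δ)
    rw [mul_zero, sub_zero]
    positivity

/-- The order of vanishing at the right endpoint. -/
lemma bernChain_right_eq_zero {q₀ : ℕ}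
    (hr : ∀ q, q₀ ≤ q → q ≤ p → ∀ s, bern w p c d q s d = if s = p then w q d else 0)
    (δ : ℕ) : ∀ q, q₀ ≤ q → ∀ s, s + δ < p → bernChain w p c d δ q s d = 0 := by
  induction δ with
  | zero =>
    intro q hq s hs
    by_cases h : q ≤ p
    · simp [bernChain, hr q hq h, show s ≠ p by omega]
    · rw [bernChain_eq_zero (by omega)]; rfl
  | succ δ ih =>
    intro q hq s hs
    simp [bernChain, ih (q + 1) (by omega) s (by omega), ih (q + 1) (by omega) (s + 1) (by omega)]

lemma bernChain_right_ne_zero (hw : IsWeights w p c d) {q₀ : ℕ}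
    (hr : ∀ q, q₀ ≤ q → q ≤ p → ∀ s, bern w p c d q s d = if s = p then w q d else 0)
    (δ : ℕ) : ∀ q, q₀ ≤ q → ∀ s, q ≤ s → s + δ = p → bernChain w p c d δ q s d ≠ 0 := by
  induction δ with
  | zero =>
    intro q hq s hqs hs
    have := hw.pos q (by omega) d (right_mem_Icc.2 hw.lt.le)
    simp [bernChain, hr q hq (by omega), this.ne', show s = p by omega]
  | succ δ ih =>
    intro q hq s hqs hs
    simp only [bernChain]
    rw [bernChain_right_eq_zero hr δ (q + 1) (by omega) s (by omega)]
    have := ih (q + 1) (by omega) (s + 1) (by omega) (by omega)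
    have h2 := bernGamma_pos (w := w) (p := p) (c := c) (d := d) q (s + 1)
    rw [mul_zero, zero_sub]
    exact neg_ne_zero.2 (mul_ne_zero h2.ne' this)

lemma bern_self_eq : bern w p c d p p = w p := by simp [bern, localBernstein]

/-- The recursion of the Bernstein functions in terms of the normalized integrals. -/
lemma bern_eq {q : ℕ} (hq : q < p)
    (hcont : ∀ s, ContinuousOn (bern w p c d (q + 1) s) (Icc c d)) (hpos : ∀ s, q + 1 ≤ s → s ≤ p →
      0 < ∫ t in c..d, bern w p c d (q + 1) s t) {s : ℕ} (hqs : q ≤ s) (hs : s ≤ p) {y : ℝ}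
    (hy : y ∈ Icc c d) : bern w p c d q s y =
      w q y * ((if s = q then 1 else 0) + bernInt w p c d q s y - bernInt w p c d q (s + 1) y) := by
  obtain ⟨Q, hQ⟩ : ∃ Q, p = q + 1 + Q := ⟨p - (q + 1), by omega⟩
  have hint : ∀ s, IntervalIntegrable (bern w p c d (q + 1) s) MeasureTheory.volume c y := fun s =>
    (((hcont s).mono (Icc_subset_Icc_right hy.2)).mono
      (by rw [uIcc_of_le hy.1])).intervalIntegrable
  have hb : ∀ s', q + 1 ≤ s' → s' ≤ p →
      localBernstein w p c d Q (s' - (q + 1)) = bern w p c d (q + 1) s' := fun s' h1 h2 => by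
    rw [bern, if_pos ⟨h1, h2⟩, show p - (q + 1) = Q by omega]
  have hB : ∀ s', q + 1 ≤ s' → s' ≤ p →
      (∫ z in c..y, bern w p c d (q + 1) s' z / ∫ t in c..d, bern w p c d (q + 1) s' t) =
        bernInt w p c d q s' y := fun s' h1 h2 => by
    rw [intervalIntegral.integral_div, bernInt, bernGamma, if_pos (hpos s' h1 h2), div_eq_inv_mul]
  conv_lhs => rw [bern, if_pos ⟨hqs, hs⟩, show p - q = Q + 1 by omega, localBernstein]
  simp only
  rw [show p - (Q + 1) = q by omega]
  congr 1
  by_cases h0 : s = q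
  · subst h0
    have h1 := hb (s + 1) le_rfl (by omega)
    rw [Nat.sub_self] at h1
    simp only [Nat.sub_self, if_true, h1, hB (s + 1) le_rfl (by omega)]
    rw [bernInt_eq_zero (s := s) (by omega)]
    ring
  · rw [if_neg (by omega), if_neg h0]
    by_cases h2 : s < p
    · rw [if_pos (by omega)]
      have e1 := hb s (by omega) hs
      have e2 := hb (s + 1) (by omega) (by omega)
      rw [show s - (q + 1) = s - q - 1 by omega] at e1
      rw [show s + 1 - (q + 1) = s - q by omega] at e2
      rw [e1, e2, intervalIntegral.integral_sub ((hint s).div_const _) ((hint (s + 1)).div_const _),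
        hB s (by omega) hs, hB (s + 1) (by omega) (by omega)]
      ring
    · rw [if_neg (by omega)]
      have e1 := hb s (by omega) hs
      rw [show s - (q + 1) = Q by omega] at e1
      rw [e1, hB s (by omega) hs, bernInt_eq_zero (s := s + 1) (by omega)]
      ring

/-- Downward induction on the level. Positivity follows from the order of vanishing at the endpoints, which
is maximal; in turn it is what makes the integrals in the definition of the next lower level nonzero. -/
lemma bernGood (hw : IsWeights w p c d) : ∀ q ≤ p, BernGood w p c d q := by
  have hc : c ∈ Icc c d := left_mem_Icc.2 hw.lt.le
  have hd : d ∈ Icc c d := right_mem_Icc.2 hw.lt.le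
  have key : ∀ Q q, q + Q = p → BernGood w p c d q := by
    intro Q
    induction Q using Nat.strong_induction_on with
    | h Q ih =>
    intro q hQ
    have good : ∀ q', q < q' → q' ≤ p → BernGood w p c d q' := fun q' h1 h2 =>
      ih (p - q') (by omega) q' (by omega)
    have hcont1 : ∀ s, ContinuousOn (bern w p c d (q + 1) s) (Icc c d) := by
      intro s
      by_cases h : q + 1 ≤ p
      · exact (good (q + 1) (by omega) h).cont s
      · rw [bern_eq_zero (by omega)]; exact continuousOn_const
    have hpos1 : ∀ s, q + 1 ≤ s → s ≤ p → 0 < ∫ t in c..d, bern w p c d (q + 1) s t := by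
      intro s h1 h2
      exact intervalIntegral.intervalIntegral_pos_of_pos_on
        ((hcont1 s).mono (by rw [uIcc_of_le hw.lt.le])).intervalIntegrable
        (fun y hy => (good (q + 1) (by omega) (by omega)).pos s h1 h2 y hy) hw.lt
    have heq : ∀ s, q ≤ s → s ≤ p → ∀ y ∈ Icc c d, bern w p c d q s y =
        w q y * ((if s = q then 1 else 0) + bernInt w p c d q s y -
          bernInt w p c d q (s + 1) y) := by
      intro s hqs hs y hy
      rcases Nat.lt_or_ge q p with h | h
      · exact bern_eq h hcont1 hpos1 hqs hs hy
      · obtain rfl : q = p := by omega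
        obtain rfl : s = q := by omega
        rw [bern_self_eq, bernInt_eq_zero (by omega), bernInt_eq_zero (by omega)]
        simp
    have hint : ∀ s, q < s → s ≤ p → bernInt w p c d q s d = 1 := by
      intro s h1 h2
      rw [bernInt, bernGamma, if_pos (hpos1 s h1 h2)]
      exact inv_mul_cancel₀ (hpos1 s h1 h2).ne'
    have hI : ∀ s, ∀ y ∈ Icc c d, HasDerivWithinAt (bernInt w p c d q s)
        (bernGamma w p c d q s * bern w p c d (q + 1) s y) (Icc c d) y := fun s y hy =>
      (hasDerivWithinAt_integral hw.lt (hcont1 s) hy).const_mul _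
    have hderiv : ∀ s, ∀ y ∈ Icc c d, HasDerivWithinAt (bernChain w p c d 0 q s)
        (bernGamma w p c d q s * bern w p c d (q + 1) s y -
        bernGamma w p c d q (s + 1) * bern w p c d (q + 1) (s + 1) y) (Icc c d) y := by
      intro s y hy
      by_cases h : q ≤ s ∧ s ≤ p
      · have h1 : ∀ z ∈ Icc c d, bernChain w p c d 0 q s z = (if s = q then 1 else 0) +
            (bernInt w p c d q s z - bernInt w p c d q (s + 1) z) := fun z hz => by
          have := (hw.pos q (by omega) z hz).ne'
          simp only [bernChain]
          rw [heq s h.1 h.2 z hz]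
          field_simp
          ring
        exact ((((hI s y hy).sub (hI (s + 1) y hy)).const_add _)).congr h1 (h1 y hy)
      · have h1 : bernChain w p c d 0 q s = 0 := by
          funext z; simp [bernChain, bern_eq_zero h]
        rw [h1, bern_eq_zero (q := q + 1) (s := s) (by omega),
          bern_eq_zero (q := q + 1) (s := s + 1) (by omega)]
        exact (hasDerivWithinAt_const y (Icc c d) (0 : ℝ)).congr_deriv (by simp)
    have hcont : ∀ s, ContinuousOn (bern w p c d q s) (Icc c d) := by
      intro s
      have h1 : ContinuousOn (bernChain w p c d 0 q s) (Icc c d) :=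
        fun y hy => (hderiv s y hy).continuousWithinAt
      refine ((hw.continuousOn (show q ≤ p by omega)).mul h1).congr fun y hy => ?_
      have := (hw.pos q (by omega) y hy).ne'
      simp only [bernChain, Pi.mul_apply]
      field_simp
    have hleft : ∀ s, bern w p c d q s c = if s = q then w q c else 0 := by
      intro s
      by_cases h : q ≤ s ∧ s ≤ p
      · rw [heq s h.1 h.2 c hc]
        simp [bernInt]
      · rw [bern_eq_zero h, if_neg (by omega)]; rfl
    have hright : ∀ s, bern w p c d q s d = if s = p then w q d else 0 := by
      intro s
      by_cases h : q ≤ s ∧ s ≤ p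
      · rw [heq s h.1 h.2 d hd]
        by_cases h1 : s = p
        · subst h1
          rw [bernInt_eq_zero (s := s + 1) (by omega), if_pos rfl]
          by_cases h2 : s = q
          · rw [if_pos h2, bernInt_eq_zero (s := s) (by omega)]; ring
          · rw [if_neg h2, hint s (by omega) le_rfl]; ring
        · rw [hint (s + 1) (by omega) (by omega), if_neg h1]
          by_cases h2 : s = q
          · rw [if_pos h2, bernInt_eq_zero (s := s) (by omega)]; ring
          · rw [if_neg h2, hint s (by omega) (by omega)]; ring
      · rw [bern_eq_zero h, if_neg (by omega)]; rfl
    refine ⟨heq, hint, hcont, hleft, hright, hderiv, fun s h1 h2 y hy => ?_⟩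
    -- `bern q s` vanishes to the order `s - q` at `c` and to the order `p - s` at `d`
    have hl : ∀ q', q ≤ q' → q' ≤ p → ∀ s, bern w p c d q' s c = if s = q' then w q' c else 0 := by
      intro q' h1 h2
      rcases Nat.eq_or_lt_of_le h1 with rfl | h1
      · exact hleft
      · exact (good q' h1 h2).left
    have hr : ∀ q', q ≤ q' → q' ≤ p → ∀ s, bern w p c d q' s d = if s = p then w q' d else 0 := by
      intro q' h1 h2
      rcases Nat.eq_or_lt_of_le h1 with rfl | h1
      · exact hright
      · exact (good q' h1 h2).right
    have hchain := isChain_bernChain hw (q₀ := q) (fun q' h1 h2 => by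
      rcases Nat.eq_or_lt_of_le h1 with rfl | h1
      · exact hderiv
      · exact (good q' h1 h2).deriv) s
    have := hchain.pos_of_zeros (a := s - q) (b := p - s) hw.lt hw.pos (by omega)
      (fun i hi => by
        rw [show q + i - q = i by omega]
        exact bernChain_left_eq_zero hl i q le_rfl s (by omega))
      (fun i hi => by
        rw [show q + i - q = i by omega]
        exact bernChain_right_eq_zero hr i q le_rfl s (by omega))
      (by
        rw [show q + (s - q) - q = s - q by omega]
        have := bernChain_left_pos hw hl (s - q) q le_rfl (by omega)
        rwa [show q + (s - q) = s by omega] at this) y hy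
    simp only [Nat.sub_self, bernChain] at this
    have hwq := hw.pos q (by omega) y (Ioo_subset_Icc_self hy)
    exact (div_pos_iff_of_pos_right hwq).1 this
  exact fun q hq => key (p - q) q (by omega)

lemma isChain_bern (hw : IsWeights w p c d) (s : ℕ) :
    IsChain w p c d 0 (fun i => bernChain w p c d i 0 s) := by
  simpa using isChain_bernChain hw (q₀ := 0) (fun q _ hq => (bernGood hw q hq).deriv) s

/-! ### The Bernstein functions span the same space as the generalized powers -/

/-- The functions that agree on `E` with an element of `S`. -/
def eqOnSpace (E : Set ℝ) (S : Submodule ℝ (ℝ → ℝ)) : Submodule ℝ (ℝ → ℝ) where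
  carrier := {f | ∃ g ∈ S, EqOn f g E}
  add_mem' := by
    rintro f₁ f₂ ⟨g₁, h₁, e₁⟩ ⟨g₂, h₂, e₂⟩
    exact ⟨g₁ + g₂, S.add_mem h₁ h₂, fun y hy => by simp [e₁ hy, e₂ hy]⟩
  zero_mem' := ⟨0, S.zero_mem, fun _ _ => rfl⟩
  smul_mem' := by
    rintro a f ⟨g, h, e⟩
    exact ⟨a • g, S.smul_mem a h, fun y hy => by simp [e hy]⟩

lemma eqOnSpace_congr {E : Set ℝ} {S : Submodule ℝ (ℝ → ℝ)} {f g : ℝ → ℝ} (h : EqOn f g E)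
    (hg : g ∈ eqOnSpace E S) : f ∈ eqOnSpace E S := by
  obtain ⟨g', h1, h2⟩ := hg
  exact ⟨g', h1, h.trans h2⟩

lemma le_eqOnSpace (E : Set ℝ) (S : Submodule ℝ (ℝ → ℝ)) : S ≤ eqOnSpace E S :=
  fun f hf => ⟨f, hf, fun _ _ => rfl⟩

/-- Integration maps one span into another if it does so for the generators. -/
lemma integral_mem_eqOnSpace {G : Set (ℝ → ℝ)} {S : Submodule ℝ (ℝ → ℝ)}
    {v : ℝ → ℝ} (hG : ∀ g ∈ G, ContinuousOn g (Icc c d))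
    (hS : ∀ g ∈ G, (fun y => v y * ∫ t in c..y, g t) ∈ eqOnSpace (Icc c d) S) {f : ℝ → ℝ}
    (hf : f ∈ eqOnSpace (Icc c d) (Submodule.span ℝ G)) :
    (fun y => v y * ∫ t in c..y, f t) ∈ eqOnSpace (Icc c d) S := by
  obtain ⟨g, hg, hfg⟩ := hf
  have h1 : EqOn (fun y => v y * ∫ t in c..y, f t) (fun y => v y * ∫ t in c..y, g t)
      (Icc c d) := by
    intro y hy
    simp only
    congr 1
    refine intervalIntegral.integral_congr fun t ht => ?_
    rw [uIcc_of_le hy.1] at ht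
    exact hfg ⟨ht.1, ht.2.trans hy.2⟩
  refine eqOnSpace_congr h1 ?_
  clear h1 hfg
  have key : ContinuousOn g (Icc c d) ∧
      (fun y => v y * ∫ t in c..y, g t) ∈ eqOnSpace (Icc c d) S := by
    have hii : ∀ {f : ℝ → ℝ}, ContinuousOn f (Icc c d) → ∀ y ∈ Icc c d,
        IntervalIntegrable f MeasureTheory.volume c y := fun h y hy =>
      (h.mono (by rw [uIcc_of_le hy.1]; exact Icc_subset_Icc_right hy.2)).intervalIntegrable
    induction hg using Submodule.span_induction with
    | mem g hg => exact ⟨hG g hg, hS g hg⟩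
    | zero =>
      refine ⟨continuousOn_const, eqOnSpace_congr (g := 0) (fun y _ => by simp) (Submodule.zero_mem _)⟩
    | add f₁ f₂ _ _ h₁ h₂ =>
      refine ⟨h₁.1.add h₂.1, eqOnSpace_congr (fun y hy => ?_) (Submodule.add_mem _ h₁.2 h₂.2)⟩
      simp only [Pi.add_apply]
      rw [intervalIntegral.integral_add (hii h₁.1 y hy) (hii h₂.1 y hy)]
      ring
    | smul a f₁ _ h₁ =>
      refine ⟨h₁.1.const_smul a, eqOnSpace_congr (fun y hy => ?_) (Submodule.smul_mem _ a h₁.2)⟩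
      simp only [Pi.smul_apply, smul_eq_mul, intervalIntegral.integral_const_mul]
      ring
  exact key.2

/-- By telescoping from the top index: the function in question is the sum of the `bern q t`, `t ≥ s`. -/
lemma mul_bernInt_mem_span (hw : IsWeights w p c d) {q : ℕ} (hq : q ≤ p) {s : ℕ} (hs : q < s) :
    (fun y => w q y * bernInt w p c d q s y) ∈
      eqOnSpace (Icc c d) (Submodule.span ℝ (range (bern w p c d q))) := by
  have key : ∀ t s, q < s → s + t = p + 1 → (fun y => w q y * bernInt w p c d q s y) ∈
      eqOnSpace (Icc c d) (Submodule.span ℝ (range (bern w p c d q))) := by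
    intro t
    induction t with
    | zero =>
      intro s _ hs
      refine eqOnSpace_congr (g := 0) (fun y _ => ?_) (Submodule.zero_mem _)
      simp [bernInt_eq_zero (w := w) (c := c) (d := d) (q := q) (s := s) (p := p) (by omega)]
    | succ t ih =>
      intro s hqs hs
      refine eqOnSpace_congr (fun y hy => ?_) (Submodule.add_mem _ (ih (s + 1) (by omega) (by omega))
        (le_eqOnSpace _ _ (Submodule.subset_span ⟨s, rfl⟩)))
      simp only [Pi.add_apply]
      rw [(bernGood hw q hq).eq s hqs.le (by omega) y hy, if_neg (by omega)]
      ring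
  rcases Nat.lt_or_ge p s with h | h
  · refine eqOnSpace_congr (g := 0) (fun y _ => ?_) (Submodule.zero_mem _)
    simp [bernInt_eq_zero (w := w) (c := c) (d := d) (q := q) (s := s) (p := p) (by omega)]
  · exact key (p + 1 - s) s hs (by omega)

lemma weight_mem_span_bern (hw : IsWeights w p c d) {q : ℕ} (hq : q ≤ p) :
    w q ∈ eqOnSpace (Icc c d) (Submodule.span ℝ (range (bern w p c d q))) := by
  refine eqOnSpace_congr (fun y hy => ?_) (Submodule.add_mem _
    (mul_bernInt_mem_span hw hq (Nat.lt_succ_self q))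
    (le_eqOnSpace _ _ (Submodule.subset_span ⟨q, rfl⟩)))
  simp only [Pi.add_apply]
  rw [(bernGood hw q hq).eq q le_rfl hq y hy, if_pos rfl, bernInt_eq_zero (s := q) (by omega)]
  ring

lemma continuousOn_genPow (hw : IsWeights w p c d) {j : ℕ} :
    ∀ {q : ℕ}, q + j ≤ p → ContinuousOn (genPow w c j q) (Icc c d) := by
  induction j with
  | zero => intro q hq; exact hw.continuousOn hq
  | succ j ih =>
    intro q hq
    exact (hw.continuousOn (show q ≤ p by omega)).mul fun y hy =>
      (hasDerivWithinAt_integral hw.lt (ih (q := q + 1) (by omega)) hy).continuousWithinAt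

/-- Induction on the number of integrations: an integral of `bern (q+1) s`, times `w q`, is a combination of
functions of level `q`. -/
lemma genPow_mem_span_bern (hw : IsWeights w p c d) (j : ℕ) : ∀ q, q + j ≤ p →
    genPow w c j q ∈ eqOnSpace (Icc c d) (Submodule.span ℝ (range (bern w p c d q))) := by
  induction j with
  | zero => intro q hq; exact weight_mem_span_bern hw hq
  | succ j ih =>
    intro q hq
    refine integral_mem_eqOnSpace (G := range (bern w p c d (q + 1))) ?_ ?_
      (ih (q + 1) (by omega))
    · rintro _ ⟨s, rfl⟩
      exact (bernGood hw (q + 1) (by omega)).cont s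
    · rintro _ ⟨s, rfl⟩
      by_cases hs : q < s
      · refine eqOnSpace_congr (fun y hy => ?_) (Submodule.smul_mem _ (bernGamma w p c d q s)⁻¹
          (mul_bernInt_mem_span hw (show q ≤ p by omega) hs))
        have := (bernGamma_pos (w := w) (p := p) (c := c) (d := d) q s).ne'
        simp only [Pi.smul_apply, smul_eq_mul, bernInt]
        field_simp
      · refine eqOnSpace_congr (g := 0) (fun y _ => ?_) (Submodule.zero_mem _)
        simp [bern_eq_zero (w := w) (c := c) (d := d) (q := q + 1) (s := s) (p := p) (by omega)]

/-- Downward induction on the level: `bern q s` is a combination of `w q` and of integrals of functions of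
level `q + 1`, times `w q`. -/
lemma bern_mem_span_genPow (hw : IsWeights w p c d) (Q : ℕ) : ∀ q, q + Q = p → ∀ s,
    bern w p c d q s ∈ eqOnSpace (Icc c d)
      (Submodule.span ℝ {f | ∃ j ≤ Q, f = genPow w c j q}) := by
  induction Q with
  | zero =>
    intro q hq s
    by_cases hs : s = p
    · obtain rfl : q = p := by omega
      subst hs
      rw [bern_self_eq]
      exact le_eqOnSpace _ _ (Submodule.subset_span ⟨0, le_rfl, rfl⟩)
    · rw [bern_eq_zero (by omega)]
      exact Submodule.zero_mem _
  | succ Q ih =>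
    intro q hq s
    by_cases hs : q ≤ s ∧ s ≤ p
    · have hI : ∀ s, (fun y => w q y * bernInt w p c d q s y) ∈ eqOnSpace (Icc c d)
          (Submodule.span ℝ {f | ∃ j ≤ Q + 1, f = genPow w c j q}) := by
        intro s
        have h1 := integral_mem_eqOnSpace (G := {f | ∃ j ≤ Q, f = genPow w c j (q + 1)})
          (S := Submodule.span ℝ {f | ∃ j ≤ Q + 1, f = genPow w c j q}) (v := w q)
          (by
            rintro _ ⟨j, hj, rfl⟩
            exact continuousOn_genPow hw (by omega))
          (by
            rintro _ ⟨j, hj, rfl⟩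
            exact le_eqOnSpace _ _ (Submodule.subset_span ⟨j + 1, by omega, rfl⟩))
          (ih (q + 1) (by omega) s)
        refine eqOnSpace_congr (fun y hy => ?_) (Submodule.smul_mem _ (bernGamma w p c d q s) h1)
        simp only [bernInt, Pi.smul_apply, smul_eq_mul]
        ring
      have hW : w q ∈ eqOnSpace (Icc c d)
          (Submodule.span ℝ {f | ∃ j ≤ Q + 1, f = genPow w c j q}) :=
        le_eqOnSpace _ _ (Submodule.subset_span ⟨0, by omega, rfl⟩)
      refine eqOnSpace_congr (fun y hy => ?_) (Submodule.sub_mem _ (Submodule.add_mem _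
        (Submodule.smul_mem _ (if s = q then 1 else 0) hW) (hI s)) (hI (s + 1)))
      rw [(bernGood hw q (by omega)).eq s hs.1 hs.2 y hy]
      simp only [Pi.sub_apply, Pi.add_apply, Pi.smul_apply, smul_eq_mul]
      ring
    · rw [bern_eq_zero hs]
      exact Submodule.zero_mem _

/-- The Bernstein functions of level `0` sum up to the weight `w 0`. -/
lemma sum_bern (hw : IsWeights w p c d) {y : ℝ} (hy : y ∈ Icc c d) :
    ∑ s ∈ Finset.range (p + 1), bern w p c d 0 s y = w 0 y := by
  have h1 : ∀ s ∈ Finset.range (p + 1), bern w p c d 0 s y = w 0 y * ((if s = 0 then 1 else 0) +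
      (bernInt w p c d 0 s y - bernInt w p c d 0 (s + 1) y)) := fun s hs => by
    rw [(bernGood hw 0 (Nat.zero_le _)).eq s (Nat.zero_le _)
      (by rw [Finset.mem_range] at hs; omega) y hy]
    ring
  rw [Finset.sum_congr rfl h1, ← Finset.mul_sum, Finset.sum_add_distrib, Finset.sum_range_sub',
    bernInt_eq_zero (s := 0) (by omega), bernInt_eq_zero (s := p + 1) (by omega)]
  simp

end

/-! ### Ordinary and generalized derivatives at an endpoint -/

/-- The relations between the derivatives `A q a` of `g q`, the derivatives `F q l` of `w q * g q` and
the derivatives `W q s` of `w q` at one point, up to the total order `r`, when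
`(g q)' = w (q+1) * g (q+1)`. They are linear in `(A, F)`. -/
structure IsJet (W : ℕ → ℕ → ℝ) (r : ℕ) (A F : ℕ → ℕ → ℝ) : Prop where
  leibniz : ∀ q l, q + l ≤ r → F q l = ∑ a ∈ Finset.range (l + 1), l.choose a * W q (l - a) * A q a
  shift : ∀ q a, q + a + 1 ≤ r → A q (a + 1) = F (q + 1) a

namespace IsJet

variable {W : ℕ → ℕ → ℝ} {r : ℕ} {A F : ℕ → ℕ → ℝ}

lemma mono {r' : ℕ} (h : IsJet W r A F) (hr : r' ≤ r) : IsJet W r' A F :=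
  ⟨fun q l hl => h.leibniz q l (hl.trans hr), fun q a ha => h.shift q a (ha.trans hr)⟩

lemma congr_weights {W' : ℕ → ℕ → ℝ} (h : IsJet W r A F)
    (hW : ∀ q s, q + s ≤ r → W' q s = W q s) : IsJet W' r A F := by
  refine ⟨fun q l hl => ?_, h.shift⟩
  rw [h.leibniz q l hl]
  refine Finset.sum_congr rfl fun a ha => ?_
  rw [hW q (l - a) (by omega)]

lemma sub {A' F' : ℕ → ℕ → ℝ} (h : IsJet W r A F) (h' : IsJet W r A' F') :
    IsJet W r (A - A') (F - F') := by
  refine ⟨fun q l hl => ?_, fun q a ha => ?_⟩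
  · simp only [Pi.sub_apply]
    rw [h.leibniz q l hl, h'.leibniz q l hl, ← Finset.sum_sub_distrib]
    exact Finset.sum_congr rfl fun a _ => by ring
  · simp only [Pi.sub_apply]
    rw [h.shift q a ha, h'.shift q a ha]

/-- The first derivative that does not vanish is a multiple of the generalized derivative of the same
order. -/
lemma deriv_eq (h : IsJet W r A F) (hW : ∀ q ≤ r, W q 0 ≠ 0) (j : ℕ) : ∀ q, q + j ≤ r →
    (∀ l < j, F q l = 0) → F q j = (∏ i ∈ Finset.range (j + 1), W (q + i) 0) * A (q + j) 0 := by
  induction j with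
  | zero =>
    intro q hq _
    simp [h.leibniz q 0 hq]
  | succ j ih =>
    intro q hq h0
    -- the Leibniz rule is triangular, so the derivatives of `g q` vanish as long as those of `w q * g q`
    have hA : ∀ l ≤ j, A q l = 0 := by
      intro l
      induction l using Nat.strong_induction_on with
      | h l ihl =>
        intro hl
        have h1 := h0 l (by omega)
        rw [h.leibniz q l (by omega), Finset.sum_range_succ, Finset.sum_eq_zero, zero_add] at h1
        · simpa [hW q (by omega)] using h1
        · intro a ha
          rw [Finset.mem_range] at ha
          rw [ihl a ha (by omega), mul_zero]
    have h1 : F q (j + 1) = W q 0 * A q (j + 1) := by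
      rw [h.leibniz q (j + 1) hq, Finset.sum_range_succ, Finset.sum_eq_zero]
      · simp
      · intro a ha
        rw [Finset.mem_range] at ha
        rw [hA a (by omega), mul_zero]
    rw [h1, h.shift q j (by omega), ih (q + 1) (by omega)
      (fun l hl => by rw [← h.shift q l (by omega)]; exact hA _ (by omega)),
      Finset.prod_range_succ' _ (j + 1), show q + 1 + j = q + (j + 1) by ring]
    have h2 : ∏ i ∈ Finset.range (j + 1), W (q + (i + 1)) 0 =
        ∏ i ∈ Finset.range (j + 1), W (q + 1 + i) 0 :=
      Finset.prod_congr rfl fun i _ => by rw [show q + (i + 1) = q + 1 + i by ring]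
    rw [h2, add_zero]
    ring

/-- If the generalized derivatives of orders below `j` vanish, so do the ordinary ones. -/
lemma eq_zero (h : IsJet W r A F) (hW : ∀ q ≤ r, W q 0 ≠ 0) {j : ℕ} (hj : j ≤ r + 1)
    (h0 : ∀ i < j, A i 0 = 0) : ∀ l < j, F 0 l = 0 := by
  intro l
  induction l using Nat.strong_induction_on with
  | h l ih =>
    intro hl
    rw [h.deriv_eq hW l 0 (by omega) fun l' hl' => ih l' hl' (by omega), zero_add, h0 l hl, mul_zero]

end IsJet

section

variable {w : ℕ → ℝ → ℝ} {p : ℕ} {c d : ℝ}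

/-- Each step down the chain gains one derivative, as the smoothness of the weights permits. -/
lemma IsChain.contDiffOn (hw : IsWeights w p c d) {g : ℕ → ℝ → ℝ} (hg : IsChain w p c d 0 g)
    (Q : ℕ) : ∀ q, q + Q = p → ContDiffOn ℝ Q (g q) (Icc c d) := by
  induction Q with
  | zero =>
    intro q _
    simpa using (contDiffOn_zero (𝕜 := ℝ)).2 (hg.continuousOn (Nat.zero_le q))
  | succ Q ih =>
    intro q hq
    have h1 : ContDiffOn ℝ Q (derivWithin (g q) (Icc c d)) (Icc c d) := by
      have h2 : ContDiffOn ℝ Q (w (q + 1)) (Icc c d) := by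
        have := hw.smooth (q + 1) (by omega)
        rwa [show p - (q + 1) = Q by omega] at this
      exact (h2.mul (ih (q + 1) (by omega))).congr fun y hy =>
        (hg.deriv q (Nat.zero_le _) (by omega) y hy).derivWithin (uniqueDiffOn_Icc hw.lt y hy)
    have := (contDiffOn_succ_iff_derivWithin (n := (Q : WithTop ℕ∞))
      (uniqueDiffOn_Icc hw.lt) (f := g q)).2
      ⟨fun y hy => (hg.deriv q (Nat.zero_le _) (by omega) y hy).differentiableWithinAt,
        fun h => by simp at h, h1⟩
    exact_mod_cast this

lemma IsChain.contDiffOn_mul (hw : IsWeights w p c d) {g : ℕ → ℝ → ℝ}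
    (hg : IsChain w p c d 0 g) {q : ℕ} (hq : q ≤ p) :
    ContDiffOn ℝ (p - q : ℕ) (fun y => w q y * g q y) (Icc c d) :=
  (hw.smooth q hq).mul (hg.contDiffOn hw (p - q) q (by omega))

/-- The derivatives of a chain at a point form a jet. -/
lemma IsChain.isJet (hw : IsWeights w p c d) {g : ℕ → ℝ → ℝ} (hg : IsChain w p c d 0 g) {e : ℝ}
    (he : e ∈ Icc c d) :
    IsJet (fun q s => iteratedDerivWithin s (w q) (Icc c d) e) p
      (fun q a => iteratedDerivWithin a (g q) (Icc c d) e)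
      (fun q l => iteratedDerivWithin l (fun y => w q y * g q y) (Icc c d) e) := by
  have hu := uniqueDiffOn_Icc hw.lt
  refine ⟨fun q l hl => ?_, fun q a ha => ?_⟩
  · have hle : (l : WithTop ℕ∞) ≤ (p - q : ℕ) := by exact_mod_cast (by omega : l ≤ p - q)
    have h1 := (hw.smooth q (by omega)).of_le hle e he
    have h2 := (hg.contDiffOn hw (p - q) q (by omega)).of_le hle e he
    have h3 := iteratedDerivWithin_mul he hu h2 h1
    have h4 : (fun y => w q y * g q y) = g q * w q := by
      funext y; simp [mul_comm]
    simp only [h4]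
    rw [h3]
    exact Finset.sum_congr rfl fun a _ => by ring
  · rw [iteratedDerivWithin_succ']
    refine iteratedDerivWithin_congr (fun y hy => ?_) he
    exact (hg.deriv q (Nat.zero_le _) (by omega) y hy).derivWithin (hu y hy)

end

namespace Data

variable (D : Data)

/-! ### Counting knots -/

/-- Number of knots `u_k` to the left of `x i`, when `c j` smoothness constraints hold at `x j`. -/
def cntU (c : ℕ → ℕ) (i : ℕ) : ℕ := ∑ j ∈ Finset.range i, (D.p (j + 1) + 1 - c j)

/-- Number of knots `v_k` in `x 1, …, x i`, when `c j` smoothness constraints hold at `x j`. -/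
def cntV (c : ℕ → ℕ) (i : ℕ) : ℕ := ∑ j ∈ Finset.range i, (D.p (j + 1) + 1 - c (j + 1))

/-- Numbers of smoothness constraints at the breakpoints: `c i` is `r i + 1` for the smoothness vector
`r`, so that there are no constraints at the two ends of the interval. -/
structure Valid (c : ℕ → ℕ) : Prop where
  zero : c 0 = 0
  last : c D.m = 0
  le_left : ∀ i, 1 ≤ i → i < D.m → c i ≤ D.p i + 1
  le_right : ∀ i, 1 ≤ i → i < D.m → c i ≤ D.p (i + 1) + 1

variable {D} {c : ℕ → ℕ}

namespace Valid

lemma le_right' (hc : D.Valid c) {i : ℕ} (hi : i < D.m) : c i ≤ D.p (i + 1) + 1 := by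
  rcases Nat.eq_zero_or_pos i with rfl | h
  · rw [hc.zero]; omega
  · exact hc.le_right i h hi

lemma le_left' (hc : D.Valid c) {i : ℕ} (h1 : 1 ≤ i) (hi : i ≤ D.m) : c i ≤ D.p i + 1 := by
  rcases Nat.eq_or_lt_of_le hi with rfl | h
  · rw [hc.last]; omega
  · exact hc.le_left i h1 h

lemma cntU_eq (hc : D.Valid c) {i : ℕ} (hi : i ≤ D.m) : D.cntU c i = D.cntV c i + c i := by
  induction i with
  | zero => simp [cntU, cntV, hc.zero]
  | succ i ih =>
    have h1 := hc.le_right' (show i < D.m by omega)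
    have h2 := hc.le_left' (show 1 ≤ i + 1 by omega) hi
    have h3 := ih (by omega)
    unfold cntU cntV at *
    rw [Finset.sum_range_succ, Finset.sum_range_succ]
    omega

lemma cntU_succ (hc : D.Valid c) {i : ℕ} (hi : i < D.m) :
    D.cntU c (i + 1) = D.cntV c i + (D.p (i + 1) + 1) := by
  have h1 := hc.le_right' hi
  have h3 := hc.cntU_eq hi.le
  unfold cntU at *
  rw [Finset.sum_range_succ]
  omega

end Valid

lemma cntU_mono : Monotone (D.cntU c) := fun _ _ h =>
  Finset.sum_le_sum_of_subset (Finset.range_mono h)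

lemma cntV_mono : Monotone (D.cntV c) := fun _ _ h =>
  Finset.sum_le_sum_of_subset (Finset.range_mono h)

/-- The knot `u_k` is `x i`, and it is the start of a function of smoothness order `s`. -/
lemma Valid.exists_start (hc : D.Valid c) {k : ℕ} (hk : k < D.cntU c D.m) :
    ∃ i < D.m, ∃ s, c i ≤ s ∧ s ≤ D.p (i + 1) ∧ k = D.cntV c i + s := by
  have key : ∀ i ≤ D.m, k < D.cntU c i → ∃ i < D.m, ∃ s, c i ≤ s ∧ s ≤ D.p (i + 1) ∧
      k = D.cntV c i + s := by
    intro i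
    induction i with
    | zero => intro _ h; simp [cntU] at h
    | succ i ih =>
      intro hi h
      rcases Nat.lt_or_ge k (D.cntU c i) with h1 | h1
      · exact ih (by omega) h1
      · have h2 := hc.cntU_eq (show i ≤ D.m by omega)
        have h3 := hc.cntU_succ (show i < D.m by omega)
        exact ⟨i, by omega, k - D.cntV c i, by omega, by omega, by omega⟩
  exact key D.m le_rfl hk

/-- The knot `v_k` is `x j`, and it is the end of a function of smoothness order `s`. -/
lemma Valid.exists_finish (hc : D.Valid c) {k : ℕ} (hk : k < D.cntU c D.m) :
    ∃ j, 1 ≤ j ∧ j ≤ D.m ∧ ∃ s, c j ≤ s ∧ s ≤ D.p j ∧ k + 1 + s = D.cntU c j := by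
  have key : ∀ i ≤ D.m, k < D.cntV c i → ∃ j, 1 ≤ j ∧ j ≤ D.m ∧ ∃ s, c j ≤ s ∧ s ≤ D.p j ∧
      k + 1 + s = D.cntU c j := by
    intro i
    induction i with
    | zero => intro _ h; simp [cntV] at h
    | succ i ih =>
      intro hi h
      rcases Nat.lt_or_ge k (D.cntV c i) with h1 | h1
      · exact ih (by omega) h1
      · have h2 := hc.cntU_eq hi
        have h3 := hc.cntU_succ (show i < D.m by omega)
        exact ⟨i + 1, by omega, hi, D.cntU c (i + 1) - (k + 1), by omega, by omega, by omega⟩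
  refine key D.m le_rfl ?_
  have := hc.cntU_eq (le_refl D.m)
  rw [hc.last] at this
  omega

/-! ### Breakpoints and one-sided smoothness of piecewise functions -/

lemma x_lt_of_lt {i j : ℕ} (hij : i < j) (hj : j ≤ D.m) : D.x i < D.x j := by
  induction j with
  | zero => omega
  | succ j ih =>
    have h1 := D.x_lt j (by omega)
    rcases Nat.eq_or_lt_of_le (Nat.lt_succ_iff.1 hij) with rfl | h
    · exact h1
    · exact (ih h (by omega)).trans h1

lemma x_le_of_le {i j : ℕ} (hij : i ≤ j) (hj : j ≤ D.m) : D.x i ≤ D.x j := by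
  rcases Nat.eq_or_lt_of_le hij with rfl | h
  · exact le_rfl
  · exact (x_lt_of_lt h hj).le

lemma isWeights {i : ℕ} (h1 : 1 ≤ i) (hi : i ≤ D.m) :
    IsWeights (D.w i) (D.p i) (D.x (i - 1)) (D.x i) :=
  ⟨x_lt_of_lt (by omega) hi, D.w_pos i h1 hi, fun j hj => by
    exact_mod_cast D.w_smooth i h1 hi j hj⟩

variable (D) in
/-- The left neighbour of `x i`; a point outside of the interval for `i = 0`. -/
noncomputable def prev (i : ℕ) : ℝ := if i = 0 then D.x 0 - 1 else D.x (i - 1)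

variable (D) in
/-- The right neighbour of `x i`; a point outside of the interval for `i = m`. -/
noncomputable def next (i : ℕ) : ℝ := if i = D.m then D.x i + 1 else D.x (i + 1)

lemma prev_lt {i : ℕ} (hi : i ≤ D.m) : D.prev i < D.x i := by
  unfold prev
  split_ifs with h
  · subst h; linarith
  · exact x_lt_of_lt (by omega) hi

lemma lt_next {i : ℕ} (hi : i ≤ D.m) : D.x i < D.next i := by
  unfold next
  split_ifs with h
  · linarith
  · exact x_lt_of_lt (by omega) (by omega)

lemma prev_of_pos {i : ℕ} (h1 : 1 ≤ i) : D.prev i = D.x (i - 1) := if_neg (by omega)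

lemma next_of_lt {i : ℕ} (h1 : i < D.m) : D.next i = D.x (i + 1) := if_neg (by omega)

lemma Ioo_subset_I (i : ℕ) : Ioo (D.x (i - 1)) (D.x i) ⊆ D.I i := by
  unfold I
  split_ifs
  · exact Ioo_subset_Icc_self
  · exact Ioo_subset_Ico_self

lemma I_subset_Icc (i : ℕ) : D.I i ⊆ Icc (D.x (i - 1)) (D.x i) := by
  unfold I
  split_ifs
  · exact subset_rfl
  · exact Ico_subset_Icc_self

lemma exists_mem_I {y : ℝ} (hy : y ∈ Icc (D.x 0) (D.x D.m)) :
    ∃ i, 1 ≤ i ∧ i ≤ D.m ∧ y ∈ D.I i := by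
  have key : ∀ i, 1 ≤ i → i ≤ D.m → y < D.x i → ∃ i, 1 ≤ i ∧ i ≤ D.m ∧ y ∈ D.I i := by
    intro i
    induction i with
    | zero => intro h; omega
    | succ i ih =>
      intro _ hi hlt
      rcases lt_or_ge y (D.x i) with h | h
      · rcases Nat.eq_zero_or_pos i with rfl | h0
        · exact absurd hy.1 (not_le.2 h)
        · exact ih h0 (by omega) h
      · refine ⟨i + 1, by omega, hi, ?_⟩
        unfold I
        split_ifs
        · exact ⟨h, hlt.le⟩
        · exact ⟨h, hlt⟩
  rcases eq_or_lt_of_le hy.2 with h | h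
  · refine ⟨D.m, D.one_le_m, le_rfl, ?_⟩
    unfold I
    rw [if_pos rfl, h]
    exact ⟨x_le_of_le (by omega) le_rfl, le_rfl⟩
  · exact key D.m D.one_le_m le_rfl h

lemma I_unique {i j : ℕ} (hi : i ≤ D.m) (hj : j ≤ D.m) {y : ℝ}
    (hyi : y ∈ D.I i) (hyj : y ∈ D.I j) : i = j := by
  have key : ∀ {i j : ℕ}, i < j → j ≤ D.m → y ∈ D.I i → y ∈ D.I j → False := by
    intro i j hij hj hyi hyj
    have h2 : y < D.x i := by
      unfold I at hyi
      rw [if_neg (by omega)] at hyi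
      exact hyi.2
    have h3 := (I_subset_Icc j hyj).1
    exact absurd (h3.trans_lt h2) (not_lt.2 (x_le_of_le (by omega) (by omega)))
  rcases lt_trichotomy i j with h | h | h
  · exact (key h hj hyi hyj).elim
  · exact h
  · exact (key h hi hyj hyi).elim

variable (D) in
/-- The Bernstein functions of the `i`-th interval. -/
noncomputable abbrev bernOn (i s : ℕ) : ℝ → ℝ :=
  bern (D.w i) (D.p i) (D.x (i - 1)) (D.x i) 0 s

lemma T_eq_span_bern {i : ℕ} (h1 : 1 ≤ i) (hi : i ≤ D.m) :
    D.T i = Submodule.span ℝ (range fun s => (D.I i).domRestrict (D.bernOn i s)) := by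
  have hw := isWeights h1 hi
  let R : (ℝ → ℝ) →ₗ[ℝ] (D.I i → ℝ) := LinearMap.funLeft ℝ ℝ Subtype.val
  have key : ∀ (G : Set (ℝ → ℝ)) (f : ℝ → ℝ),
      f ∈ eqOnSpace (Icc (D.x (i - 1)) (D.x i)) (Submodule.span ℝ G) →
      (D.I i).domRestrict f ∈ Submodule.span ℝ (R '' G) := by
    rintro G f ⟨g, hg, hfg⟩
    rw [← Submodule.map_span]
    refine ⟨g, hg, ?_⟩
    funext y
    exact (hfg (I_subset_Icc i y.2)).symm
  apply le_antisymm
  · refine Submodule.span_le.2 ?_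
    rintro _ ⟨j, hj, rfl⟩
    have := key _ _ (genPow_mem_span_bern hw j 0 (by omega))
    rw [← range_comp] at this
    exact this
  · refine Submodule.span_le.2 ?_
    rintro _ ⟨s, rfl⟩
    have := key _ _ (bern_mem_span_genPow hw (D.p i) 0 (by omega) s)
    refine Submodule.span_mono ?_ this
    rintro _ ⟨_, ⟨j, hj, rfl⟩, rfl⟩
    exact ⟨j, hj, rfl⟩

/-- Elements of the local space have chains of generalized derivatives. -/
lemma exists_chain_of_mem_T {i : ℕ} (h1 : 1 ≤ i) (hi : i ≤ D.m) {f : ℝ → ℝ}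
    (hf : (D.I i).domRestrict f ∈ D.T i) :
    ∃ g, IsChain (D.w i) (D.p i) (D.x (i - 1)) (D.x i) 0 g ∧
      EqOn f (fun y => D.w i 0 y * g 0 y) (D.I i) := by
  have hw := isWeights h1 hi
  rw [T_eq_span_bern h1 hi] at hf
  have key : ∀ h ∈ Submodule.span ℝ (range fun s => (D.I i).domRestrict (D.bernOn i s)),
      ∃ g, IsChain (D.w i) (D.p i) (D.x (i - 1)) (D.x i) 0 g ∧
        ∀ y : D.I i, h y = D.w i 0 y * g 0 y := by
    intro h hh
    induction hh using Submodule.span_induction with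
    | mem h hh =>
      obtain ⟨s, rfl⟩ := hh
      refine ⟨_, isChain_bern hw s, fun y => ?_⟩
      have := (hw.pos 0 (Nat.zero_le _) y (I_subset_Icc i y.2)).ne'
      simp only [bernChain, domRestrict_apply]
      field_simp
    | zero => exact ⟨0, ⟨fun i _ _ y _ => by
        simpa using! hasDerivWithinAt_const y (Icc (D.x _) (D.x _)) (0 : ℝ), fun _ _ => rfl⟩, by simp⟩
    | add a b _ _ ha hb =>
      obtain ⟨g₁, h₁, e₁⟩ := ha
      obtain ⟨g₂, h₂, e₂⟩ := hb
      exact ⟨_, h₁.add h₂, fun y => by simp [e₁, e₂, mul_add]⟩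
    | smul a b _ hb =>
      obtain ⟨g₁, h₁, e₁⟩ := hb
      exact ⟨_, h₁.smul a, fun y => by simp [e₁, mul_left_comm]⟩
  obtain ⟨g, hg, he⟩ := key _ hf
  exact ⟨g, hg, fun y hy => he ⟨y, hy⟩⟩

variable (D) in
/-- Functions that vanish outside of `[x 0, x m]` and are piecewise in the local spaces. -/
noncomputable def pieceSpace : Submodule ℝ (ℝ → ℝ) where
  carrier := {s | (∀ y ∉ Icc (D.x 0) (D.x D.m), s y = 0) ∧
    ∀ i, 1 ≤ i → i ≤ D.m → (D.I i).domRestrict s ∈ D.T i}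
  add_mem' := fun {a b} ha hb => ⟨fun y hy => by simp [ha.1 y hy, hb.1 y hy],
    fun i h1 hi => (D.T i).add_mem (ha.2 i h1 hi) (hb.2 i h1 hi)⟩
  zero_mem' := ⟨fun _ _ => rfl, fun i _ _ => (D.T i).zero_mem⟩
  smul_mem' := fun a {b} hb => ⟨fun y hy => by simp [hb.1 y hy],
    fun i h1 hi => (D.T i).smul_mem a (hb.2 i h1 hi)⟩

variable (D) in
/-- The splines with `c i` smoothness constraints at `x i`. -/
def splines (c : ℕ → ℕ) : Set (ℝ → ℝ) :=
  {s | s ∈ D.pieceSpace ∧ ∀ i, 1 ≤ i → i < D.m → ∀ j < c i, jump (D.x i) j s = 0}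

lemma smoothUpTo_left {i l : ℕ} (h1 : 1 ≤ i) (hi : i ≤ D.m) (hl : l ≤ D.p i) {f : ℝ → ℝ}
    (hf : f ∈ D.pieceSpace) : f ∈ smoothUpTo (D.prev i) (D.x i) l := by
  obtain ⟨g, hg, he⟩ := exists_chain_of_mem_T h1 hi (hf.2 i h1 hi)
  rw [prev_of_pos h1]
  refine ⟨_, (hg.contDiffOn_mul (isWeights h1 hi) (Nat.zero_le _)).of_le ?_,
    he.mono (Ioo_subset_I i)⟩
  exact_mod_cast hl

lemma smoothUpTo_right {i l : ℕ} (hi : i < D.m) (hl : l ≤ D.p (i + 1)) {f : ℝ → ℝ}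
    (hf : f ∈ D.pieceSpace) : f ∈ smoothUpTo (D.x i) (D.next i) l := by
  have hi' : i + 1 ≤ D.m := hi
  obtain ⟨g, hg, he⟩ := exists_chain_of_mem_T (by omega) hi' (hf.2 (i + 1) (by omega) hi')
  rw [next_of_lt hi]
  refine ⟨_, (hg.contDiffOn_mul (isWeights (by omega) hi') (Nat.zero_le _)).of_le ?_,
    he.mono (Ioo_subset_I (i + 1))⟩
  exact_mod_cast hl

lemma jumpSmooth_of_interior {i l : ℕ} (h1 : 1 ≤ i) (hi : i < D.m) (hl : l ≤ D.p i)
    (hl' : l ≤ D.p (i + 1)) {f : ℝ → ℝ} (hf : f ∈ D.pieceSpace) :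
    f ∈ jumpSmooth (D.prev i) (D.x i) (D.next i) l :=
  ⟨smoothUpTo_left h1 hi.le hl hf, smoothUpTo_right hi hl' hf⟩

lemma jumpSmooth_of_zero_left {i l : ℕ} (hi : i < D.m) (hl : l ≤ D.p (i + 1)) {f : ℝ → ℝ}
    (hf : f ∈ D.pieceSpace) (h0 : ∀ y < D.x i, f y = 0) :
    f ∈ jumpSmooth (D.prev i) (D.x i) (D.next i) l :=
  ⟨smoothUpTo_of_eqOn_zero fun y hy => h0 y hy.2, smoothUpTo_right hi hl hf⟩

lemma jumpSmooth_of_zero_right {i l : ℕ} (h1 : 1 ≤ i) (hi : i ≤ D.m) (hl : l ≤ D.p i) {f : ℝ → ℝ}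
    (hf : f ∈ D.pieceSpace) (h0 : ∀ y, D.x i < y → f y = 0) :
    f ∈ jumpSmooth (D.prev i) (D.x i) (D.next i) l :=
  ⟨smoothUpTo_left h1 hi hl hf, smoothUpTo_of_eqOn_zero fun y hy => h0 y hy.1⟩

lemma jump_eq_zero {i : ℕ} (hi : i ≤ D.m) (l : ℕ) {f : ℝ → ℝ}
    (h : ∀ y ∈ Ioo (D.prev i) (D.next i), f y = 0) : jump (D.x i) l f = 0 := by
  rw [jump, leftDeriv_eq_zero (prev_lt hi) fun y hy => h y ⟨hy.1, hy.2.trans (lt_next hi)⟩,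
    rightDeriv_eq_zero (lt_next hi) fun y hy => h y ⟨(prev_lt hi).trans hy.1, hy.2⟩, sub_zero]

lemma jump_eq_zero_of_zero_left {i j : ℕ} (hij : i < j) (hj : j ≤ D.m) (l : ℕ) {f : ℝ → ℝ}
    (h : ∀ y < D.x j, f y = 0) : jump (D.x i) l f = 0 := by
  refine jump_eq_zero (by omega) l fun y hy => h y (hy.2.trans_le ?_)
  rw [next_of_lt (by omega)]
  exact x_le_of_le (by omega) hj

lemma jump_eq_zero_of_zero_right {i j : ℕ} (hij : i < j) (hj : j ≤ D.m) (l : ℕ) {f : ℝ → ℝ}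
    (h : ∀ y, D.x i < y → f y = 0) : jump (D.x j) l f = 0 := by
  refine jump_eq_zero hj l fun y hy => h y (lt_of_le_of_lt ?_ hy.1)
  rw [prev_of_pos (by omega)]
  exact x_le_of_le (by omega) (by omega)

/-! ### Bases with prescribed starts and ends -/

variable (D) in
/-- `f` vanishes to the left of `x i`, and its first jump there is that of the `s`-th derivative. -/
def Starts (f : ℝ → ℝ) (i s : ℕ) : Prop :=
  (∀ y < D.x i, f y = 0) ∧ (∀ l < s, jump (D.x i) l f = 0) ∧ jump (D.x i) s f ≠ 0

variable (D) in
/-- `f` vanishes to the right of `x i`, and its first jump there is that of the `s`-th derivative. -/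
def Stops (f : ℝ → ℝ) (i s : ℕ) : Prop :=
  (∀ y, D.x i < y → f y = 0) ∧ (∀ l < s, jump (D.x i) l f = 0) ∧ jump (D.x i) s f ≠ 0

lemma Starts.unique {f : ℝ → ℝ} {i s i' s' : ℕ} (h : D.Starts f i s) (h' : D.Starts f i' s')
    (hi : i ≤ D.m) (hi' : i' ≤ D.m) : i = i' ∧ s = s' := by
  have e : i = i' := by
    rcases lt_trichotomy i i' with hl | hl | hl
    · exact (h.2.2 (jump_eq_zero_of_zero_left hl hi' s h'.1)).elim
    · exact hl
    · exact (h'.2.2 (jump_eq_zero_of_zero_left hl hi s' h.1)).elim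
  subst e
  refine ⟨rfl, ?_⟩
  rcases lt_trichotomy s s' with hl | hl | hl
  · exact (h.2.2 (h'.2.1 s hl)).elim
  · exact hl
  · exact (h'.2.2 (h.2.1 s' hl)).elim

lemma Stops.unique {f : ℝ → ℝ} {i s i' s' : ℕ} (h : D.Stops f i s) (h' : D.Stops f i' s')
    (hi : i ≤ D.m) (hi' : i' ≤ D.m) : i = i' ∧ s = s' := by
  have e : i = i' := by
    rcases lt_trichotomy i i' with hl | hl | hl
    · exact (h'.2.2 (jump_eq_zero_of_zero_right hl hi' s' h.1)).elim
    · exact hl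
    · exact (h.2.2 (jump_eq_zero_of_zero_right hl hi s h'.1)).elim
  subst e
  refine ⟨rfl, ?_⟩
  rcases lt_trichotomy s s' with hl | hl | hl
  · exact (h.2.2 (h'.2.1 s hl)).elim
  · exact hl
  · exact (h'.2.2 (h.2.1 s' hl)).elim

variable (D) in
/-- A basis with prescribed supports and with prescribed smoothness at their ends, indexed by all
natural numbers and zero beyond the dimension. The function `k` starts at `x i` if `k` is the number
`cntV c i` of ends in `x 1, …, x i` plus the order `s` of its first jump at `x i`, and it ends at
`x j` if `k + 1 + s` is the number `cntU c j` of starts to the left of `x j`. -/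
structure HasEnds (c : ℕ → ℕ) (B : ℕ → ℝ → ℝ) : Prop where
  zero : ∀ k, D.cntU c D.m ≤ k → B k = 0
  mem : ∀ k, B k ∈ D.splines c
  span : ∀ f ∈ D.splines c, f ∈ Submodule.span ℝ (range B)
  start : ∀ i < D.m, ∀ s, c i ≤ s → s ≤ D.p (i + 1) → D.Starts (B (D.cntV c i + s)) i s
  finish : ∀ j, 1 ≤ j → j ≤ D.m → ∀ s, c j ≤ s → s ≤ D.p j → ∀ k, k + 1 + s = D.cntU c j →
    D.Stops (B k) j s

namespace HasEnds

variable {B : ℕ → ℝ → ℝ}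

/-- Functions with an index at least `cntV c i + s` start at `x i` or later. -/
lemma zero_left (hB : D.HasEnds c B) (hc : D.Valid c) {i s : ℕ} (hi : i < D.m) (hs : c i ≤ s)
    {l : ℕ} (hl : D.cntV c i + s ≤ l) : ∀ y < D.x i, B l y = 0 := by
  rcases Nat.lt_or_ge l (D.cntU c D.m) with hK | hK
  · obtain ⟨i', hi', s', h1, h2, h3⟩ := hc.exists_start hK
    have hii : i ≤ i' := by
      by_contra! h
      have e1 := hc.cntU_succ hi'
      have e2 := hc.cntU_eq hi.le
      have e3 := cntU_mono (D := D) (c := c) (show i' + 1 ≤ i from h)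
      omega
    intro y hy
    rw [h3]
    exact (hB.start i' hi' s' h1 h2).1 y (hy.trans_le (x_le_of_le hii hi'.le))
  · rw [hB.zero l hK]; exact fun _ _ => rfl

/-- Functions with an index above `cntV c i + s` start at `x i` more smoothly than to the order `s`, or
later. -/
lemma jump_left (hB : D.HasEnds c B) (hc : D.Valid c) {i s : ℕ} (hi : i < D.m) (hs : c i ≤ s)
    {l : ℕ} (hl : D.cntV c i + s < l) : ∀ s' ≤ s, jump (D.x i) s' (B l) = 0 := by
  intro s₁ hs₁
  rcases Nat.lt_or_ge l (D.cntU c D.m) with hK | hK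
  · obtain ⟨i', hi', s', h1, h2, h3⟩ := hc.exists_start hK
    have hii : i ≤ i' := by
      by_contra! h
      have e1 := hc.cntU_succ hi'
      have e2 := hc.cntU_eq hi.le
      have e3 := cntU_mono (D := D) (c := c) (show i' + 1 ≤ i from h)
      omega
    have hst := hB.start i' hi' s' h1 h2
    rw [h3]
    rcases Nat.eq_or_lt_of_le hii with rfl | hlt
    · exact hst.2.1 s₁ (by omega)
    · exact jump_eq_zero_of_zero_left hlt hi'.le s₁ hst.1
  · rw [hB.zero l hK]
    exact jump_eq_zero hi.le s₁ fun _ _ => rfl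

/-- Functions whose index is at most that of the one that ends at `x j` with order `s` end at `x j` or
earlier. -/
lemma zero_right (hB : D.HasEnds c B) (hc : D.Valid c) {j s : ℕ} (hj : j ≤ D.m) (hs : c j ≤ s)
    {l : ℕ} (hl : l + 1 + s ≤ D.cntU c j) : ∀ y, D.x j < y → B l y = 0 := by
  have hK : l < D.cntU c D.m := by
    have := cntU_mono (D := D) (c := c) hj
    omega
  obtain ⟨j', h1', hj', s', h1, h2, h3⟩ := hc.exists_finish hK
  have hjj : j' ≤ j := by
    by_contra! h
    have e1 := hc.cntU_succ (show j' - 1 < D.m by omega)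
    rw [show j' - 1 + 1 = j' by omega] at e1
    have e2 := hc.cntU_eq hj
    have e3 := cntV_mono (D := D) (c := c) (show j ≤ j' - 1 by omega)
    omega
  intro y hy
  exact (hB.finish j' h1' hj' s' h1 h2 l h3).1 y ((x_le_of_le hjj hj).trans_lt hy)

/-- Functions whose index is below that of the one that ends at `x j` with order `s` end at `x j` more
smoothly, or earlier. -/
lemma jump_right (hB : D.HasEnds c B) (hc : D.Valid c) {j s : ℕ} (hj : j ≤ D.m) (hs : c j ≤ s)
    {l : ℕ} (hl : l + 1 + s < D.cntU c j) : ∀ s' ≤ s, jump (D.x j) s' (B l) = 0 := by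
  intro s₁ hs₁
  have hK : l < D.cntU c D.m := by
    have := cntU_mono (D := D) (c := c) hj
    omega
  obtain ⟨j', h1', hj', s', h1, h2, h3⟩ := hc.exists_finish hK
  have hjj : j' ≤ j := by
    by_contra! h
    have e1 := hc.cntU_succ (show j' - 1 < D.m by omega)
    rw [show j' - 1 + 1 = j' by omega] at e1
    have e2 := hc.cntU_eq hj
    have e3 := cntV_mono (D := D) (c := c) (show j ≤ j' - 1 by omega)
    omega
  have hst := hB.finish j' h1' hj' s' h1 h2 l h3
  rcases Nat.eq_or_lt_of_le hjj with rfl | hlt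
  · exact hst.2.1 s₁ (by omega)
  · exact jump_eq_zero_of_zero_right hlt hj s₁ hst.1

/-- The first function of a linear combination determines its start. -/
lemma starts_sum (hB : D.HasEnds c B) (hc : D.Valid c) {a : ℕ → ℝ} {i s : ℕ} (hi : i < D.m)
    (hs : c i ≤ s) (hs' : s ≤ D.p (i + 1)) (h0 : ∀ l < D.cntV c i + s, a l = 0)
    (h1 : a (D.cntV c i + s) ≠ 0) {K : ℕ} (hK : D.cntV c i + s < K) :
    D.Starts (∑ l ∈ Finset.range K, a l • B l) i s := by
  have hz : ∀ l, a l ≠ 0 → D.cntV c i + s ≤ l := fun l h => by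
    by_contra! hl
    exact h (h0 l hl)
  have hj : ∀ s₁ ≤ s, jump (D.x i) s₁ (∑ l ∈ Finset.range K, a l • B l) =
      ∑ l ∈ Finset.range K, a l * jump (D.x i) s₁ (B l) := fun s₁ hs₁ =>
    jump_sum (prev_lt hi.le) (lt_next hi.le) _ _ _ fun l _ hl =>
      jumpSmooth_of_zero_left hi (hs₁.trans hs') (hB.mem l).1 (hB.zero_left hc hi hs (hz l hl))
  have hst := hB.start i hi s hs hs'
  refine ⟨fun y hy => ?_, fun s₁ hs₁ => ?_, ?_⟩
  · rw [Finset.sum_apply]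
    refine Finset.sum_eq_zero fun l _ => ?_
    by_cases hl : a l = 0
    · simp [hl]
    · simp [hB.zero_left hc hi hs (hz l hl) y hy]
  · rw [hj s₁ hs₁.le]
    refine Finset.sum_eq_zero fun l _ => ?_
    by_cases hl : a l = 0
    · simp [hl]
    · rcases Nat.eq_or_lt_of_le (hz l hl) with e | e
      · rw [← e, hst.2.1 s₁ hs₁, mul_zero]
      · rw [hB.jump_left hc hi hs e s₁ hs₁.le, mul_zero]
  · rw [hj s le_rfl, Finset.sum_eq_single_of_mem _ (Finset.mem_range.2 hK)]
    · exact mul_ne_zero h1 hst.2.2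
    · intro l _ hl
      by_cases hl0 : a l = 0
      · simp [hl0]
      · rw [hB.jump_left hc hi hs (lt_of_le_of_ne (hz l hl0) (Ne.symm hl)) s le_rfl, mul_zero]

/-- The last function of a linear combination determines its end. -/
lemma stops_sum (hB : D.HasEnds c B) (hc : D.Valid c) {a : ℕ → ℝ} {j s : ℕ} (hj1 : 1 ≤ j)
    (hj : j ≤ D.m) (hs : c j ≤ s) (hs' : s ≤ D.p j) {k : ℕ} (hk : k + 1 + s = D.cntU c j)
    (h0 : ∀ l, k < l → a l = 0) (h1 : a k ≠ 0) {K : ℕ} (hK : k < K) :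
    D.Stops (∑ l ∈ Finset.range K, a l • B l) j s := by
  have hz : ∀ l, a l ≠ 0 → l ≤ k := fun l h => by
    by_contra! hl
    exact h (h0 l hl)
  have hjs : ∀ s₁ ≤ s, jump (D.x j) s₁ (∑ l ∈ Finset.range K, a l • B l) =
      ∑ l ∈ Finset.range K, a l * jump (D.x j) s₁ (B l) := fun s₁ hs₁ =>
    jump_sum (prev_lt hj) (lt_next hj) _ _ _ fun l _ hl =>
      jumpSmooth_of_zero_right hj1 hj (hs₁.trans hs') (hB.mem l).1
        (hB.zero_right hc hj hs (by have := hz l hl; omega))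
  have hst := hB.finish j hj1 hj s hs hs' k hk
  refine ⟨fun y hy => ?_, fun s₁ hs₁ => ?_, ?_⟩
  · rw [Finset.sum_apply]
    refine Finset.sum_eq_zero fun l _ => ?_
    by_cases hl : a l = 0
    · simp [hl]
    · have := hz l hl
      have h2 := hB.zero_right hc hj hs (l := l) (by omega) y hy
      simp [h2]
  · rw [hjs s₁ hs₁.le]
    refine Finset.sum_eq_zero fun l _ => ?_
    by_cases hl : a l = 0
    · simp [hl]
    · rcases Nat.eq_or_lt_of_le (hz l hl) with e | e
      · rw [e, hst.2.1 s₁ hs₁, mul_zero]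
      · rw [hB.jump_right hc hj hs (by omega) s₁ hs₁.le, mul_zero]
  · rw [hjs s le_rfl, Finset.sum_eq_single_of_mem _ (Finset.mem_range.2 hK)]
    · exact mul_ne_zero h1 hst.2.2
    · intro l _ hl
      by_cases hl0 : a l = 0
      · simp [hl0]
      · have := hz l hl0
        rw [hB.jump_right hc hj hs (by omega) s le_rfl, mul_zero]

/-- The first nonzero coefficient of a combination that starts at `x i` with order `s` belongs to the basis
function with the same start. Every combination starts like its first function, and starts are unique. -/
lemma coeff_of_starts (hB : D.HasEnds c B) (hc : D.Valid c) {a : ℕ → ℝ}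
    (ha : ∀ l, D.cntU c D.m ≤ l → a l = 0) {i s : ℕ} (hi : i < D.m)
    (h : D.Starts (∑ l ∈ Finset.range (D.cntU c D.m), a l • B l) i s) :
    (∀ l < D.cntV c i + s, a l = 0) ∧ a (D.cntV c i + s) ≠ 0 := by
  classical
  have hne : ∃ l, a l ≠ 0 := by
    by_contra! h0
    refine h.2.2 (jump_eq_zero hi.le s fun y _ => ?_)
    simp [h0]
  have hl0 := Nat.find_spec hne
  set l₀ := Nat.find hne with hl₀
  have hK : l₀ < D.cntU c D.m := by
    by_contra! hle
    exact hl0 (ha l₀ hle)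
  obtain ⟨i', hi', s', h1, h2, h3⟩ := hc.exists_start hK
  have hmin : ∀ l < l₀, a l = 0 := fun l hl => by
    by_contra h'
    exact Nat.find_min hne hl h'
  have hst := hB.starts_sum hc (a := a) hi' h1 h2 (by rwa [← h3]) (by rwa [← h3]) (by rwa [← h3])
  obtain ⟨rfl, rfl⟩ := h.unique hst hi.le hi'.le
  rw [← h3]
  exact ⟨hmin, hl0⟩

/-- The last nonzero coefficient of a combination that ends at `x j` with order `s` belongs to the basis
function with the same end. -/
lemma coeff_of_stops (hB : D.HasEnds c B) (hc : D.Valid c) {a : ℕ → ℝ}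
    (ha : ∀ l, D.cntU c D.m ≤ l → a l = 0) {j s : ℕ} (hj : j ≤ D.m)
    (h : D.Stops (∑ l ∈ Finset.range (D.cntU c D.m), a l • B l) j s) :
    ∃ k, k + 1 + s = D.cntU c j ∧ (∀ l, k < l → a l = 0) ∧ a k ≠ 0 := by
  classical
  have hne : ∃ l ≤ D.cntU c D.m, a l ≠ 0 := by
    by_contra! h0
    refine h.2.2 (jump_eq_zero hj s fun y _ => ?_)
    rw [Finset.sum_apply]
    refine Finset.sum_eq_zero fun l hl => ?_
    rw [Finset.mem_range] at hl
    simp [h0 l hl.le]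
  have hl0 : a (Nat.findGreatest (fun l => a l ≠ 0) (D.cntU c D.m)) ≠ 0 := by
    obtain ⟨l, hl, h'⟩ := hne
    exact Nat.findGreatest_spec (P := fun l => a l ≠ 0) hl h'
  set l₀ := Nat.findGreatest (fun l => a l ≠ 0) (D.cntU c D.m) with hl₀
  have hK : l₀ < D.cntU c D.m := by
    by_contra! hle
    exact hl0 (ha l₀ hle)
  obtain ⟨j', h1', hj', s', h1, h2, h3⟩ := hc.exists_finish hK
  have hmax : ∀ l, l₀ < l → a l = 0 := fun l hl => by
    by_contra h'
    rcases Nat.lt_or_ge l (D.cntU c D.m) with hlt | hge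
    · exact Nat.findGreatest_is_greatest hl hlt.le h'
    · exact h' (ha l hge)
  have hst := hB.stops_sum hc (a := a) h1' hj' h1 h2 h3 hmax hl0 hK
  obtain ⟨rfl, rfl⟩ := h.unique hst hj hj'
  exact ⟨l₀, h3, hmax, hl0⟩

/-- The first function with a nonzero coefficient would give the combination a start. -/
lemma linearIndependent_nat (hB : D.HasEnds c B) (hc : D.Valid c) {a : ℕ → ℝ}
    (h : ∑ l ∈ Finset.range (D.cntU c D.m), a l • B l = 0) :
    ∀ l < D.cntU c D.m, a l = 0 := by
  classical
  by_contra! hne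
  have hspec := Nat.find_spec hne
  set l₀ := Nat.find hne
  obtain ⟨i', hi', s', h1, h2, h3⟩ := hc.exists_start hspec.1
  have hmin : ∀ l < l₀, a l = 0 := fun l hl => by
    by_contra h'
    exact Nat.find_min hne hl ⟨hl.trans hspec.1, h'⟩
  have hst := hB.starts_sum hc (a := a) hi' h1 h2 (by rwa [← h3]) (by rw [← h3]; exact hspec.2)
    (K := D.cntU c D.m) (by rw [← h3]; exact hspec.1)
  rw [h] at hst
  exact hst.2.2 (jump_eq_zero hi'.le s' fun _ _ => rfl)

lemma exists_coeff (hB : D.HasEnds c B) {f : ℝ → ℝ} (hf : f ∈ D.splines c) :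
    ∃ a : ℕ → ℝ, (∀ l, D.cntU c D.m ≤ l → a l = 0) ∧
      f = ∑ l ∈ Finset.range (D.cntU c D.m), a l • B l := by
  have key : ∀ g ∈ Submodule.span ℝ (range B), ∃ a : ℕ → ℝ, (∀ l, D.cntU c D.m ≤ l → a l = 0) ∧
      g = ∑ l ∈ Finset.range (D.cntU c D.m), a l • B l := by
    intro g hg
    induction hg using Submodule.span_induction with
    | mem g hg =>
      obtain ⟨k, rfl⟩ := hg
      rcases Nat.lt_or_ge k (D.cntU c D.m) with hk | hk
      · refine ⟨fun l => if l = k then 1 else 0, fun l hl => if_neg (by omega), ?_⟩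
        simp [hk]
      · exact ⟨0, fun _ _ => rfl, by simp [hB.zero k hk]⟩
    | zero => exact ⟨0, fun _ _ => rfl, by simp⟩
    | add g₁ g₂ _ _ h₁ h₂ =>
      obtain ⟨a₁, z₁, e₁⟩ := h₁
      obtain ⟨a₂, z₂, e₂⟩ := h₂
      refine ⟨a₁ + a₂, fun l hl => by simp [z₁ l hl, z₂ l hl], ?_⟩
      rw [e₁, e₂, ← Finset.sum_add_distrib]
      exact Finset.sum_congr rfl fun l _ => by rw [Pi.add_apply, add_smul]
    | smul b g₁ _ h₁ =>
      obtain ⟨a₁, z₁, e₁⟩ := h₁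
      refine ⟨b • a₁, fun l hl => by simp [z₁ l hl], ?_⟩
      rw [e₁, Finset.smul_sum]
      exact Finset.sum_congr rfl fun l _ => by rw [Pi.smul_apply, smul_assoc]
  exact key f (hB.span f hf)

end HasEnds

end Data

/-! ### The nullspace routine -/

/-- The bidiagonal matrix with diagonal `α` in the rows before `t` and superdiagonal `β` in the rows
before `u`. -/
noncomputable def bidiag (α β : ℕ → ℝ) (t u : ℕ) : ℕ → ℕ → ℝ := fun i j =>
  if j = i ∧ i < t then α i else if j = i + 1 ∧ i < u then β i else 0

lemma write_diag {α β : ℕ → ℝ} {k u : ℕ} {z : ℝ} (hz : z = α k) :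
    write (bidiag α β k u) k k z = bidiag α β (k + 1) u := by
  funext i j
  simp only [write, bidiag]
  grind

lemma write_super {α β : ℕ → ℝ} {t k : ℕ} {z : ℝ} (hz : z = β k) :
    write (bidiag α β t k) k (k + 1) z = bidiag α β t (k + 1) := by
  funext i j
  simp only [write, bidiag]
  grind

/-- The nullspace routine computes the bidiagonal matrix with column sums `1` that annihilates a
vector whose nonzero entries are those from `κ` to `υ`. -/
lemma nullspace_eq {n : ℕ} (a : Fin n → ℝ) {a₀ α β : ℕ → ℝ} (ha : ∀ k : Fin n, a k = a₀ k)
    {κ υ : ℕ} (hκ : κ < υ) (hυ : υ < n) (h0 : ∀ k < κ, a₀ k = 0)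
    (h1 : ∀ k, κ ≤ k → k ≤ υ → a₀ k ≠ 0) (h2 : ∀ k, υ < k → k < n → a₀ k = 0)
    (hα0 : α 0 = 1) (hαβ : ∀ k, k + 1 < n → α (k + 1) + β k = 1) (hβ : ∀ k < κ, β k = 0)
    (hα : ∀ k, υ ≤ k → α k = 0) (hrel : ∀ k, κ ≤ k → k < υ → α k * a₀ k + β k * a₀ (k + 1) = 0)
    (i : Fin (n - 1)) (j : Fin n) :
    nullspace a i j = if (j : ℕ) = i then α i else if (j : ℕ) = i + 1 then β i else 0 := by
  set a₁ : ℕ → ℝ := fun k => if h : k < n then a ⟨k, h⟩ else 0 with ha₁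
  have ha' : ∀ k < n, a₁ k = a₀ k := fun k hk => by simp [ha₁, hk, ha]
  have hα1 : ∀ k ≤ κ, α k = 1 := by
    intro k hk
    rcases k with _ | k
    · exact hα0
    · have := hαβ k (by omega)
      rw [hβ k (by omega)] at this
      linarith
  have hβ1 : ∀ k, υ ≤ k + 1 → k + 1 < n → β k = 1 := by
    intro k hk hkn
    have := hαβ k hkn
    rw [hα (k + 1) hk] at this
    linarith
  -- the first loop writes `1 = α k` on the diagonal and ends at the first nonzero entry
  have hA : ∀ t k, k + t = κ → loopA n a₁ k (bidiag α β k 0) = (κ, bidiag α β κ 0) := by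
    intro t
    induction t with
    | zero =>
      intro k hk
      rw [loopA, if_neg]
      · rw [show k = κ by omega]
      · rintro ⟨-, h⟩
        rw [ha' k (by omega)] at h
        exact h1 k (by omega) (by omega) h
    | succ t ih =>
      intro k hk
      rw [loopA, if_pos ⟨by omega, by rw [ha' k (by omega), h0 k (by omega)]⟩,
        write_diag (hα1 k (by omega)).symm]
      exact ih (k + 1) (by omega)
  -- the superdiagonal entries before `κ` are zero, so nothing has to be written there
  have hM : bidiag α β (κ + 1) 0 = bidiag α β (κ + 1) κ := by
    funext i j
    simp only [bidiag]
    grind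
  -- the second loop follows `α k * a₀ k + β k * a₀ (k + 1) = 0` and `α (k + 1) + β k = 1`; it ends at `υ`,
  -- or one index earlier if `υ` is the last column, since there is no row `υ` in that case
  have hC : ∀ t k, k + t = υ → κ ≤ k → ∃ k', υ ≤ k' + 1 ∧
      loopC n a₁ k (bidiag α β (k + 1) k) = (k', bidiag α β (k' + 1) k') := by
    intro t
    induction t with
    | zero =>
      intro k hk _
      refine ⟨k, by omega, ?_⟩
      rw [loopC, if_neg]
      rintro ⟨hn, h⟩
      rw [ha' (k + 1) (by omega)] at h
      exact h (h2 (k + 1) (by omega) (by omega))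
    | succ t ih =>
      intro k hk hκk
      by_cases hn : k + 2 < n
      · rw [loopC, if_pos ⟨hn, by rw [ha' (k + 1) (by omega)]; exact h1 _ (by omega) (by omega)⟩]
        have hb : -bidiag α β (k + 1) k k k * a₁ k / a₁ (k + 1) = β k := by
          have e1 := h1 (k + 1) (by omega) (by omega)
          have e2 := hrel k hκk (by omega)
          rw [ha' k (by omega), ha' (k + 1) (by omega)]
          simp only [bidiag]
          rw [if_pos ⟨trivial, by omega⟩, div_eq_iff e1]
          linarith
        simp only
        rw [write_super hb, write_diag]
        · exact ih (k + 1) (by omega) (by omega)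
        · have := hαβ k (by omega)
          simp only [bidiag]
          rw [if_neg (by omega), if_pos ⟨trivial, by omega⟩]
          linarith
      · refine ⟨k, by omega, ?_⟩
        rw [loopC, if_neg (by omega)]
  -- the third loop writes `1 = β k` on the remaining superdiagonal
  have hB : ∀ s t k, k + s = n → υ ≤ k + 1 → loopB n k (bidiag α β t k) =
      bidiag α β t (max k (n - 1)) := by
    intro s
    induction s with
    | zero =>
      intro t k hk _
      rw [loopB, if_neg (by omega), max_eq_left (by omega)]
    | succ s ih =>
      intro t k hk hυk
      by_cases h : k + 1 < n
      · rw [loopB, if_pos h, write_super (hβ1 k hυk h).symm, ih t (k + 1) (by omega) (by omega)]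
        congr 1
        omega
      · rw [loopB, if_neg h]
        congr 1
        omega
  have hB' : ∀ t k, υ ≤ k + 1 → loopB n k (bidiag α β t k) = bidiag α β t (max k (n - 1)) := by
    intro t k hk
    by_cases h : k ≤ n
    · exact hB (n - k) t k (by omega) hk
    · rw [loopB, if_neg (by omega), max_eq_left (by omega)]
  have hinit : (fun _ _ => 0 : ℕ → ℕ → ℝ) = bidiag α β 0 0 := by
    funext i j
    simp [bidiag]
  obtain ⟨k', hk', hCk⟩ := hC (υ - κ) κ (by omega) le_rfl
  have hfin : nullspace a i j = bidiag α β (k' + 1) (max k' (n - 1)) i j := by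
    simp only [nullspace]
    rw [← ha₁, hinit, hA κ 0 (by omega)]
    simp only
    rw [write_diag (hα1 κ le_rfl).symm, hM, hCk]
    simp only
    rw [hB' _ _ hk']
  rw [hfin]
  simp only [bidiag]
  have hi := i.2
  by_cases hji : (j : ℕ) = i
  · rw [if_pos hji]
    by_cases hik : (i : ℕ) < k' + 1
    · rw [if_pos ⟨hji, hik⟩]
    · rw [if_neg (by omega), if_neg (by omega), hα i (by omega)]
  · rw [if_neg hji, if_neg (by omega)]
    by_cases hj1 : (j : ℕ) = i + 1
    · rw [if_pos hj1, if_pos ⟨hj1, lt_max_of_lt_right hi⟩]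
    · rw [if_neg hj1, if_neg (by omega)]

namespace Data

variable {D : Data} {c : ℕ → ℕ}

/-! ### Adding one smoothness constraint -/

/-- One more smoothness constraint at `x i`. -/
def addOne (c : ℕ → ℕ) (i : ℕ) : ℕ → ℕ := Function.update c i (c i + 1)

lemma addOne_self (c : ℕ → ℕ) (i : ℕ) : addOne c i i = c i + 1 := by simp [addOne]

lemma addOne_of_ne {i j : ℕ} (h : j ≠ i) : addOne c i j = c j := by simp [addOne, h]

lemma cntU_addOne_of_le {i i₀ : ℕ} (h : i ≤ i₀) : D.cntU (addOne c i₀) i = D.cntU c i := by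
  refine Finset.sum_congr rfl fun j hj => ?_
  rw [Finset.mem_range] at hj
  rw [addOne_of_ne (by omega)]

lemma cntV_addOne_of_lt {i i₀ : ℕ} (h : i < i₀) : D.cntV (addOne c i₀) i = D.cntV c i := by
  refine Finset.sum_congr rfl fun j hj => ?_
  rw [Finset.mem_range] at hj
  rw [addOne_of_ne (by omega)]

lemma cntU_addOne_of_lt {i i₀ : ℕ} (hp : c i₀ ≤ D.p (i₀ + 1)) (h : i₀ < i) :
    D.cntU (addOne c i₀) i + 1 = D.cntU c i := by
  induction i with
  | zero => omega
  | succ i ih =>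
    simp only [cntU, Finset.sum_range_succ] at ih ⊢
    rcases Nat.eq_or_lt_of_le (Nat.lt_succ_iff.1 h) with rfl | h'
    · have := cntU_addOne_of_le (D := D) (c := c) (le_refl i₀)
      simp only [cntU] at this
      rw [this, addOne_self]
      omega
    · have := ih h'
      rw [addOne_of_ne (show i ≠ i₀ by omega)]
      omega

lemma cntV_addOne_of_le {i i₀ : ℕ} (h1 : 1 ≤ i₀) (hp : c i₀ ≤ D.p i₀) (h : i₀ ≤ i) :
    D.cntV (addOne c i₀) i + 1 = D.cntV c i := by
  induction i with
  | zero => omega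
  | succ i ih =>
    simp only [cntV, Finset.sum_range_succ] at ih ⊢
    rcases Nat.eq_or_lt_of_le h with rfl | h'
    · have := cntV_addOne_of_lt (D := D) (c := c) (show i < i + 1 by omega)
      simp only [cntV] at this
      rw [this, addOne_self]
      omega
    · have := ih (by omega)
      rw [addOne_of_ne (show i + 1 ≠ i₀ by omega)]
      omega

/-- The situation in which a smoothness constraint of order `c i₀` is added at `x i₀`. -/
structure CanAdd (D : Data) (c : ℕ → ℕ) (i₀ : ℕ) : Prop where
  valid : D.Valid c
  one_le : 1 ≤ i₀
  lt : i₀ < D.m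
  le_left : c i₀ ≤ D.p i₀
  le_right : c i₀ ≤ D.p (i₀ + 1)

namespace CanAdd

variable {i₀ : ℕ}

lemma valid_addOne (h : D.CanAdd c i₀) : D.Valid (addOne c i₀) := by
  have := h.one_le
  have := h.lt
  have := h.le_left
  have := h.le_right
  refine ⟨?_, ?_, fun i h1 hi => ?_, fun i h1 hi => ?_⟩
  · rw [addOne_of_ne (by omega), h.valid.zero]
  · rw [addOne_of_ne (by omega), h.valid.last]
  · by_cases e : i = i₀
    · subst e; rw [addOne_self]; omega
    · rw [addOne_of_ne e]; exact h.valid.le_left i h1 hi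
  · by_cases e : i = i₀
    · subst e; rw [addOne_self]; omega
    · rw [addOne_of_ne e]; exact h.valid.le_right i h1 hi

/-- The last function that ends at `x i₀`. It ends with a jump of order `c i₀`, so that it is the first
function that violates the new constraint. -/
lemma exists_kappa (h : D.CanAdd c i₀) : ∃ κ, κ + 1 + c i₀ = D.cntU c i₀ := by
  have h1 := h.valid.cntU_eq h.lt.le
  have h2 := h.valid.cntU_succ (show i₀ - 1 < D.m by have := h.lt; omega)
  rw [show i₀ - 1 + 1 = i₀ by have := h.one_le; omega] at h2
  have := h.le_left
  exact ⟨D.cntV c i₀ - 1, by omega⟩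

lemma cntU_lt (h : D.CanAdd c i₀) : D.cntU c i₀ < D.cntU c D.m := by
  have h1 := h.valid.cntU_succ h.lt
  have h2 := h.valid.cntU_eq h.lt.le
  have h3 := cntU_mono (D := D) (c := c) (show i₀ + 1 ≤ D.m from h.lt)
  have := h.le_right
  omega

lemma cntU_last (h : D.CanAdd c i₀) : D.cntU (addOne c i₀) D.m + 1 = D.cntU c D.m :=
  cntU_addOne_of_lt h.le_right h.lt

lemma splines_subset : D.splines (addOne c i₀) ⊆ D.splines c := by
  rintro f ⟨hf, hj⟩
  refine ⟨hf, fun i h1 hi j hjc => hj i h1 hi j (lt_of_lt_of_le hjc ?_)⟩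
  by_cases e : i = i₀
  · subst e; rw [addOne_self]; omega
  · rw [addOne_of_ne e]

lemma mem_splines_addOne_iff (h : D.CanAdd c i₀) {f : ℝ → ℝ} :
    f ∈ D.splines (addOne c i₀) ↔ f ∈ D.splines c ∧ jump (D.x i₀) (c i₀) f = 0 := by
  constructor
  · intro hf
    exact ⟨splines_subset hf, hf.2 i₀ h.one_le h.lt (c i₀) (by rw [addOne_self]; omega)⟩
  · rintro ⟨hf, h0⟩
    refine ⟨hf.1, fun i h1 hi j hj => ?_⟩
    by_cases e : i = i₀
    · subst e
      rw [addOne_self] at hj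
      rcases Nat.eq_or_lt_of_le (Nat.lt_succ_iff.1 hj) with rfl | hlt
      · exact h0
      · exact hf.2 i h1 hi j hlt
    · rw [addOne_of_ne e] at hj
      exact hf.2 i h1 hi j hj

lemma jumpSmooth (h : D.CanAdd c i₀) {f : ℝ → ℝ} (hf : f ∈ D.pieceSpace) :
    f ∈ jumpSmooth (D.prev i₀) (D.x i₀) (D.next i₀) (c i₀) :=
  jumpSmooth_of_interior h.one_le h.lt h.le_left h.le_right hf

variable {B B' : ℕ → ℝ → ℝ}

/-- The functions before the last one that ends at `x i₀`, and those after the first one that starts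
there, satisfy the new constraint. -/
lemma jump_eq_zero (h : D.CanAdd c i₀) (hB : D.HasEnds c B) {k : ℕ}
    (hk : k + 1 + c i₀ < D.cntU c i₀ ∨ D.cntU c i₀ < k) : jump (D.x i₀) (c i₀) (B k) = 0 := by
  rcases hk with hk | hk
  · exact hB.jump_right h.valid h.lt.le le_rfl hk _ le_rfl
  · exact hB.jump_left h.valid h.lt le_rfl (by rwa [← h.valid.cntU_eq h.lt.le]) _ le_rfl

lemma jump_ne_zero (h : D.CanAdd c i₀) (hB : D.HasEnds c B) {k : ℕ}
    (hk : k + 1 + c i₀ = D.cntU c i₀ ∨ k = D.cntU c i₀) : jump (D.x i₀) (c i₀) (B k) ≠ 0 := by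
  rcases hk with hk | hk
  · exact (hB.finish i₀ h.one_le h.lt.le _ le_rfl h.le_left k hk).2.2
  · have := (hB.start i₀ h.lt _ le_rfl h.le_right).2.2
    rwa [← h.valid.cntU_eq h.lt.le, ← hk] at this

/-- A basis for one more constraint is a bidiagonal combination of the given one: its starts and ends
determine the first and the last coefficient of every function. -/
lemma exists_bidiagonal (h : D.CanAdd c i₀) (hB : D.HasEnds c B)
    (hB' : D.HasEnds (addOne c i₀) B') {κ : ℕ} (hκ : κ + 1 + c i₀ = D.cntU c i₀) :
    ∃ α β : ℕ → ℝ, (∀ k, k + 1 < D.cntU c D.m → B' k = α k • B k + β k • B (k + 1)) ∧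
      (∀ k < D.cntU c i₀, α k ≠ 0) ∧ (∀ k, D.cntU c i₀ ≤ k → α k = 0) ∧ (∀ k < κ, β k = 0) ∧
      ∀ k, κ ≤ k → k + 1 < D.cntU c D.m → β k ≠ 0 := by
  have hK := h.cntU_last
  have h1 := h.one_le
  have hυ := h.cntU_lt
  have key : ∀ k, k + 1 < D.cntU c D.m → ∃ α β : ℝ, B' k = α • B k + β • B (k + 1) ∧
      (k < D.cntU c i₀ → α ≠ 0) ∧ (D.cntU c i₀ ≤ k → α = 0) ∧ (k < κ → β = 0) ∧
      (κ ≤ k → β ≠ 0) := by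
    intro k hk
    obtain ⟨a, ha, hsum⟩ := hB.exists_coeff (splines_subset (hB'.mem k))
    obtain ⟨i, hi, s, hs1, hs2, hks⟩ := h.valid_addOne.exists_start (k := k) (by omega)
    obtain ⟨j, hj1, hj, t, ht1, ht2, hkt⟩ := h.valid_addOne.exists_finish (k := k) (by omega)
    have hst := hB'.start i hi s hs1 hs2
    rw [← hks, hsum] at hst
    obtain ⟨hlow, hlow0⟩ := hB.coeff_of_starts h.valid ha hi hst
    have hsp := hB'.finish j hj1 hj t ht1 ht2 k hkt
    rw [hsum] at hsp
    obtain ⟨k', hk', hup, hup0⟩ := hB.coeff_of_stops h.valid ha hj hsp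
    -- the first coefficient
    have hfirst : D.cntV c i + s = if k < D.cntU c i₀ then k else k + 1 := by
      by_cases hii : i < i₀
      · have e1 := cntV_addOne_of_lt (D := D) (c := c) hii
        have e2 := h.valid.cntU_succ hi
        have e3 := cntU_mono (D := D) (c := c) (show i + 1 ≤ i₀ from hii)
        rw [if_pos (by omega)]
        omega
      · have e1 := cntV_addOne_of_le (D := D) (c := c) h1 h.le_left (not_lt.1 hii)
        have e2 := h.valid.cntU_eq hi.le
        have e3 := cntU_mono (D := D) (c := c) (not_lt.1 hii)
        by_cases e : i = i₀
        · subst e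
          rw [addOne_self] at hs1
          rw [if_neg (by omega)]
          omega
        · rw [addOne_of_ne e] at hs1
          have e4 := h.valid.cntU_succ h.lt
          have e5 := h.valid.cntU_eq h.lt.le
          have e6 := cntU_mono (D := D) (c := c) (show i₀ + 1 ≤ i by omega)
          have := h.le_right
          rw [if_neg (by omega)]
          omega
    -- the last coefficient
    have hlast : k' = if k < κ then k else k + 1 := by
      by_cases hjj : j ≤ i₀
      · have e1 := cntU_addOne_of_le (D := D) (c := c) hjj
        have e3 := cntU_mono (D := D) (c := c) hjj
        have e2 := h.valid.cntU_eq h.lt.le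
        by_cases e : j = i₀
        · subst e
          rw [addOne_self] at ht1
          rw [if_pos (by omega)]
          omega
        · rw [addOne_of_ne e] at ht1
          have e4 := h.valid.cntU_eq hj
          have e5 := h.valid.cntU_succ (show i₀ - 1 < D.m by have := h.lt; omega)
          rw [show i₀ - 1 + 1 = i₀ by omega] at e5
          have e6 := cntV_mono (D := D) (c := c) (show j ≤ i₀ - 1 by omega)
          have := h.le_left
          rw [if_pos (by omega)]
          omega
      · have e1 := cntU_addOne_of_lt (D := D) (c := c) h.le_right (show i₀ < j by omega)
        have e2 := h.valid.cntU_eq h.lt.le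
        have e3 := h.valid.cntU_succ (show j - 1 < D.m by omega)
        rw [show j - 1 + 1 = j by omega] at e3
        have e4 := cntV_mono (D := D) (c := c) (show i₀ ≤ j - 1 by omega)
        rw [if_neg (by omega)]
        omega
    refine ⟨a k, a (k + 1), ?_, fun hlt => ?_, fun hle => ?_, fun hlt => ?_, fun hle => ?_⟩
    · have hrest : ∀ l, l ≠ k → l ≠ k + 1 → a l = 0 := by
        intro l hl1 hl2
        rcases Nat.lt_or_ge l k with hl | hl
        · refine hlow l ?_
          rw [hfirst]; split_ifs <;> omega
        · refine hup l ?_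
          rw [hlast]; split_ifs <;> omega
      rw [hsum, ← Finset.sum_subset (s₁ := {k, k + 1})]
      · rw [Finset.sum_pair (by omega)]
      · intro l hl
        rw [Finset.mem_insert, Finset.mem_singleton] at hl
        rw [Finset.mem_range]
        omega
      · intro l _ hl
        rw [Finset.mem_insert, Finset.mem_singleton] at hl
        rw [hrest l (by omega) (by omega), zero_smul]
    · rwa [hfirst, if_pos hlt] at hlow0
    · refine hlow k ?_
      rw [hfirst, if_neg (by omega)]; omega
    · refine hup (k + 1) ?_
      rw [hlast, if_pos hlt]; omega
    · rwa [hlast, if_neg (by omega)] at hup0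
  choose! α₁ β h1 h2 h3 h4 h5 using key
  -- the choice is arbitrary beyond the last row, where the coefficients are made to vanish
  refine ⟨fun k => if D.cntU c i₀ ≤ k then 0 else α₁ k, fun k => if k < κ then 0 else β k,
    fun k hk => ?_, fun k hk => ?_, fun k hk => if_pos hk, fun k hk => if_pos hk, fun k hk hk' => ?_⟩
  · rw [h1 k hk]
    congr 2
    · simp only
      split_ifs with hle
      · exact h3 k hk hle
      · rfl
    · simp only
      split_ifs with hlt
      · exact h4 k hk hlt
      · rfl
  · simp only
    rw [if_neg (by omega)]
    exact h2 k (by omega) hk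
  · simp only
    rw [if_neg (by omega)]
    exact h5 k hk' hk

end CanAdd

/-- Two partitions of unity on `[x 0, x m]` have the same sum everywhere, as both sums vanish outside. -/
lemma sum_eq_of_sum_eq_one {K K' : ℕ} {B B' : ℕ → ℝ → ℝ} (hm : ∀ k, B k ∈ D.pieceSpace)
    (hm' : ∀ k, B' k ∈ D.pieceSpace)
    (h : ∀ y ∈ Icc (D.x 0) (D.x D.m), ∑ k ∈ Finset.range K, B k y = 1)
    (h' : ∀ y ∈ Icc (D.x 0) (D.x D.m), ∑ k ∈ Finset.range K', B' k y = 1) :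
    ∑ k ∈ Finset.range K, B k = ∑ k ∈ Finset.range K', B' k := by
  funext y
  rw [Finset.sum_apply, Finset.sum_apply]
  by_cases hy : y ∈ Icc (D.x 0) (D.x D.m)
  · rw [h y hy, h' y hy]
  · rw [Finset.sum_eq_zero fun k _ => (hm k).1 y hy, Finset.sum_eq_zero fun k _ => (hm' k).1 y hy]

lemma sum_bidiagonal {α β : ℕ → ℝ} (B : ℕ → ℝ → ℝ) (K : ℕ) (hα : α K = 0) :
    ∑ k ∈ Finset.range K, (α k • B k + β k • B (k + 1)) =
      ∑ k ∈ Finset.range (K + 1), (α k + if k = 0 then 0 else β (k - 1)) • B k := by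
  have h2 : ∑ k ∈ Finset.range (K + 1), (if k = 0 then 0 else β (k - 1)) • B k =
      ∑ k ∈ Finset.range K, β k • B (k + 1) := by
    rw [Finset.sum_range_succ']
    simp
  simp only [add_smul, Finset.sum_add_distrib, h2]
  rw [Finset.sum_range_succ (fun k => α k • B k), hα, zero_smul, add_zero]

variable {B B' : ℕ → ℝ → ℝ} {i₀ : ℕ}

/-- The column sums are `1` because both bases are partitions of unity. -/
lemma CanAdd.column_sums (h : D.CanAdd c i₀) (hB : D.HasEnds c B)
    (hB' : D.HasEnds (addOne c i₀) B')
    (h1 : ∀ y ∈ Icc (D.x 0) (D.x D.m), ∑ k ∈ Finset.range (D.cntU c D.m), B k y = 1)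
    (h1' : ∀ y ∈ Icc (D.x 0) (D.x D.m),
      ∑ k ∈ Finset.range (D.cntU (addOne c i₀) D.m), B' k y = 1) {α β : ℕ → ℝ}
    (hαβ : ∀ k, k + 1 < D.cntU c D.m → B' k = α k • B k + β k • B (k + 1))
    (hα : ∀ k, D.cntU c i₀ ≤ k → α k = 0) :
    α 0 = 1 ∧ ∀ k, k + 1 < D.cntU c D.m → α (k + 1) + β k = 1 := by
  have hK := h.cntU_last
  have hυ := h.cntU_lt
  have e1 := sum_eq_of_sum_eq_one (fun k => (hB.mem k).1) (fun k => (hB'.mem k).1) h1 h1'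
  have e2 : ∑ k ∈ Finset.range (D.cntU (addOne c i₀) D.m), B' k =
      ∑ k ∈ Finset.range (D.cntU (addOne c i₀) D.m), (α k • B k + β k • B (k + 1)) :=
    Finset.sum_congr rfl fun k hk => hαβ k (by rw [Finset.mem_range] at hk; omega)
  rw [e2, sum_bidiagonal B _ (hα _ (by omega)), hK] at e1
  have e3 := hB.linearIndependent_nat h.valid
    (a := fun k => (α k + if k = 0 then 0 else β (k - 1)) - 1) (by
      simp only [sub_smul, Finset.sum_sub_distrib, one_smul]
      rw [← e1, sub_self])
  constructor
  · have := e3 0 (by omega)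
    simp only [if_true, add_zero] at this
    linarith
  · intro k hk
    have := e3 (k + 1) hk
    simp only [Nat.succ_ne_zero, if_false, Nat.add_sub_cancel] at this
    linarith

/-- One pass of the extraction algorithm: the nullspace matrix of the vector of jumps of a basis maps that
basis to the one for one more constraint. -/
lemma CanAdd.eq_nullspace (h : D.CanAdd c i₀) (hB : D.HasEnds c B)
    (hB' : D.HasEnds (addOne c i₀) B')
    (h1 : ∀ y ∈ Icc (D.x 0) (D.x D.m), ∑ k ∈ Finset.range (D.cntU c D.m), B k y = 1)
    (h1' : ∀ y ∈ Icc (D.x 0) (D.x D.m),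
      ∑ k ∈ Finset.range (D.cntU (addOne c i₀) D.m), B' k y = 1) {n : ℕ} (hn : n = D.cntU c D.m)
    (a : Fin n → ℝ) (ha : ∀ k : Fin n, a k = jump (D.x i₀) (c i₀) (B k)) (k : Fin (n - 1)) :
    B' k = ∑ l : Fin n, nullspace a k l • B l := by
  obtain ⟨κ, hκ⟩ := h.exists_kappa
  obtain ⟨α, β, hαβ, hα0, hα, hβ, hβ0⟩ := h.exists_bidiagonal hB hB' hκ
  obtain ⟨hs0, hs⟩ := h.column_sums hB hB' h1 h1' hαβ hα
  have hυ := h.cntU_lt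
  have hrel : ∀ k, k + 1 < D.cntU c D.m → α k * jump (D.x i₀) (c i₀) (B k) +
      β k * jump (D.x i₀) (c i₀) (B (k + 1)) = 0 := by
    intro k hk
    rw [← jump_add_smul (prev_lt h.lt.le) (lt_next h.lt.le) _ _ (h.jumpSmooth (hB.mem k).1)
      (h.jumpSmooth (hB.mem (k + 1)).1), ← hαβ k hk]
    exact (h.mem_splines_addOne_iff.1 (hB'.mem k)).2
  -- the jumps from `κ` to `υ` do not vanish: the first one does not, and the relations with `α k ≠ 0`
  -- carry this on
  have hne : ∀ t, κ + t ≤ D.cntU c i₀ → jump (D.x i₀) (c i₀) (B (κ + t)) ≠ 0 := by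
    intro t
    induction t with
    | zero => intro _; exact h.jump_ne_zero hB (Or.inl hκ)
    | succ t ih =>
      intro ht h0
      have e := hrel (κ + t) (by omega)
      rw [show κ + t + 1 = κ + (t + 1) by ring, h0, mul_zero, add_zero] at e
      exact mul_ne_zero (hα0 _ (by omega)) (ih (by omega)) e
  have hnull := nullspace_eq a (a₀ := fun k => jump (D.x i₀) (c i₀) (B k)) (α := α) (β := β) ha
    (κ := κ) (υ := D.cntU c i₀) (by omega) (by omega)
    (fun k hk => h.jump_eq_zero hB (Or.inl (by omega)))
    (fun k hk1 hk2 => by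
      obtain ⟨t, rfl⟩ := Nat.exists_eq_add_of_le hk1
      exact hne t hk2)
    (fun k hk _ => h.jump_eq_zero hB (Or.inr hk)) hs0 (fun k hk => hs k (by omega)) hβ hα
    (fun k _ hk => hrel k (by omega)) k
  have hk2 := k.2
  rw [hαβ k (by omega), ← Finset.sum_subset
    (s₁ := {(⟨k, by omega⟩ : Fin n), ⟨k + 1, by omega⟩}) (Finset.subset_univ _)]
  · rw [Finset.sum_pair (by simp [Fin.ext_iff]), hnull, hnull]
    simp
  · intro l _ hl
    rw [Finset.mem_insert, Finset.mem_singleton, Fin.ext_iff, Fin.ext_iff] at hl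
    push Not at hl
    rw [hnull, if_neg hl.1, if_neg hl.2, zero_smul]

/-- A basis that is a partition of unity is determined by its starts and ends. -/
lemma HasEnds.unique (hc : D.Valid c) (hB : D.HasEnds c B) (hB' : D.HasEnds c B')
    (h1 : ∀ y ∈ Icc (D.x 0) (D.x D.m), ∑ k ∈ Finset.range (D.cntU c D.m), B k y = 1)
    (h1' : ∀ y ∈ Icc (D.x 0) (D.x D.m), ∑ k ∈ Finset.range (D.cntU c D.m), B' k y = 1) :
    B' = B := by
  have key : ∀ k, ∃ α : ℝ, B' k = α • B k := by
    intro k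
    rcases Nat.lt_or_ge k (D.cntU c D.m) with hk | hk
    · obtain ⟨a, ha, hsum⟩ := hB.exists_coeff (hB'.mem k)
      obtain ⟨i, hi, s, hs1, hs2, hks⟩ := hc.exists_start hk
      obtain ⟨j, hj1, hj, t, ht1, ht2, hkt⟩ := hc.exists_finish hk
      have hst := hB'.start i hi s hs1 hs2
      rw [← hks, hsum] at hst
      obtain ⟨hlow, -⟩ := hB.coeff_of_starts hc ha hi hst
      have hsp := hB'.finish j hj1 hj t ht1 ht2 k hkt
      rw [hsum] at hsp
      obtain ⟨k', hk', hup, -⟩ := hB.coeff_of_stops hc ha hj hsp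
      obtain rfl : k' = k := by omega
      refine ⟨a k', ?_⟩
      rw [hsum, Finset.sum_eq_single_of_mem k' (Finset.mem_range.2 hk)]
      intro l _ hl
      rcases Nat.lt_or_ge l k' with h | h
      · rw [hlow l (by omega), zero_smul]
      · rw [hup l (by omega), zero_smul]
    · exact ⟨0, by rw [hB'.zero k hk, zero_smul]⟩
  choose α hα using key
  -- the multiples are determined by the partition of unity
  have e1 := sum_eq_of_sum_eq_one (fun k => (hB.mem k).1) (fun k => (hB'.mem k).1) h1 h1'
  have e3 := hB.linearIndependent_nat hc (a := fun k => α k - 1) (by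
    simp only [sub_smul, Finset.sum_sub_distrib, one_smul, ← hα]
    rw [← e1, sub_self])
  funext k
  rcases Nat.lt_or_ge k (D.cntU c D.m) with hk | hk
  · rw [hα k, show α k = 1 by linarith [e3 k hk], one_smul]
  · rw [hB'.zero k hk, hB.zero k hk]

end Data

lemma blockStart_mono (s : ℕ → ℕ) : Monotone (blockStart s) := fun _ _ h =>
  Finset.sum_le_sum_of_subset (Finset.range_mono h)

lemma blockStart_succ (s : ℕ → ℕ) (i : ℕ) : blockStart s (i + 1) = blockStart s i + s i :=
  Finset.sum_range_succ _ _

lemma blockOf_eq {s : ℕ → ℕ} {i k : ℕ} (h1 : blockStart s i ≤ k) (h2 : k < blockStart s (i + 1)) :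
    blockOf s k = i := by
  apply le_antisymm
  · exact Nat.sInf_le h2
  · by_contra! h
    have hmem : blockOf s k ∈ {i | k < blockStart s (i + 1)} := Nat.sInf_mem ⟨i, h2⟩
    have := blockStart_mono s (show blockOf s k + 1 ≤ i from h)
    have h3 : k < blockStart s (blockOf s k + 1) := hmem
    omega

lemma exists_block {s : ℕ → ℕ} {n k : ℕ} (h : k < blockStart s n) :
    ∃ i < n, blockStart s i ≤ k ∧ k < blockStart s (i + 1) := by
  induction n with
  | zero => simp [blockStart] at h
  | succ n ih =>
    rcases Nat.lt_or_ge k (blockStart s n) with h1 | h1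
    · obtain ⟨i, hi, h2⟩ := ih h1
      exact ⟨i, by omega, h2⟩
    · exact ⟨n, by omega, h1, h⟩

lemma sum_range_blockStart (s : ℕ → ℕ) (n : ℕ) (F : ℕ → ℝ) :
    ∑ k ∈ Finset.range (blockStart s n), F k =
      ∑ i ∈ Finset.range n, ∑ t ∈ Finset.range (s i), F (blockStart s i + t) := by
  induction n with
  | zero => simp [blockStart]
  | succ n ih => rw [blockStart_succ, Finset.sum_range_add, Finset.sum_range_succ, ih]

namespace Data

variable {D : Data} {c : ℕ → ℕ}

variable (D) in
/-- The properties of a GTB-spline basis for `c i` smoothness constraints at `x i`, for a basis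
indexed as in `HasEnds`. -/
structure IsGtb (c : ℕ → ℕ) (B : ℕ → ℝ → ℝ) : Prop extends D.HasEnds c B where
  pos : ∀ i < D.m, ∀ s, c i ≤ s → s ≤ D.p (i + 1) → ∀ j, 1 ≤ j → j ≤ D.m → ∀ t, c j ≤ t →
    t ≤ D.p j → D.cntV c i + s + 1 + t = D.cntU c j → ∀ y ∈ Ioo (D.x i) (D.x j),
    0 < B (D.cntV c i + s) y
  sum_one : ∀ y ∈ Icc (D.x 0) (D.x D.m), ∑ k ∈ Finset.range (D.cntU c D.m), B k y = 1
  loc : ∀ i < D.m, Submodule.span ℝ {f | ∃ k, D.cntV c i ≤ k ∧ k < D.cntU c (i + 1) ∧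
    f = (D.I (i + 1)).domRestrict (B k)} = D.T (i + 1)

/-! ### The global Bernstein basis -/

variable (D) in
/-- The global Bernstein functions, extended by zero functions to all indices. -/
noncomputable def bernBasis (k : ℕ) : ℝ → ℝ := if k < D.M then D.bernstein k else 0

lemma valid_zero : D.Valid 0 := ⟨rfl, rfl, fun _ _ _ => Nat.zero_le _, fun _ _ _ => Nat.zero_le _⟩

lemma cntU_zero (i : ℕ) : D.cntU 0 i = blockStart D.bernSizes i := rfl

lemma cntV_zero (i : ℕ) : D.cntV 0 i = blockStart D.bernSizes i := rfl

lemma bernBasis_eq {i s : ℕ} (hi : i < D.m) (hs : s ≤ D.p (i + 1)) :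
    D.bernBasis (blockStart D.bernSizes i + s) =
      (D.I (i + 1)).indicator (D.bernOn (i + 1) s) := by
  have h2 : blockStart D.bernSizes i + s < blockStart D.bernSizes (i + 1) := by
    rw [blockStart_succ, bernSizes]; omega
  have h1 : blockOf D.bernSizes (blockStart D.bernSizes i + s) = i :=
    blockOf_eq (by omega) h2
  have h3 : blockStart D.bernSizes i + s < D.M :=
    h2.trans_le (blockStart_mono _ (show i + 1 ≤ D.m from hi))
  rw [bernBasis, if_pos h3, bernstein, offset, h1, bernOn, bern, if_pos ⟨Nat.zero_le _, hs⟩]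
  simp

lemma exists_bernIdx {k : ℕ} (hk : k < D.M) :
    ∃ i < D.m, ∃ s, s ≤ D.p (i + 1) ∧ k = blockStart D.bernSizes i + s := by
  obtain ⟨i, hi, h1, h2⟩ := exists_block hk
  rw [blockStart_succ, bernSizes] at h2
  exact ⟨i, hi, k - blockStart D.bernSizes i, by omega, by omega⟩

lemma I_subset {i : ℕ} (hi : i < D.m) : D.I (i + 1) ⊆ Icc (D.x 0) (D.x D.m) := by
  refine (I_subset_Icc (i + 1)).trans (Icc_subset_Icc ?_ ?_)
  · exact x_le_of_le (by omega) (by omega)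
  · exact x_le_of_le (by omega) le_rfl

lemma indicator_mem_pieceSpace {i : ℕ} (hi : i < D.m) {g : ℝ → ℝ}
    (hg : (D.I (i + 1)).domRestrict g ∈ D.T (i + 1)) :
    (D.I (i + 1)).indicator g ∈ D.pieceSpace := by
  refine ⟨fun y hy => indicator_of_notMem (fun h => hy (I_subset hi h)) _, fun j h1 hj => ?_⟩
  by_cases e : j = i + 1
  · subst e
    have : (D.I (i + 1)).domRestrict ((D.I (i + 1)).indicator g) = (D.I (i + 1)).domRestrict g := by
      funext y
      simp
    rwa [this]
  · have : (D.I j).domRestrict ((D.I (i + 1)).indicator g) = 0 := by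
      funext y
      exact indicator_of_notMem (fun h => e (I_unique hj (by omega) y.2 h)) _
    rw [this]
    exact Submodule.zero_mem _

lemma bernOn_mem_T {i : ℕ} (h1 : 1 ≤ i) (hi : i ≤ D.m) (s : ℕ) :
    (D.I i).domRestrict (D.bernOn i s) ∈ D.T i := by
  rw [T_eq_span_bern h1 hi]
  exact Submodule.subset_span ⟨s, rfl⟩

lemma bernBasis_mem_pieceSpace (k : ℕ) : D.bernBasis k ∈ D.pieceSpace := by
  by_cases hk : k < D.M
  · obtain ⟨i, hi, s, hs, rfl⟩ := exists_bernIdx hk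
    rw [bernBasis_eq hi hs]
    exact indicator_mem_pieceSpace hi (bernOn_mem_T (by omega) hi s)
  · rw [bernBasis, if_neg hk]
    exact Submodule.zero_mem _

lemma indicator_bernOn_mem_span {i : ℕ} (hi : i < D.m) (s : ℕ) :
    (D.I (i + 1)).indicator (D.bernOn (i + 1) s) ∈ Submodule.span ℝ (range D.bernBasis) := by
  by_cases hs : s ≤ D.p (i + 1)
  · rw [← bernBasis_eq hi hs]
    exact Submodule.subset_span ⟨_, rfl⟩
  · rw [bernOn, bern_eq_zero (by omega), indicator_zero']
    exact Submodule.zero_mem _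

lemma indicator_mem_span {i : ℕ} (hi : i < D.m) {f : ℝ → ℝ}
    (hf : (D.I (i + 1)).domRestrict f ∈ D.T (i + 1)) :
    (D.I (i + 1)).indicator f ∈ Submodule.span ℝ (range D.bernBasis) := by
  have hi' : i + 1 ≤ D.m := hi
  rw [T_eq_span_bern (by omega) hi'] at hf
  have key : ∀ h ∈ Submodule.span ℝ (range fun s => (D.I (i + 1)).domRestrict (D.bernOn (i + 1) s)),
      ∃ g ∈ Submodule.span ℝ (range D.bernBasis), (∀ y : D.I (i + 1), g y = h y) ∧
        ∀ y ∉ D.I (i + 1), g y = 0 := by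
    intro h hh
    induction hh using Submodule.span_induction with
    | mem h hh =>
      obtain ⟨s, rfl⟩ := hh
      exact ⟨_, indicator_bernOn_mem_span hi s, fun y => by simp,
        fun y hy => indicator_of_notMem hy _⟩
    | zero => exact ⟨0, Submodule.zero_mem _, fun _ => rfl, fun _ _ => rfl⟩
    | add a b _ _ ha hb =>
      obtain ⟨g₁, m₁, e₁, z₁⟩ := ha
      obtain ⟨g₂, m₂, e₂, z₂⟩ := hb
      exact ⟨_, Submodule.add_mem _ m₁ m₂, fun y => by simp [e₁, e₂],
        fun y hy => by simp [z₁ y hy, z₂ y hy]⟩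
    | smul a b _ hb =>
      obtain ⟨g₁, m₁, e₁, z₁⟩ := hb
      exact ⟨_, Submodule.smul_mem _ a m₁, fun y => by simp [e₁], fun y hy => by simp [z₁ y hy]⟩
  obtain ⟨g, hg, e, z⟩ := key _ hf
  have : (D.I (i + 1)).indicator f = g := by
    funext y
    by_cases hy : y ∈ D.I (i + 1)
    · rw [indicator_of_mem hy, e ⟨y, hy⟩]; rfl
    · rw [indicator_of_notMem hy, z y hy]
  rwa [this]

lemma eq_sum_indicator {f : ℝ → ℝ} (hf : f ∈ D.pieceSpace) :
    f = ∑ i ∈ Finset.range D.m, (D.I (i + 1)).indicator f := by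
  funext y
  rw [Finset.sum_apply]
  by_cases hy : y ∈ Icc (D.x 0) (D.x D.m)
  · obtain ⟨i, h1, hi, hyi⟩ := exists_mem_I hy
    rw [Finset.sum_eq_single_of_mem (i - 1) (Finset.mem_range.2 (by omega)),
      show i - 1 + 1 = i by omega, indicator_of_mem hyi]
    intro j hj hne
    rw [Finset.mem_range] at hj
    refine indicator_of_notMem (fun h => ?_) _
    have := I_unique hj hi h hyi
    omega
  · rw [hf.1 y hy]
    refine (Finset.sum_eq_zero fun j hj => ?_).symm
    exact indicator_of_notMem (fun h => hy (I_subset (Finset.mem_range.1 hj) h)) _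

lemma mem_span_bernBasis {f : ℝ → ℝ} (hf : f ∈ D.pieceSpace) :
    f ∈ Submodule.span ℝ (range D.bernBasis) := by
  rw [eq_sum_indicator hf]
  refine Submodule.sum_mem _ fun i hi => ?_
  rw [Finset.mem_range] at hi
  exact indicator_mem_span hi (hf.2 (i + 1) (by omega) hi)

lemma bernOn_eq_mul {i : ℕ} (h1 : 1 ≤ i) (hi : i ≤ D.m) (s : ℕ) :
    EqOn (D.bernOn i s)
      (fun y => D.w i 0 y * bernChain (D.w i) (D.p i) (D.x (i - 1)) (D.x i) 0 0 s y)
      (Icc (D.x (i - 1)) (D.x i)) := by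
  intro y hy
  have := ((isWeights h1 hi).pos 0 (Nat.zero_le _) y hy).ne'
  simp only [bernChain]
  field_simp

/-- The form in which the global Bernstein functions are accessible to the theory of chains. -/
lemma indicator_eqOn {i : ℕ} (h1 : 1 ≤ i) (hi : i ≤ D.m) (s : ℕ) :
    EqOn ((D.I i).indicator (D.bernOn i s))
      (fun y => D.w i 0 y * bernChain (D.w i) (D.p i) (D.x (i - 1)) (D.x i) 0 0 s y)
      (Ioo (D.x (i - 1)) (D.x i)) := fun y hy => by
  rw [indicator_of_mem (Ioo_subset_I i hy)]
  exact bernOn_eq_mul h1 hi s (Ioo_subset_Icc_self hy)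

lemma bern_left {i : ℕ} (h1 : 1 ≤ i) (hi : i ≤ D.m) : ∀ q, 0 ≤ q → q ≤ D.p i → ∀ s,
    bern (D.w i) (D.p i) (D.x (i - 1)) (D.x i) q s (D.x (i - 1)) =
      if s = q then D.w i q (D.x (i - 1)) else 0 :=
  fun q _ hq => (bernGood (isWeights h1 hi) q hq).left

lemma bern_right {i : ℕ} (h1 : 1 ≤ i) (hi : i ≤ D.m) : ∀ q, 0 ≤ q → q ≤ D.p i → ∀ s,
    bern (D.w i) (D.p i) (D.x (i - 1)) (D.x i) q s (D.x i) =
      if s = D.p i then D.w i q (D.x i) else 0 :=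
  fun q _ hq => (bernGood (isWeights h1 hi) q hq).right

/-- The first generalized derivative of `bern 0 s` that does not vanish at the left endpoint is the one of
order `s`, and so is the first ordinary one. -/
lemma starts_bern {i s : ℕ} (hi : i < D.m) (hs : s ≤ D.p (i + 1)) :
    D.Starts ((D.I (i + 1)).indicator (D.bernOn (i + 1) s)) i s := by
  have hi' : i + 1 ≤ D.m := hi
  have hw := isWeights (D := D) (show 1 ≤ i + 1 by omega) hi'
  have hl : D.x i < D.x (i + 1) := D.x_lt i hi
  have he : D.x i ∈ Icc (D.x (i + 1 - 1)) (D.x (i + 1)) := left_mem_Icc.2 hl.le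
  have hg := isChain_bern hw s
  have hjet := hg.isJet hw he
  have hz : ∀ y < D.x i, (D.I (i + 1)).indicator (D.bernOn (i + 1) s) y = 0 := fun y hy =>
    indicator_of_notMem (fun h => absurd (I_subset_Icc (i + 1) h).1 (not_le.2 hy)) _
  have hj : ∀ l ≤ D.p (i + 1), jump (D.x i) l ((D.I (i + 1)).indicator (D.bernOn (i + 1) s)) =
      -iteratedDerivWithin l (fun y => D.w (i + 1) 0 y * bernChain (D.w (i + 1)) (D.p (i + 1))
        (D.x (i + 1 - 1)) (D.x (i + 1)) 0 0 s y) (Icc (D.x (i + 1 - 1)) (D.x (i + 1))) (D.x i) := by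
    intro l hl'
    rw [jump, leftDeriv_eq_zero (prev_lt hi.le) fun y hy => hz y hy.2, zero_sub]
    congr 1
    refine rightDeriv_eq hl ?_ (indicator_eqOn (by omega) hi' s)
    refine (hg.contDiffOn_mul hw (Nat.zero_le _)).of_le ?_
    exact_mod_cast hl'
  have hne : ∀ q ≤ D.p (i + 1), iteratedDerivWithin 0 (D.w (i + 1) q)
      (Icc (D.x (i + 1 - 1)) (D.x (i + 1))) (D.x i) ≠ 0 := fun q hq => by
    rw [iteratedDerivWithin_zero]
    exact (hw.pos q hq _ he).ne'
  have h0 : ∀ l < s, iteratedDerivWithin l (fun y => D.w (i + 1) 0 y * bernChain (D.w (i + 1))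
      (D.p (i + 1)) (D.x (i + 1 - 1)) (D.x (i + 1)) 0 0 s y)
      (Icc (D.x (i + 1 - 1)) (D.x (i + 1))) (D.x i) = 0 := by
    refine hjet.eq_zero hne (by omega) fun q hq => ?_
    rw [iteratedDerivWithin_zero]
    exact bernChain_left_eq_zero (bern_left (by omega) hi') q 0 le_rfl s (by omega)
  refine ⟨hz, fun l hls => ?_, ?_⟩
  · rw [hj l (by omega), h0 l hls, neg_zero]
  · rw [hj s hs, neg_ne_zero]
    have := hjet.deriv_eq hne s 0 (by omega) h0
    rw [this]
    refine mul_ne_zero (Finset.prod_ne_zero_iff.2 fun q hq => hne _ ?_) ?_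
    · rw [Finset.mem_range] at hq; omega
    · rw [iteratedDerivWithin_zero]
      simpa using! (bernChain_left_pos hw (bern_left (by omega) hi') s 0 le_rfl (by omega)).ne'

/-- At the right endpoint, the first derivative of `bern 0 s` that does not vanish has order `p - s`. -/
lemma stops_bern {i s t : ℕ} (h1 : 1 ≤ i) (hi : i ≤ D.m) (hst : s + t = D.p i) :
    D.Stops ((D.I i).indicator (D.bernOn i s)) i t := by
  have hw := isWeights (D := D) h1 hi
  have hl : D.x (i - 1) < D.x i := hw.lt
  have he : D.x i ∈ Icc (D.x (i - 1)) (D.x i) := right_mem_Icc.2 hl.le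
  have hg := isChain_bern hw s
  have hjet := hg.isJet hw he
  have hz : ∀ y, D.x i < y → (D.I i).indicator (D.bernOn i s) y = 0 := fun y hy =>
    indicator_of_notMem (fun h => absurd (I_subset_Icc i h).2 (not_le.2 hy)) _
  have hj : ∀ l ≤ D.p i, jump (D.x i) l ((D.I i).indicator (D.bernOn i s)) =
      iteratedDerivWithin l (fun y => D.w i 0 y * bernChain (D.w i) (D.p i)
        (D.x (i - 1)) (D.x i) 0 0 s y) (Icc (D.x (i - 1)) (D.x i)) (D.x i) := by
    intro l hl'
    rw [jump, rightDeriv_eq_zero (lt_next hi) fun y hy => hz y hy.1, sub_zero]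
    refine leftDeriv_eq hl ?_ (indicator_eqOn h1 hi s)
    refine (hg.contDiffOn_mul hw (Nat.zero_le _)).of_le ?_
    exact_mod_cast hl'
  have hne : ∀ q ≤ D.p i, iteratedDerivWithin 0 (D.w i q)
      (Icc (D.x (i - 1)) (D.x i)) (D.x i) ≠ 0 := fun q hq => by
    rw [iteratedDerivWithin_zero]
    exact (hw.pos q hq _ he).ne'
  have h0 : ∀ l < t, iteratedDerivWithin l (fun y => D.w i 0 y * bernChain (D.w i)
      (D.p i) (D.x (i - 1)) (D.x i) 0 0 s y) (Icc (D.x (i - 1)) (D.x i)) (D.x i) = 0 := by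
    refine hjet.eq_zero hne (by omega) fun q hq => ?_
    rw [iteratedDerivWithin_zero]
    exact bernChain_right_eq_zero (bern_right h1 hi) q 0 le_rfl s (by omega)
  refine ⟨hz, fun l hls => ?_, ?_⟩
  · rw [hj l (by omega), h0 l hls]
  · rw [hj t (by omega)]
    have := hjet.deriv_eq hne t 0 (by omega) h0
    rw [this]
    refine mul_ne_zero (Finset.prod_ne_zero_iff.2 fun q hq => hne _ ?_) ?_
    · rw [Finset.mem_range] at hq; omega
    · rw [iteratedDerivWithin_zero]
      simpa using! bernChain_right_ne_zero hw (bern_right h1 hi) t 0 le_rfl s (Nat.zero_le _) hst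

lemma sum_bernBasis (hw : D.IsNormalized) {y : ℝ} (hy : y ∈ Icc (D.x 0) (D.x D.m)) :
    ∑ k ∈ Finset.range D.M, D.bernBasis k y = 1 := by
  rw [sum_range_blockStart]
  obtain ⟨i, h1, hi, hyi⟩ := exists_mem_I hy
  have h2 : ∀ j ∈ Finset.range D.m, ∑ t ∈ Finset.range (D.bernSizes j),
      D.bernBasis (blockStart D.bernSizes j + t) y =
      ∑ t ∈ Finset.range (D.p (j + 1) + 1), (D.I (j + 1)).indicator (D.bernOn (j + 1) t) y := by
    intro j hj
    refine Finset.sum_congr rfl fun t ht => ?_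
    have ht : t < D.p (j + 1) + 1 := Finset.mem_range.1 ht
    rw [bernBasis_eq (Finset.mem_range.1 hj) (by omega)]
  rw [Finset.sum_congr rfl h2, Finset.sum_eq_single_of_mem (i - 1) (Finset.mem_range.2 (by omega)),
    show i - 1 + 1 = i by omega]
  · simp only [indicator_of_mem hyi]
    rw [sum_bern (isWeights h1 hi) (I_subset_Icc i hyi)]
    exact hw i h1 hi y (I_subset_Icc i hyi)
  · intro j hj hne
    rw [Finset.mem_range] at hj
    refine Finset.sum_eq_zero fun t _ => indicator_of_notMem (fun h => ?_) _
    have := I_unique hj hi h hyi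
    omega

/-- The global Bernstein functions are the GTB-spline basis of the discontinuous splines. -/
lemma isGtb_bernBasis (hw : D.IsNormalized) : D.IsGtb 0 D.bernBasis where
  zero k hk := if_neg (not_lt.2 hk)
  mem k := ⟨bernBasis_mem_pieceSpace k, fun _ _ _ _ h => absurd h (Nat.not_lt_zero _)⟩
  span f hf := mem_span_bernBasis hf.1
  start i hi s _ hs := by
    rw [cntV_zero, bernBasis_eq hi hs]
    exact starts_bern hi hs
  finish j h1 hj s _ hs k hk := by
    have e := blockStart_succ D.bernSizes (j - 1)
    rw [bernSizes, show j - 1 + 1 = j by omega] at e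
    rw [cntU_zero, e] at hk
    obtain rfl : k = blockStart D.bernSizes (j - 1) + (D.p j - s) := by omega
    have := bernBasis_eq (D := D) (show j - 1 < D.m by omega) (s := D.p j - s)
      (by rw [show j - 1 + 1 = j by omega]; omega)
    rw [show j - 1 + 1 = j by omega] at this
    rw [this]
    exact stops_bern h1 hj (by omega)
  pos i hi s _ hs j h1 hj t _ ht hst y hy := by
    have hji : j = i + 1 := by
      rw [cntV_zero, cntU_zero] at hst
      by_contra hne
      rcases Nat.lt_or_ge j (i + 1) with h | h
      · have := blockStart_mono D.bernSizes (show j ≤ i by omega)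
        omega
      · have e1 := blockStart_mono D.bernSizes (show i + 1 ≤ j - 1 by omega)
        rw [blockStart_succ, bernSizes] at e1
        have e2 := blockStart_succ D.bernSizes (j - 1)
        rw [bernSizes, show j - 1 + 1 = j by omega] at e2
        omega
    subst hji
    rw [cntV_zero, bernBasis_eq hi hs, indicator_of_mem (Ioo_subset_I (i + 1) hy)]
    exact (bernGood (isWeights h1 hj) 0 (Nat.zero_le _)).pos s (Nat.zero_le _) hs y hy
  sum_one y hy := sum_bernBasis hw hy
  loc i hi := by
    have hi' : i + 1 ≤ D.m := hi
    have hr : ∀ s ≤ D.p (i + 1), (D.I (i + 1)).domRestrict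
        (D.bernBasis (blockStart D.bernSizes i + s)) =
        (D.I (i + 1)).domRestrict (D.bernOn (i + 1) s) := by
      intro s hs
      rw [bernBasis_eq hi hs]
      funext y
      simp
    rw [T_eq_span_bern (by omega) hi']
    apply le_antisymm
    · refine Submodule.span_le.2 ?_
      rintro _ ⟨k, hk1, hk2, rfl⟩
      rw [cntV_zero] at hk1
      rw [cntU_zero, blockStart_succ, bernSizes] at hk2
      obtain ⟨s, rfl⟩ := Nat.exists_eq_add_of_le hk1
      rw [hr s (by omega)]
      exact Submodule.subset_span ⟨s, rfl⟩
    · refine Submodule.span_le.2 ?_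
      rintro _ ⟨s, rfl⟩
      by_cases hs : s ≤ D.p (i + 1)
      · refine Submodule.subset_span ⟨blockStart D.bernSizes i + s, ?_, ?_, (hr s hs).symm⟩
        · rw [cntV_zero]; omega
        · rw [cntU_zero, blockStart_succ, bernSizes]; omega
      · simp only
        rw [bernOn, bern_eq_zero (by omega)]
        exact Submodule.zero_mem _

end Data

namespace Data

variable {D : Data} {c : ℕ → ℕ} {r : ℕ → ℤ}

/-! ### Smoothness vectors and numbers of constraints -/

variable (D) in
/-- The smoothness vector `r` imposes `c i` constraints at `x i`. -/
def Agrees (r : ℕ → ℤ) (c : ℕ → ℕ) : Prop := ∀ i ≤ D.m, r i = (c i : ℤ) - 1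

namespace Agrees

lemma blockStart_uSizes (h : D.Agrees r c) {i : ℕ} (hi : i ≤ D.m) :
    blockStart (D.uSizes r) i = D.cntU c i := by
  refine Finset.sum_congr rfl fun j hj => ?_
  rw [Finset.mem_range] at hj
  have := h j (by omega)
  rw [uSizes]
  omega

lemma blockStart_vSizes (h : D.Agrees r c) {i : ℕ} (hi : i ≤ D.m) :
    blockStart (D.vSizes r) i = D.cntV c i := by
  refine Finset.sum_congr rfl fun j hj => ?_
  rw [Finset.mem_range] at hj
  have := h (j + 1) (by omega)
  rw [vSizes]
  omega

lemma O_eq (h : D.Agrees r c) (hc : D.Valid c) : D.O r = ∑ j ∈ Finset.range D.m, c j := by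
  have h1 := D.one_le_m
  have h2 : D.O r = ∑ j ∈ Finset.range (D.m - 1), c (j + 1) := by
    refine Finset.sum_congr rfl fun j hj => ?_
    rw [Finset.mem_range] at hj
    have := h (j + 1) (by omega)
    rw [constraintSizes]
    omega
  obtain ⟨n, hn⟩ : ∃ n, D.m = n + 1 := ⟨D.m - 1, by omega⟩
  rw [h2, hn, Finset.sum_range_succ', hc.zero]
  simp

lemma N_eq (h : D.Agrees r c) (hc : D.Valid c) : D.N r = D.cntU c D.m := by
  have key : ∀ i ≤ D.m, blockStart D.bernSizes i = D.cntU c i + ∑ j ∈ Finset.range i, c j := by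
    intro i
    induction i with
    | zero => intro _; rfl
    | succ i ih =>
      intro hi
      have h1 := ih (by omega)
      have h2 := hc.le_right' (show i < D.m by omega)
      rw [blockStart_succ, Finset.sum_range_succ, h1]
      simp only [cntU, bernSizes, Finset.sum_range_succ]
      omega
  have h1 := h.O_eq hc
  have h2 : D.M = _ := key D.m le_rfl
  rw [N, h1]
  omega

lemma uIdx_eq (h : D.Agrees r c) (hc : D.Valid c) {i s : ℕ} (hi : i < D.m) (hs : c i ≤ s)
    (hs' : s ≤ D.p (i + 1)) : D.uIdx r (D.cntV c i + s) = i := by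
  have h1 := hc.cntU_eq hi.le
  have h2 := hc.cntU_succ hi
  apply blockOf_eq
  · rw [h.blockStart_uSizes hi.le]; omega
  · rw [h.blockStart_uSizes (show i + 1 ≤ D.m from hi)]; omega

lemma vIdx_eq (h : D.Agrees r c) (hc : D.Valid c) {j s k : ℕ} (h1 : 1 ≤ j) (hj : j ≤ D.m)
    (hs : c j ≤ s) (hs' : s ≤ D.p j) (hk : k + 1 + s = D.cntU c j) : D.vIdx r k = j := by
  have e1 := hc.cntU_eq hj
  have e2 := hc.cntU_succ (show j - 1 < D.m by omega)
  rw [show j - 1 + 1 = j by omega] at e2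
  have : blockOf (D.vSizes r) k = j - 1 := by
    apply blockOf_eq
    · rw [h.blockStart_vSizes (show j - 1 ≤ D.m by omega)]; omega
    · rw [h.blockStart_vSizes (show j - 1 + 1 ≤ D.m by omega), show j - 1 + 1 = j by omega]; omega
  rw [vIdx, this]
  omega

lemma x_injective {i j : ℕ} (hi : i ≤ D.m) (hj : j ≤ D.m) (h : D.x i = D.x j) : i = j := by
  rcases lt_trichotomy i j with h1 | h1 | h1
  · exact absurd h (x_lt_of_lt h1 hj).ne
  · exact h1
  · exact absurd h (x_lt_of_lt h1 hi).ne'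

/-- The multiplicity of the knot translates the order of the first jump into the smoothness order: a jump
of order `s` is the same as exact smoothness `C^(s-1)`. -/
lemma ru_eq (h : D.Agrees r c) (hc : D.Valid c) {i s : ℕ} (hi : i < D.m) (hs : c i ≤ s)
    (hs' : s ≤ D.p (i + 1)) : D.ru r (D.cntV c i + s) = (s : ℤ) - 1 := by
  have h2 := hc.cntU_succ hi
  have hmono := cntU_mono (D := D) (c := c) (show i + 1 ≤ D.m from hi)
  have hgr : IsGreatest {l : ℕ | D.cntV c i + s + l < D.N r ∧
      D.u r (D.cntV c i + s) = D.u r (D.cntV c i + s + l)} (D.p (i + 1) - s) := by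
    constructor
    · refine ⟨by rw [h.N_eq hc]; omega, ?_⟩
      rw [show D.cntV c i + s + (D.p (i + 1) - s) = D.cntV c i + D.p (i + 1) by omega, u, u,
        h.uIdx_eq hc hi hs hs', h.uIdx_eq hc hi (by omega) le_rfl]
    · rintro l ⟨hl1, hl2⟩
      rw [h.N_eq hc] at hl1
      obtain ⟨i', hi', s', e1, e2, e3⟩ := hc.exists_start hl1
      rw [e3, u, u, h.uIdx_eq hc hi hs hs', h.uIdx_eq hc hi' e1 e2] at hl2
      obtain rfl := x_injective hi.le hi'.le hl2
      omega
  rw [ru, h.uIdx_eq hc hi hs hs', hgr.csSup_eq]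
  omega

lemma rv_eq (h : D.Agrees r c) (hc : D.Valid c) {j s k : ℕ} (h1 : 1 ≤ j) (hj : j ≤ D.m)
    (hs : c j ≤ s) (hs' : s ≤ D.p j) (hk : k + 1 + s = D.cntU c j) :
    D.rv r k = (s : ℤ) - 1 := by
  have e2 := hc.cntU_succ (show j - 1 < D.m by omega)
  rw [show j - 1 + 1 = j by omega] at e2
  have hmono := cntU_mono (D := D) (c := c) hj
  have hgr : IsGreatest {l : ℕ | l ≤ k ∧ D.v r k = D.v r (k - l)} (D.p j - s) := by
    constructor
    · refine ⟨by omega, ?_⟩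
      rw [v, v, h.vIdx_eq hc h1 hj hs hs' hk,
        h.vIdx_eq hc (k := k - (D.p j - s)) (s := D.p j) h1 hj (by omega) le_rfl (by omega)]
    · rintro l ⟨hl1, hl2⟩
      obtain ⟨j', h1', hj', s', e1, e2, e3⟩ := hc.exists_finish (k := k - l) (by omega)
      rw [v, v, h.vIdx_eq hc h1 hj hs hs' hk, h.vIdx_eq hc h1' hj' e1 e2 e3] at hl2
      obtain rfl := x_injective hj hj' hl2
      omega
  rw [rv, h.vIdx_eq hc h1 hj hs hs' hk, hgr.csSup_eq]
  omega

lemma uCount_eq (h : D.Agrees r c) (hc : D.Valid c) {i : ℕ} (hi : i ≤ D.m) :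
    D.uCount r i = D.cntU c i := by
  rw [uCount, cntU, Nat.cast_sum]
  refine Finset.sum_congr rfl fun j hj => ?_
  rw [Finset.mem_range] at hj
  have h1 := h j (by omega)
  have h2 := hc.le_right' (show j < D.m by omega)
  omega

lemma splineSpace_eq (h : D.Agrees r c) : D.splineSpace r = D.splines c := by
  ext f
  have : (∀ i, 1 ≤ i → i < D.m → ∀ j : ℕ, (j : ℤ) ≤ r i → jump (D.x i) j f = 0) ↔
      ∀ i, 1 ≤ i → i < D.m → ∀ j < c i, jump (D.x i) j f = 0 := by
    refine forall_congr' fun i => forall_congr' fun h1 => forall_congr' fun hi =>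
      forall_congr' fun j => ?_
    have := h i hi.le
    rw [show ((j : ℤ) ≤ r i) ↔ j < c i by omega]
  simp only [splineSpace, splines, pieceSpace, mem_ofPred_eq, Submodule.mem_mk, and_assoc,
    AddSubmonoid.mem_mk, AddSubsemigroup.mem_mk, this]

end Agrees

lemma isExactlyC_iff (f : ℝ → ℝ) (x : ℝ) (s : ℕ) :
    IsExactlyC f x ((s : ℤ) - 1) ↔ (∀ l < s, jump x l f = 0) ∧ jump x s f ≠ 0 := by
  unfold IsExactlyC
  rw [show ((s : ℤ) - 1 + 1).toNat = s by omega]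
  refine and_congr (forall_congr' fun l => ?_) Iff.rfl
  rw [show ((l : ℤ) ≤ (s : ℤ) - 1) ↔ l < s by omega]

/-- The extension of a finite family by zero. -/
noncomputable def extend {n : ℕ} (B : Fin n → ℝ → ℝ) (k : ℕ) : ℝ → ℝ :=
  if h : k < n then B ⟨k, h⟩ else 0

lemma extend_of_lt {n : ℕ} (B : Fin n → ℝ → ℝ) {k : ℕ} (h : k < n) : extend B k = B ⟨k, h⟩ :=
  dif_pos h

lemma splines_smul_add (hc : D.Valid c) {f g : ℝ → ℝ} (hf : f ∈ D.splines c)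
    (hg : g ∈ D.splines c) (a b : ℝ) : a • f + b • g ∈ D.splines c := by
  refine ⟨D.pieceSpace.add_mem (D.pieceSpace.smul_mem a hf.1) (D.pieceSpace.smul_mem b hg.1),
    fun i h1 hi j hj => ?_⟩
  have e1 := hc.le_left i h1 hi
  have e2 := hc.le_right i h1 hi
  rw [jump_add_smul (prev_lt hi.le) (lt_next hi.le) a b
    (jumpSmooth_of_interior h1 hi (by omega) (by omega) hf.1)
    (jumpSmooth_of_interior h1 hi (by omega) (by omega) hg.1), hf.2 i h1 hi j hj,
    hg.2 i h1 hi j hj]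
  simp

lemma zero_mem_splines (c : ℕ → ℕ) : (0 : ℝ → ℝ) ∈ D.splines c :=
  ⟨Submodule.zero_mem _, fun _ _ hi _ _ => jump_eq_zero hi.le _ fun _ _ => rfl⟩

lemma span_le_splines (hc : D.Valid c) {G : Set (ℝ → ℝ)} (hG : G ⊆ D.splines c) {f : ℝ → ℝ}
    (hf : f ∈ Submodule.span ℝ G) : f ∈ D.splines c := by
  induction hf using Submodule.span_induction with
  | mem f hf => exact hG hf
  | zero => exact zero_mem_splines c
  | add f g _ _ hf hg => simpa using splines_smul_add hc hf hg 1 1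
  | smul a f _ hf => simpa using splines_smul_add hc hf hf a 0

lemma sum_extend {n : ℕ} (B : Fin n → ℝ → ℝ) (y : ℝ) :
    ∑ k ∈ Finset.range n, extend B k y = ∑ k, B k y := by
  rw [Finset.sum_range]
  exact Finset.sum_congr rfl fun k _ => by rw [extend_of_lt B k.2]

/-- A GTB-spline basis has the prescribed starts and ends. -/
lemma IsGTBBasis.hasEnds (hr : D.Agrees r c) (hc : D.Valid c) {B : Fin (D.N r) → ℝ → ℝ}
    (hB : D.IsGTBBasis r B) : D.HasEnds c (extend B) ∧
      ∀ y ∈ Icc (D.x 0) (D.x D.m), ∑ k ∈ Finset.range (D.cntU c D.m), extend B k y = 1 := by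
  have hN := hr.N_eq hc
  refine ⟨⟨fun k hk => dif_neg (by omega), fun k => ?_, fun f hf => ?_, fun i hi s hs hs' => ?_,
    fun j h1 hj s hs hs' k hk => ?_⟩, fun y hy => ?_⟩
  · by_cases h : k < D.N r
    · rw [extend_of_lt B h, ← hr.splineSpace_eq, ← hB.span_eq]
      exact Submodule.subset_span ⟨_, rfl⟩
    · rw [extend, dif_neg h]
      exact zero_mem_splines c
  · rw [← hr.splineSpace_eq, ← hB.span_eq] at hf
    refine Submodule.span_mono ?_ hf
    rintro _ ⟨k, rfl⟩
    exact ⟨k, extend_of_lt B k.2⟩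
  · have h2 := hc.cntU_succ hi
    have hmono := cntU_mono (D := D) (c := c) (show i + 1 ≤ D.m from hi)
    have hk : D.cntV c i + s < D.N r := by omega
    have e1 := hB.start_smooth ⟨_, hk⟩
    have e2 := hB.support ⟨_, hk⟩
    simp only [hr.ru_eq hc hi hs hs', u, hr.uIdx_eq hc hi hs hs', isExactlyC_iff] at e1 e2
    rw [extend_of_lt B hk]
    exact ⟨fun y hy => e2 y fun h => absurd h.1 (not_le.2 hy), e1⟩
  · have hmono := cntU_mono (D := D) (c := c) hj
    have hk' : k < D.N r := by omega
    have e1 := hB.end_smooth ⟨_, hk'⟩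
    have e2 := hB.support ⟨_, hk'⟩
    simp only [hr.rv_eq hc h1 hj hs hs' hk, v, hr.vIdx_eq hc h1 hj hs hs' hk,
      isExactlyC_iff] at e1 e2
    rw [extend_of_lt B hk']
    exact ⟨fun y hy => e2 y fun h => absurd h.2 (not_le.2 hy), e1⟩
  · rw [← hN, sum_extend]
    exact hB.partition_of_unity y hy

lemma IsGtb.isGTBBasis (hr : D.Agrees r c) (hc : D.Valid c) {B : ℕ → ℝ → ℝ}
    (hB : D.IsGtb c B) : D.IsGTBBasis r (fun k : Fin (D.N r) => B k) := by
  have hN := hr.N_eq hc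
  have hrange : range (fun k : Fin (D.N r) => B k) ⊆ range B := by
    rintro _ ⟨k, rfl⟩
    exact ⟨k, rfl⟩
  refine ⟨?_, ?_, fun k y hy => ?_, fun k y hy => ?_, fun y hy => ?_, fun k => ?_, fun k => ?_,
    fun i h1 hi => ?_⟩
  · rw [Fintype.linearIndependent_iff]
    intro a ha k
    have := hB.linearIndependent_nat hc (a := fun l => if h : l < D.N r then a ⟨l, h⟩ else 0) (by
      rw [← hN, Finset.sum_range, ← ha]
      exact Finset.sum_congr rfl fun l _ => by simp) k (by omega)
    simpa using this
  · rw [hr.splineSpace_eq]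
    apply Subset.antisymm
    · intro f hf
      refine span_le_splines hc ?_ hf
      rintro _ ⟨k, rfl⟩
      exact hB.mem k
    · intro f hf
      refine Submodule.span_le.2 ?_ (hB.span f hf)
      rintro _ ⟨k, rfl⟩
      by_cases hk : k < D.N r
      · exact Submodule.subset_span ⟨⟨k, hk⟩, rfl⟩
      · rw [hB.zero k (by omega)]
        exact Submodule.zero_mem _
  · obtain ⟨i, hi, s, e1, e2, e3⟩ := hc.exists_start (k := k) (by omega)
    obtain ⟨j, h1', hj, t, f1, f2, f3⟩ := hc.exists_finish (k := k) (by omega)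
    rw [u, v, hr.vIdx_eq hc h1' hj f1 f2 f3, e3, hr.uIdx_eq hc hi e1 e2] at hy
    simp only [e3]
    exact hB.pos i hi s e1 e2 j h1' hj t f1 f2 (by omega) y hy
  · obtain ⟨i, hi, s, e1, e2, e3⟩ := hc.exists_start (k := k) (by omega)
    obtain ⟨j, h1', hj, t, f1, f2, f3⟩ := hc.exists_finish (k := k) (by omega)
    rw [u, v, hr.vIdx_eq hc h1' hj f1 f2 f3, e3, hr.uIdx_eq hc hi e1 e2] at hy
    rw [mem_Icc, not_and_or, not_le, not_le] at hy
    rcases hy with hy | hy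
    · simp only [e3]
      exact (hB.start i hi s e1 e2).1 y hy
    · exact (hB.finish j h1' hj t f1 f2 k f3).1 y hy
  · rw [← hB.sum_one y hy, ← hN, Finset.sum_range]
  · obtain ⟨i, hi, s, e1, e2, e3⟩ := hc.exists_start (k := k) (by omega)
    simp only [e3, hr.ru_eq hc hi e1 e2, u, hr.uIdx_eq hc hi e1 e2, isExactlyC_iff]
    exact (hB.start i hi s e1 e2).2
  · obtain ⟨j, h1', hj, t, f1, f2, f3⟩ := hc.exists_finish (k := k) (by omega)
    rw [hr.rv_eq hc h1' hj f1 f2 f3, v, hr.vIdx_eq hc h1' hj f1 f2 f3, isExactlyC_iff]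
    exact (hB.finish j h1' hj t f1 f2 k f3).2
  · have h2 := hc.cntU_succ (show i - 1 < D.m by omega)
    have hmono := cntU_mono (D := D) (c := c) hi
    have e := hB.loc (i - 1) (by omega)
    rw [show i - 1 + 1 = i by omega] at e h2
    rw [← e]
    congr 1
    ext f
    constructor
    · rintro ⟨k, hk1, hk2, rfl⟩
      rw [hr.uCount_eq hc hi] at hk1 hk2
      exact ⟨k, by omega, by omega, rfl⟩
    · rintro ⟨k, hk1, hk2, rfl⟩
      refine ⟨⟨k, by omega⟩, ?_, ?_, rfl⟩ <;> rw [hr.uCount_eq hc hi] <;> simp only <;> omega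

/-! ### The constraints in lexicographic order -/

/-- The numbers of constraints at the breakpoints among the first `ρ` constraints. -/
def firstConstraints (r : ℕ → ℤ) (ρ i : ℕ) : ℕ :=
  min (r i + 1).toNat (ρ - blockStart (constraintSizes r) (i - 1))

lemma agrees_truncate (r : ℕ → ℤ) (ρ : ℕ) :
    D.Agrees (truncate r ρ) (firstConstraints r ρ) := fun _ _ => rfl

lemma valid_firstConstraints (hr : D.IsSmoothness r) (ρ : ℕ) :
    D.Valid (firstConstraints r ρ) := by
  obtain ⟨h0, hm, h⟩ := hr
  refine ⟨by simp [firstConstraints, h0], by simp [firstConstraints, hm], fun i h1 hi => ?_,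
    fun i h1 hi => ?_⟩ <;>
  · have := h i h1 hi
    have := this.2
    rw [le_min_iff] at this
    simp only [firstConstraints]
    omega

lemma firstConstraints_zero (r : ℕ → ℤ) : firstConstraints r 0 = 0 := by
  funext i
  simp [firstConstraints]

lemma agrees_firstConstraints (hr : D.IsSmoothness r) :
    D.Agrees r (firstConstraints r (D.O r)) := by
  obtain ⟨h0, hm, h⟩ := hr
  intro i hi
  rcases Nat.eq_zero_or_pos i with rfl | h1
  · simp [firstConstraints, h0]
  rcases Nat.eq_or_lt_of_le hi with rfl | hi
  · simp [firstConstraints, hm]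
  · have e1 := blockStart_mono (constraintSizes r) (show i ≤ D.m - 1 by omega)
    have e2 := blockStart_succ (constraintSizes r) (i - 1)
    rw [show i - 1 + 1 = i by omega, constraintSizes, show i - 1 + 1 = i by omega] at e2
    have e3 := (h i h1 hi).1
    simp only [firstConstraints, O]
    omega

/-- The next constraint after the first `ρ` ones. -/
lemma firstConstraints_succ (hr : D.IsSmoothness r) {ρ : ℕ} (hρ : ρ < D.O r) {i₀ : ℕ}
    (hi₀ : i₀ = blockOf (constraintSizes r) ρ + 1) :
    D.CanAdd (firstConstraints r ρ) i₀ ∧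
      firstConstraints r ρ i₀ = offset (constraintSizes r) ρ ∧
      firstConstraints r (ρ + 1) = addOne (firstConstraints r ρ) i₀ ∧
      (∀ i, i₀ < i → firstConstraints r ρ i = 0) ∧ ((firstConstraints r ρ i₀ : ℕ) : ℤ) ≤ r i₀ := by
  obtain ⟨b, hb, h1, h2⟩ := exists_block hρ
  have hbo := blockOf_eq h1 h2
  rw [hbo] at hi₀
  subst hi₀
  have e2 := blockStart_succ (constraintSizes r) b
  rw [constraintSizes] at e2
  have hm : b + 1 < D.m := by omega
  have h3 := hr.2.2 (b + 1) (by omega) hm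
  have h4 := le_min_iff.1 h3.2
  have e3 : firstConstraints r ρ (b + 1) = ρ - blockStart (constraintSizes r) b := by
    simp only [firstConstraints, Nat.add_sub_cancel]
    omega
  refine ⟨⟨valid_firstConstraints hr ρ, by omega, hm, by omega, by omega⟩, ?_, ?_, fun i hi => ?_,
    by omega⟩
  · rw [e3, offset, hbo]
  · funext i
    by_cases hi : i = b + 1
    · subst hi
      rw [addOne_self, e3]
      simp only [firstConstraints, Nat.add_sub_cancel]
      omega
    · rw [addOne_of_ne hi]
      simp only [firstConstraints]
      rcases Nat.lt_or_ge (i - 1) b with hlt | hge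
      · have e4 := blockStart_mono (constraintSizes r) (show i - 1 + 1 ≤ b from hlt)
        have e5 := blockStart_succ (constraintSizes r) (i - 1)
        rcases Nat.eq_zero_or_pos i with rfl | hpos
        · simp [hr.1]
        · rw [constraintSizes, show i - 1 + 1 = i by omega] at e5
          rw [show i - 1 + 1 = i by omega] at e4
          omega
      · rcases Nat.eq_zero_or_pos i with rfl | hpos
        · simp [hr.1]
        · have e4 := blockStart_mono (constraintSizes r) (show b + 1 ≤ i - 1 by omega)
          omega
  · have e4 := blockStart_mono (constraintSizes r) (show b + 1 ≤ i - 1 by omega)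
    simp only [firstConstraints]
    omega

lemma cntU_firstConstraints (hr : D.IsSmoothness r) {ρ : ℕ} (hρ : ρ ≤ D.O r) :
    D.cntU (firstConstraints r ρ) D.m + ρ = D.M := by
  induction ρ with
  | zero => rw [firstConstraints_zero, cntU_zero]; rfl
  | succ ρ ih =>
    obtain ⟨h1, -, h3, -⟩ := firstConstraints_succ hr (show ρ < D.O r by omega) rfl
    have := ih (by omega)
    have := h1.cntU_last
    rw [h3]
    omega

/-! ### The extraction algorithm -/

/-- The algorithm produces the coefficients of the basis, if there is one after every pass. The second
matrix of the state is the product of the first one with the matrix of the jumps of the Bernstein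
functions, so that its columns are the vectors of jumps of the current basis. -/
theorem extraction (hw : D.IsNormalized) (hr : D.IsSmoothness r)
    (hex : ∀ ρ ≤ D.O r, ∃ B, D.HasEnds (firstConstraints r ρ) B ∧ ∀ y ∈ Icc (D.x 0) (D.x D.m),
      ∑ k ∈ Finset.range (D.cntU (firstConstraints r ρ) D.m), B k y = 1) (ρ : ℕ)
    (hρ : ρ ≤ D.O r) (B : ℕ → ℝ → ℝ) (hB : D.HasEnds (firstConstraints r ρ) B)
    (h1 : ∀ y ∈ Icc (D.x 0) (D.x D.m),
      ∑ k ∈ Finset.range (D.cntU (firstConstraints r ρ) D.m), B k y = 1) :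
    (∀ k : Fin (D.M - ρ), B k =
      ∑ l : Fin D.M, (extractionState (D.jumpMatrix r) ρ hρ).1 k l • D.bernstein l) ∧
    (extractionState (D.jumpMatrix r) ρ hρ).2 =
      (extractionState (D.jumpMatrix r) ρ hρ).1 * D.jumpMatrix r := by
  induction ρ generalizing B with
  | zero =>
    have h0 := isGtb_bernBasis hw
    rw [firstConstraints_zero] at hB h1
    have := HasEnds.unique valid_zero h0.toHasEnds hB h0.sum_one h1
    subst this
    refine ⟨fun k => ?_, by simp [extractionState]⟩
    have hk : (k : ℕ) < D.M := k.2
    simp only [extractionState]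
    rw [Finset.sum_eq_single_of_mem (⟨k, hk⟩ : Fin D.M) (Finset.mem_univ _)]
    · rw [bernBasis, if_pos hk]
      have : (1 : Matrix (Fin D.M) (Fin D.M) ℝ) k ⟨k, hk⟩ = 1 := Matrix.one_apply_eq _
      rw [this, one_smul]
    · intro l _ hl
      have : (1 : Matrix (Fin D.M) (Fin D.M) ℝ) k l = 0 :=
        Matrix.one_apply_ne fun h => hl h.symm
      rw [this, zero_smul]
  | succ ρ ih =>
    obtain ⟨B₀, hB₀, h₀⟩ := hex ρ (by omega)
    obtain ⟨ih1, ih2⟩ := ih (by omega) B₀ hB₀ h₀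
    obtain ⟨i₀, hi₀⟩ : ∃ i₀, i₀ = blockOf (constraintSizes r) ρ + 1 := ⟨_, rfl⟩
    obtain ⟨hadd, hoff, hsucc, -, -⟩ := firstConstraints_succ hr (show ρ < D.O r by omega) hi₀
    rw [hsucc] at hB h1
    have hcnt := cntU_firstConstraints hr (show ρ ≤ D.O r by omega)
    -- the vector handed to the nullspace routine
    have hcol : ∀ k : Fin (D.M - ρ),
        (extractionState (D.jumpMatrix r) ρ (Nat.le_of_succ_le hρ)).2 k ⟨ρ, hρ⟩ =
        jump (D.x i₀) (firstConstraints r ρ i₀) (B₀ k) := by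
      intro k
      rw [ih2, ih1 k, jump_sum (prev_lt hadd.lt.le) (lt_next hadd.lt.le)]
      · rw [Matrix.mul_apply]
        refine Finset.sum_congr rfl fun l _ => ?_
        rw [jumpMatrix, hoff, hi₀]
      · intro l _ _
        have := bernBasis_mem_pieceSpace (D := D) l
        rw [bernBasis, if_pos l.2] at this
        exact hadd.jumpSmooth this
    have hstep := hadd.eq_nullspace hB₀ hB h₀ h1 (n := D.M - ρ) (by omega) _ hcol
    refine ⟨fun k => ?_, ?_⟩
    · rw [hstep k]
      simp only [extractionState, Matrix.mul_apply, Finset.sum_smul]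
      rw [Finset.sum_comm]
      refine Finset.sum_congr rfl fun i _ => ?_
      rw [ih1 i, Finset.smul_sum]
      exact Finset.sum_congr rfl fun l _ => (mul_smul _ _ _).symm
    · simp only [extractionState]
      rw [Matrix.mul_assoc, ih2]

end Data

/-! ### Coefficients of one smoothness step -/

/-- Data of one smoothness step of order `j` at all levels `q ≤ j`: `a q k` stands for the jump of the
`k`-th function of level `q`. At level `j` only two of the jumps do not vanish; they determine the
jumps at the lower levels. -/
structure JumpTable (j κ υ : ℕ) (γ a : ℕ → ℕ → ℝ) : Prop where
  eq : κ + 1 + j = υ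
  pos : ∀ q k, 0 < γ q k
  top : ∀ k, a j k = (if k + 1 = υ then 1 else 0) - if k = υ then 1 else 0
  recur : ∀ q < j, ∀ k, a q k = γ q k * a (q + 1) k - γ q (k + 1) * a (q + 1) (k + 1)

/-- The coefficient of the `k`-th function of level `q` in the `k`-th function after the step. The
coefficient of the next function is `1 - stepCoeff q (k + 1)`, by partition of unity. Below
the top level the formula splits `a q k` into the two terms of its recursion: the coefficient times
`a q k` is the second term, with its sign, and the rest is the first one. The combination of two
neighbouring jumps therefore vanishes. -/
noncomputable def stepCoeff (κ υ : ℕ) (γ a : ℕ → ℕ → ℝ) (q k : ℕ) : ℝ :=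
  if υ ≤ k then 0 else if k ≤ κ + q then 1 else -(γ q (k + 1) * a (q + 1) (k + 1)) / a q k

/-- The recursion coefficients after the step. Behind the index `υ` the functions move down by one, and
their coefficients with them. -/
noncomputable def stepGamma (κ υ : ℕ) (γ a : ℕ → ℕ → ℝ) (q k : ℕ) : ℝ :=
  if k < υ then stepCoeff κ υ γ a q k * γ q k / stepCoeff κ υ γ a (q + 1) k else γ q (k + 1)

lemma stepCoeff_of_le {κ υ : ℕ} {γ a : ℕ → ℕ → ℝ} {q k : ℕ} (h : υ ≤ k) :
    stepCoeff κ υ γ a q k = 0 := if_pos h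

lemma stepCoeff_eq_one {κ υ : ℕ} {γ a : ℕ → ℕ → ℝ} {q k : ℕ} (h : k < υ) (h' : k ≤ κ + q) :
    stepCoeff κ υ γ a q k = 1 := by
  rw [stepCoeff, if_neg (by omega), if_pos h']

namespace JumpTable

variable {j κ υ : ℕ} {γ a : ℕ → ℕ → ℝ} (h : JumpTable j κ υ γ a)
include h

/-- The jumps alternate in sign on their support: in the recursion, the difference of two numbers of
opposite sign cannot cancel. -/
lemma sign : ∀ q ≤ j, (∀ k, k < κ + q ∨ υ < k → a q k = 0) ∧
    ∀ k, κ + q ≤ k → k ≤ υ → 0 < (-1) ^ (υ + 1 + k) * a q k := by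
  intro q hq
  have he := h.eq
  induction hq using Nat.decreasingInduction with
  | self =>
    refine ⟨fun k hk => ?_, fun k h1 h2 => ?_⟩
    · rw [h.top, if_neg (by omega), if_neg (by omega), sub_zero]
    · rcases Nat.eq_or_lt_of_le h2 with rfl | h3
      · rw [h.top, if_neg (by omega), if_pos rfl, Odd.neg_one_pow ⟨k, by omega⟩]
        norm_num
      · rw [h.top, if_pos (by omega), if_neg (by omega), Even.neg_one_pow ⟨υ, by omega⟩]
        norm_num
  | of_succ q hq ih =>
    obtain ⟨ih0, ih1⟩ := ih
    refine ⟨fun k hk => ?_, fun k h1 h2 => ?_⟩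
    · rw [h.recur q hq, ih0 k (by omega), ih0 (k + 1) (by omega)]
      simp
    · have e : (-1 : ℝ) ^ (υ + 1 + k) * a q k = γ q k * ((-1) ^ (υ + 1 + k) * a (q + 1) k) +
          γ q (k + 1) * ((-1) ^ (υ + 1 + (k + 1)) * a (q + 1) (k + 1)) := by
        rw [h.recur q hq, ← add_assoc (υ + 1) k 1, pow_succ]
        ring
      rw [e]
      have p1 := h.pos q k
      have p2 := h.pos q (k + 1)
      rcases Nat.eq_or_lt_of_le h1 with h3 | h3
      · rw [ih0 k (by omega)]
        have := mul_pos p2 (ih1 (k + 1) (by omega) (by omega))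
        simpa using this
      · have q1 := mul_pos p1 (ih1 k (by omega) (by omega))
        rcases Nat.eq_or_lt_of_le h2 with h4 | h4
        · rw [ih0 (k + 1) (by omega)]
          simpa using q1
        · exact add_pos q1 (mul_pos p2 (ih1 (k + 1) (by omega) (by omega)))

lemma ne_zero {q k : ℕ} (hq : q ≤ j) (h1 : κ + q ≤ k) (h2 : k ≤ υ) : a q k ≠ 0 := fun h0 => by
  have := (h.sign q hq).2 k h1 h2
  rw [h0, mul_zero] at this
  exact this.false

lemma coeff_mul {q : ℕ} (hq : q < j) (k : ℕ) :
    stepCoeff κ υ γ a q k * a q k = -(γ q (k + 1) * a (q + 1) (k + 1)) := by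
  have he := h.eq
  obtain ⟨z0, -⟩ := h.sign (q + 1) hq
  rw [stepCoeff]
  split_ifs with h1 h2
  · rw [z0 (k + 1) (by omega)]; simp
  · rw [h.recur q hq, z0 k (by omega)]; ring
  · exact div_mul_cancel₀ _ (h.ne_zero hq.le (by omega) (by omega))

lemma one_sub_coeff_mul {q : ℕ} (hq : q < j) (k : ℕ) :
    (1 - stepCoeff κ υ γ a q k) * a q k = γ q k * a (q + 1) k := by
  rw [sub_mul, h.coeff_mul hq, h.recur q hq]
  ring

/-- The new functions have no jump. -/
lemma kernel {q : ℕ} (hq : q ≤ j) (k : ℕ) : stepCoeff κ υ γ a q k * a q k +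
    (1 - stepCoeff κ υ γ a q (k + 1)) * a q (k + 1) = 0 := by
  have he := h.eq
  rcases Nat.eq_or_lt_of_le hq with rfl | hq
  · rw [h.top, h.top, stepCoeff, stepCoeff]
    rcases lt_trichotomy (k + 1) υ with h1 | h1 | h1
    · simp [show ¬ υ ≤ k by omega, show ¬ υ ≤ k + 1 by omega, show k ≤ κ + q by omega,
        show k + 1 ≤ κ + q by omega, show ¬ k + 1 = υ by omega, show ¬ k = υ by omega]
    · simp [show ¬ υ ≤ k by omega, show k ≤ κ + q by omega,
        show k + 1 = υ by omega, show ¬ k = υ by omega]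
    · simp [show υ ≤ k by omega, show υ ≤ k + 1 by omega, show ¬ k + 1 = υ by omega,
        show ¬ k + 1 + 1 = υ by omega]
  · rw [h.coeff_mul hq, h.one_sub_coeff_mul hq]
    ring

lemma coeff_pos {q k : ℕ} (hk : k < υ) : 0 < stepCoeff κ υ γ a q k := by
  have he := h.eq
  rw [stepCoeff, if_neg (by omega)]
  split_ifs with h1
  · exact one_pos
  · have s1 := (h.sign q (by omega)).2 k (by omega) hk.le
    have s2 := (h.sign (q + 1) (by omega)).2 (k + 1) (by omega) (by omega)
    have e : -(γ q (k + 1) * a (q + 1) (k + 1)) / a q k =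
        γ q (k + 1) * ((-1) ^ (υ + 1 + (k + 1)) * a (q + 1) (k + 1)) /
          ((-1) ^ (υ + 1 + k) * a q k) := by
      rw [← add_assoc (υ + 1) k 1, pow_succ]
      have : (-1 : ℝ) ^ (υ + 1 + k) ≠ 0 := pow_ne_zero _ (by norm_num)
      have := h.ne_zero (show q ≤ j by omega) (show κ + q ≤ k by omega) hk.le
      field_simp
    rw [e]
    exact div_pos (mul_pos (h.pos _ _) s2) s1

lemma coeff_lt_one {q k : ℕ} (hk : κ + q < k) : stepCoeff κ υ γ a q k < 1 := by
  have he := h.eq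
  rcases Nat.lt_or_ge k υ with h1 | h1
  · have s1 := (h.sign q (by omega)).2 k (by omega) h1.le
    have s2 := (h.sign (q + 1) (by omega)).2 k (by omega) h1.le
    have e : (1 - stepCoeff κ υ γ a q k) * ((-1) ^ (υ + 1 + k) * a q k) =
        γ q k * ((-1) ^ (υ + 1 + k) * a (q + 1) k) := by
      linear_combination (-1) ^ (υ + 1 + k) * h.one_sub_coeff_mul (show q < j by omega) k
    have := pos_of_mul_pos_left (e ▸ mul_pos (h.pos q k) s2) s1.le
    linarith
  · rw [stepCoeff_of_le h1]; exact one_pos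

lemma gamma_pos (q k : ℕ) : 0 < stepGamma κ υ γ a q k := by
  rw [stepGamma]
  split_ifs with h1
  · exact div_pos (mul_pos (h.coeff_pos h1) (h.pos _ _)) (h.coeff_pos h1)
  · exact h.pos _ _

lemma gamma_mul (q k : ℕ) : stepGamma κ υ γ a q k * stepCoeff κ υ γ a (q + 1) k =
    stepCoeff κ υ γ a q k * γ q k := by
  rw [stepGamma]
  split_ifs with h1
  · exact div_mul_cancel₀ _ (h.coeff_pos h1).ne'
  · rw [stepCoeff_of_le (by omega), stepCoeff_of_le (by omega)]; simp

/-- Together with `gamma_mul`, this says that the step commutes with the recursion. -/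
lemma gamma_mul_one_sub {q : ℕ} (hq : q < j) (k : ℕ) :
    stepGamma κ υ γ a q k * (1 - stepCoeff κ υ γ a (q + 1) (k + 1)) =
      (1 - stepCoeff κ υ γ a q k) * γ q (k + 1) := by
  have he := h.eq
  rcases Nat.lt_or_ge k υ with h1 | h1
  · rcases Nat.lt_or_ge (κ + q) k with h2 | h2
    · have h3 := (h.coeff_pos (q := q + 1) h1).ne'
      refine mul_left_cancel₀ (mul_ne_zero h3 (h.ne_zero hq.le h2.le h1.le)) ?_
      have e1 := h.gamma_mul q k
      have e2 := h.coeff_mul hq k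
      have e3 := h.one_sub_coeff_mul hq k
      have e4 := h.kernel (show q + 1 ≤ j from hq) k
      linear_combination (a q k * (1 - stepCoeff κ υ γ a (q + 1) (k + 1))) * e1 +
        γ q k * (1 - stepCoeff κ υ γ a (q + 1) (k + 1)) * e2 -
        stepCoeff κ υ γ a (q + 1) k * γ q (k + 1) * e3 - γ q k * γ q (k + 1) * e4
    · rw [stepCoeff_eq_one (by omega) (show k + 1 ≤ κ + (q + 1) by omega),
        stepCoeff_eq_one h1 h2]
      simp
  · rw [stepCoeff_of_le (by omega), stepCoeff_of_le h1, stepGamma, if_neg (by omega)]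
    ring

end JumpTable

namespace Data

variable {D : Data} {c : ℕ → ℕ} {i₀ : ℕ}

variable (D) in
/-- The numbers `h q k i e l` stand for the `l`-th functions, at the left side (`e = false`) or at the
right side (`e = true`) of `x i`, in the chain of generalized derivatives of the `k`-th function of
level `q`. The functions of level `0` are those of the basis. Generalized differentiation maps the
functions of level `q` to the differences of the functions of level `q + 1`, with coefficients `γ`,
and the functions of level `q` have the starts and ends that a basis for the smoothness vector `c`,
diminished by `q`, would have. If `q` exceeds `c i`, there are `q - c i` indices between the functions
that end at `x i` and those that start there; the functions with these indices vanish. Only breakpoints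
from `x i₀` on are considered, those at which constraints may still be added. -/
structure Tower (c : ℕ → ℕ) (i₀ : ℕ) (γ : ℕ → ℕ → ℝ) (h : ℕ → ℕ → ℕ → Bool → ℕ → ℝ) : Prop where
  pos : ∀ q k, 0 < γ q k
  recur : ∀ q k i e l, q < l →
    h q k i e l = γ q k * h (q + 1) k i e l - γ q (k + 1) * h (q + 1) (k + 1) i e l
  left : ∀ i, i₀ ≤ i → i < D.m → ∀ q k, c i ≤ q → q ≤ D.p i →
    h q k i false q = if k + 1 = D.cntU c i then 1 else 0
  right : ∀ i, i₀ ≤ i → i < D.m → ∀ q k, c i ≤ q → q ≤ D.p (i + 1) →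
    h q k i true q = if k + c i = D.cntU c i + q then 1 else 0
  gap : ∀ i, i₀ ≤ i → i < D.m → ∀ q k, c i < q → D.cntU c i ≤ k → k + c i < D.cntU c i + q →
    ∀ i' e l, q ≤ l → h q k i' e l = 0

namespace Tower

variable {γ : ℕ → ℕ → ℝ} {h : ℕ → ℕ → ℕ → Bool → ℕ → ℝ}

lemma mono (H : D.Tower c i₀ γ h) {i₁ : ℕ} (hi : i₀ ≤ i₁) : D.Tower c i₁ γ h where
  pos := H.pos
  recur := H.recur
  left i h1 := H.left i (hi.trans h1)
  right i h1 := H.right i (hi.trans h1)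
  gap i h1 := H.gap i (hi.trans h1)

lemma jumpTable (H : D.Tower c i₀ γ h) (hA : D.CanAdd c i₀) {κ : ℕ}
    (hκ : κ + 1 + c i₀ = D.cntU c i₀) : JumpTable (c i₀) κ (D.cntU c i₀) γ
      fun q k => h q k i₀ false (c i₀) - h q k i₀ true (c i₀) where
  eq := hκ
  pos := H.pos
  top k := by
    rw [H.left i₀ le_rfl hA.lt _ _ le_rfl hA.le_left, H.right i₀ le_rfl hA.lt _ _ le_rfl hA.le_right]
    simp
  recur q hq k := by
    rw [H.recur _ _ _ _ _ hq, H.recur _ k _ true _ hq]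
    ring

/-- A smoothness step turns a tower into a tower. Above the order of the step, the functions of a level
do not change, except that one that vanishes identically is deleted. -/
lemma step (H : D.Tower c i₀ γ h) (hA : D.CanAdd c i₀) (hc : ∀ i, i₀ < i → c i = 0)
    {α : ℕ → ℕ → ℝ} {κ : ℕ} (hκ : κ + 1 + c i₀ = D.cntU c i₀)
    (hα : α = stepCoeff κ (D.cntU c i₀) γ
      fun q k => h q k i₀ false (c i₀) - h q k i₀ true (c i₀)) :
    ∃ γ', D.Tower (addOne c i₀) i₀ γ' fun q k i e l => α q k * h q k i e l +
      (if q ≤ c i₀ then 1 - α q (k + 1) else 1 - α q k) * h q (k + 1) i e l := by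
  have T := H.jumpTable hA hκ
  have hge : ∀ q k, D.cntU c i₀ ≤ k → α q k = 0 := fun q k hk => hα ▸ stepCoeff_of_le hk
  have hlt : ∀ q k, c i₀ ≤ q → k < D.cntU c i₀ → α q k = 1 := fun q k hq hk =>
    hα ▸ stepCoeff_eq_one hk (by omega)
  have hV := hA.valid.cntU_eq hA.lt.le
  have hS := hA.valid.cntU_succ hA.lt
  have hr := hA.le_right
  -- the last fact concerns the case in which the deleted index is the last one that ends at `x i`
  have hU : ∀ i, i₀ < i → i < D.m → D.cntU (addOne c i₀) i + 1 = D.cntU c i ∧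
      D.cntU c i₀ + 1 ≤ D.cntU c i ∧
      (D.cntU c i = D.cntU c i₀ + 1 → D.p i = c i₀) := by
    intro i h1 h2
    refine ⟨cntU_addOne_of_lt hA.le_right h1, ?_, fun e => ?_⟩
    · have := cntU_mono (D := D) (c := c) (show i₀ + 1 ≤ i from h1)
      omega
    · rcases Nat.eq_or_lt_of_le (show i₀ + 1 ≤ i from h1) with rfl | h3
      · omega
      · have e1 := cntU_mono (D := D) (c := c) (show i₀ + 1 + 1 ≤ i from h3)
        have e2 := hA.valid.cntU_succ (show i₀ + 1 < D.m by omega)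
        have e3 := hA.valid.cntU_eq (show i₀ + 1 ≤ D.m by omega)
        have e4 := hc (i₀ + 1) (by omega)
        omega
  have hU0 : D.cntU (addOne c i₀) i₀ = D.cntU c i₀ := cntU_addOne_of_le le_rfl
  -- at and behind the deleted index the functions are those with the next index
  have hbig : ∀ q k i e l, D.cntU c i₀ ≤ k → α q k * h q k i e l +
      (if q ≤ c i₀ then 1 - α q (k + 1) else 1 - α q k) * h q (k + 1) i e l =
      h q (k + 1) i e l := by
    intro q k i e l hk
    rw [hge q k hk, hge q (k + 1) (by omega)]
    simp
  -- before the deleted index the functions of the higher levels stay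
  have hsmall : ∀ q k i e l, c i₀ < q → k < D.cntU c i₀ → α q k * h q k i e l +
      (if q ≤ c i₀ then 1 - α q (k + 1) else 1 - α q k) * h q (k + 1) i e l = h q k i e l := by
    intro q k i e l hq hk
    rw [hlt q k hq.le hk, if_neg (by omega)]
    simp
  refine ⟨stepGamma κ (D.cntU c i₀) γ
    fun q k => h q k i₀ false (c i₀) - h q k i₀ true (c i₀), T.gamma_pos, ?_, ?_, ?_, ?_⟩
  · intro q k i e l hl
    rcases Nat.lt_or_ge q (c i₀) with hq | hq
    · have g1 := T.gamma_mul q k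
      have g2 := T.gamma_mul q (k + 1)
      have g3 := T.gamma_mul_one_sub hq k
      have g4 := T.gamma_mul_one_sub hq (k + 1)
      rw [← hα] at g1 g2 g3 g4
      simp only [if_pos hq.le, if_pos (show q + 1 ≤ c i₀ from hq)]
      rw [H.recur q k i e l hl, H.recur q (k + 1) i e l hl]
      linear_combination -h (q + 1) k i e l * g1 - h (q + 1) (k + 1) i e l * (g3 - g2) +
        h (q + 1) (k + 2) i e l * g4
    · have z1 : h (q + 1) (D.cntU c i₀) i e l = 0 :=
        H.gap i₀ le_rfl hA.lt (q + 1) _ (by omega) le_rfl (by omega) i e l hl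
      have gl : ∀ k, k < D.cntU c i₀ → stepGamma κ (D.cntU c i₀) γ
          (fun q k => h q k i₀ false (c i₀) - h q k i₀ true (c i₀)) q k = γ q k := fun k hk => by
        rw [stepGamma, if_pos hk, ← hα, hlt _ _ hq hk, hlt _ _ (by omega) hk]
        simp
      have gr : ∀ k, D.cntU c i₀ ≤ k → stepGamma κ (D.cntU c i₀) γ
          (fun q k => h q k i₀ false (c i₀) - h q k i₀ true (c i₀)) q k = γ q (k + 1) :=
        fun k hk => by rw [stepGamma, if_neg (by omega)]
      rcases lt_trichotomy (k + 1) (D.cntU c i₀) with h1 | h1 | h1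
      · rw [hsmall (q + 1) k _ _ _ (by omega) (by omega), hsmall (q + 1) (k + 1) _ _ _ (by omega) h1,
          hlt q k hq (by omega), hlt q (k + 1) hq h1, gl k (by omega), gl _ h1,
          H.recur q k i e l hl]
        simp
      · rw [hsmall (q + 1) k _ _ _ (by omega) (by omega), hbig (q + 1) (k + 1) _ _ _ h1.ge,
          hlt q k hq (by omega), hge q (k + 1) h1.ge, gl k (by omega), gr _ h1.ge,
          H.recur q k i e l hl, H.recur q (k + 1) i e l hl, h1, z1]
        rcases Nat.eq_or_lt_of_le hq with h2 | h2
        · rw [if_pos h2.ge]; ring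
        · have z2 : h (q + 1) (D.cntU c i₀ + 1) i e l = 0 :=
            H.gap i₀ le_rfl hA.lt (q + 1) _ (by omega) (by omega) (by omega) i e l hl
          rw [if_neg (by omega), z2]; ring
      · rw [hbig q k _ _ _ (by omega), hbig (q + 1) k _ _ _ (by omega),
          hbig (q + 1) (k + 1) _ _ _ (by omega), gr k (by omega), gr (k + 1) (by omega),
          H.recur q (k + 1) i e l hl]
  · intro i hi him q k hq hqp
    rcases Nat.eq_or_lt_of_le hi with rfl | hi
    · rw [addOne_self] at hq
      rw [hU0]
      rcases Nat.lt_or_ge k (D.cntU c i₀) with h1 | h1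
      · rw [hsmall q k _ _ _ (by omega) h1, H.left i₀ le_rfl him q k (by omega) hqp]
      · rw [hbig q k _ _ _ h1, H.left i₀ le_rfl him q _ (by omega) hqp, if_neg (by omega),
          if_neg (by omega)]
    · rw [addOne_of_ne (by omega)] at hq
      obtain ⟨u1, u2, u3⟩ := hU i hi him
      rw [H.left i hi.le him q k hq hqp, H.left i hi.le him q (k + 1) hq hqp]
      by_cases e1 : k + 1 = D.cntU c i
      · rw [if_pos e1, if_neg (show ¬ k + 1 + 1 = D.cntU c i by omega),
          if_neg (show ¬ k + 1 = D.cntU (addOne c i₀) i by omega), hge q k (by omega)]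
        simp
      · rw [if_neg e1]
        by_cases e2 : k + 1 + 1 = D.cntU c i
        · rw [if_pos e2, if_pos (show k + 1 = D.cntU (addOne c i₀) i by omega)]
          split_ifs with h1
          · rw [hge q (k + 1) (by omega)]; simp
          · rw [hge q k (by_contra fun h2 => by have := u3 (by omega); omega)]; simp
        · rw [if_neg e2, if_neg (show ¬ k + 1 = D.cntU (addOne c i₀) i by omega)]; simp
  · intro i hi him q k hq hqp
    rcases Nat.eq_or_lt_of_le hi with rfl | hi
    · rw [addOne_self] at hq ⊢
      rw [hU0]
      rcases Nat.lt_or_ge k (D.cntU c i₀) with h1 | h1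
      · rw [hsmall q k _ _ _ (by omega) h1, H.right i₀ le_rfl him q k (by omega) hqp,
          if_neg (by omega), if_neg (by omega)]
      · rw [hbig q k _ _ _ h1, H.right i₀ le_rfl him q _ (by omega) hqp]
        simp only [show k + 1 + c i₀ = k + (c i₀ + 1) by omega]
    · rw [addOne_of_ne (by omega)] at hq ⊢
      have hci := hc i hi
      obtain ⟨u1, u2, u3⟩ := hU i hi him
      rw [H.right i hi.le him q k hq hqp, H.right i hi.le him q (k + 1) hq hqp]
      by_cases e1 : k + c i = D.cntU c i + q
      · rw [if_pos e1, if_neg (show ¬ k + 1 + c i = D.cntU c i + q by omega),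
          if_neg (show ¬ k + c i = D.cntU (addOne c i₀) i + q by omega), hge q k (by omega)]
        simp
      · rw [if_neg e1]
        by_cases e2 : k + 1 + c i = D.cntU c i + q
        · rw [if_pos e2, if_pos (show k + c i = D.cntU (addOne c i₀) i + q by omega), hge q k (by omega), hge q (k + 1) (by omega)]
          simp
        · rw [if_neg e2, if_neg (show ¬ k + c i = D.cntU (addOne c i₀) i + q by omega)]; simp
  · intro i hi him q k hq hk1 hk2 i' e l hl
    rcases Nat.eq_or_lt_of_le hi with rfl | hi
    · rw [addOne_self] at hq hk2
      rw [hU0] at hk1 hk2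
      rw [hbig q k _ _ _ hk1]
      exact H.gap i₀ le_rfl him q _ (by omega) (by omega) (by omega) i' e l hl
    · rw [addOne_of_ne (by omega)] at hq hk2
      obtain ⟨u1, u2, u3⟩ := hU i hi him
      rw [hbig q k _ _ _ (by omega)]
      exact H.gap i hi.le him q _ hq (by omega) (by omega) i' e l hl

end Tower

end Data

lemma bernChain_eq_zero_of_not {w : ℕ → ℝ → ℝ} {p : ℕ} {c d : ℝ} (δ : ℕ) : ∀ {q s : ℕ},
    s < q ∨ p < s → bernChain w p c d δ q s = 0 := by
  induction δ with
  | zero =>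
    intro q s h
    funext y
    simp only [bernChain, bern_eq_zero (show ¬ (q ≤ s ∧ s ≤ p) by omega)]
    simp
  | succ δ ih =>
    intro q s h
    funext y
    simp only [bernChain, ih (show s < q + 1 ∨ p < s by omega),
      ih (show s + 1 < q + 1 ∨ p < s + 1 by omega)]
    simp

namespace Data

variable {D : Data} {c : ℕ → ℕ} {i₀ : ℕ} {B : ℕ → ℝ → ℝ}

/-! ### Chains of generalized derivatives of a basis -/

variable (D) in
/-- `g k i` is a chain of generalized derivatives of `B k` on the `i`-th interval. -/
structure HasChains (B : ℕ → ℝ → ℝ) (g : ℕ → ℕ → ℕ → ℝ → ℝ) : Prop where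
  chain : ∀ k i, 1 ≤ i → i ≤ D.m → IsChain (D.w i) (D.p i) (D.x (i - 1)) (D.x i) 0 (g k i)
  eqOn : ∀ k i, 1 ≤ i → i ≤ D.m →
    EqOn (B k) (fun y => D.w i 0 y * g k i 0 y) (Ioo (D.x (i - 1)) (D.x i))

variable (D) in
/-- The values at the breakpoints of the chains of generalized derivatives of `B` are the functions of
level `0` of a tower. -/
def HasTower (c : ℕ → ℕ) (i₀ : ℕ) (B : ℕ → ℝ → ℝ) : Prop :=
  ∃ g γ h, D.HasChains B g ∧ D.Tower c i₀ γ h ∧ ∀ k i l, 1 ≤ i → i < D.m →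
    h 0 k i false l = g k i l (D.x i) ∧ h 0 k i true l = g k (i + 1) l (D.x i)

lemma HasTower.mono (H : D.HasTower c i₀ B) {i₁ : ℕ} (hi : i₀ ≤ i₁) : D.HasTower c i₁ B := by
  obtain ⟨g, γ, h, h1, h2, h3⟩ := H
  exact ⟨g, γ, h, h1, h2.mono hi, h3⟩

variable (D) in
/-- The `l`-th function, on the interval `[x b, x (b + 1)]`, of the chain of the `k`-th global Bernstein
function of level `q`. -/
noncomputable def bernLevel (q k b l : ℕ) : ℝ → ℝ :=
  if blockStart D.bernSizes b ≤ k then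
    bernChain (D.w (b + 1)) (D.p (b + 1)) (D.x b) (D.x (b + 1)) (l - q) q
      (k - blockStart D.bernSizes b)
  else 0

variable (D) in
/-- The normalizing factor of the `k`-th global Bernstein function of level `q + 1`. -/
noncomputable def levelGamma (q k : ℕ) : ℝ :=
  let b := blockOf D.bernSizes k
  bernGamma (D.w (b + 1)) (D.p (b + 1)) (D.x b) (D.x (b + 1)) q (k - blockStart D.bernSizes b)

lemma bernLevel_add (q b s l : ℕ) : D.bernLevel q (blockStart D.bernSizes b + s) b l =
    bernChain (D.w (b + 1)) (D.p (b + 1)) (D.x b) (D.x (b + 1)) (l - q) q s := by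
  rw [bernLevel, if_pos (Nat.le_add_right _ _), Nat.add_sub_cancel_left]

lemma bernLevel_of_lt {q k b : ℕ} (h : k < blockStart D.bernSizes b) (l : ℕ) :
    D.bernLevel q k b l = 0 := if_neg (by omega)

/-- The block of an index determines the normalizing factor; indices beyond the block of the `b`-th interval
do no harm because the functions vanish there. -/
lemma levelGamma_mul (q b s l : ℕ) (y : ℝ) :
    D.levelGamma q (blockStart D.bernSizes b + s) *
      D.bernLevel (q + 1) (blockStart D.bernSizes b + s) b l y =
    bernGamma (D.w (b + 1)) (D.p (b + 1)) (D.x b) (D.x (b + 1)) q s *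
      D.bernLevel (q + 1) (blockStart D.bernSizes b + s) b l y := by
  rcases Nat.lt_or_ge (D.p (b + 1)) s with hs | hs
  · rw [bernLevel_add, bernChain_eq_zero_of_not _ (Or.inr hs)]
    simp
  · have : blockOf D.bernSizes (blockStart D.bernSizes b + s) = b :=
      blockOf_eq (Nat.le_add_right _ _) (by rw [blockStart_succ, bernSizes]; omega)
    rw [levelGamma, this, Nat.add_sub_cancel_left]

lemma bernLevel_rec {q l : ℕ} (h : q < l) (k b : ℕ) (y : ℝ) :
    D.bernLevel q k b l y = D.levelGamma q k * D.bernLevel (q + 1) k b l y -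
      D.levelGamma q (k + 1) * D.bernLevel (q + 1) (k + 1) b l y := by
  obtain ⟨δ, rfl⟩ : ∃ δ, l = q + 1 + δ := Nat.exists_eq_add_of_le h
  rcases Nat.lt_or_ge k (blockStart D.bernSizes b) with hk | hk
  · rw [bernLevel_of_lt hk, bernLevel_of_lt hk]
    rcases Nat.eq_or_lt_of_le (show k + 1 ≤ blockStart D.bernSizes b from hk) with h1 | h1
    · have := bernLevel_add (D := D) (q + 1) b 0 (q + 1 + δ)
      rw [add_zero, ← h1, bernChain_eq_zero_of_not _ (Or.inl (Nat.succ_pos q))] at this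
      rw [this]
      simp
    · rw [bernLevel_of_lt h1]
      simp
  · obtain ⟨s, rfl⟩ := Nat.exists_eq_add_of_le hk
    rw [levelGamma_mul, add_assoc (blockStart D.bernSizes b) s 1, levelGamma_mul, bernLevel_add,
      bernLevel_add, bernLevel_add, show q + 1 + δ - q = δ + 1 by omega,
      show q + 1 + δ - (q + 1) = δ by omega]
    rfl

/-- Level `q` lacks the first `q` functions of each block. -/
lemma bernLevel_eq_zero {q i k b : ℕ} (h1 : blockStart D.bernSizes i ≤ k)
    (h2 : k < blockStart D.bernSizes i + q) (l : ℕ) : D.bernLevel q k b l = 0 := by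
  rcases Nat.lt_or_ge k (blockStart D.bernSizes b) with hk | hk
  · exact bernLevel_of_lt hk l
  · obtain ⟨s, rfl⟩ := Nat.exists_eq_add_of_le hk
    rw [bernLevel_add]
    apply bernChain_eq_zero_of_not
    rcases Nat.lt_or_ge b i with hb | hb
    · have := blockStart_mono D.bernSizes (show b + 1 ≤ i from hb)
      rw [blockStart_succ, bernSizes] at this
      omega
    · have := blockStart_mono D.bernSizes hb
      omega

/-- The chains of the Bernstein functions of all levels form a tower. -/
lemma tower_bernLevel : D.Tower 0 1 D.levelGamma
    fun q k i e l => D.bernLevel q k (if e then i else i - 1) l (D.x i) where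
  pos q k := bernGamma_pos _ _
  recur q k i e l hl := bernLevel_rec hl _ _ _
  left i h1 hi q k _ hq := by
    obtain ⟨b, rfl⟩ : ∃ b, i = b + 1 := ⟨i - 1, by omega⟩
    rw [cntU_zero, blockStart_succ, bernSizes]
    simp only [Bool.false_eq_true, if_false, Nat.add_sub_cancel]
    rcases Nat.lt_or_ge k (blockStart D.bernSizes b) with hk | hk
    · rw [bernLevel_of_lt hk, if_neg (by omega)]; rfl
    · obtain ⟨s, rfl⟩ := Nat.exists_eq_add_of_le hk
      have hw := isWeights (D := D) h1 hi.le
      have e := bern_right h1 hi.le q (Nat.zero_le _) hq s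
      have hne := (hw.pos q hq _ (right_mem_Icc.2 hw.lt.le)).ne'
      rw [Nat.add_sub_cancel] at e
      rw [bernLevel_add, Nat.sub_self]
      simp only [bernChain]
      rw [e]
      by_cases hs : s = D.p (b + 1)
      · rw [if_pos hs, if_pos (by omega), div_self hne]
      · rw [if_neg hs, if_neg (by omega), zero_div]
  right i h1 hi q k _ hq := by
    simp only [if_true, Pi.zero_apply, add_zero]
    rw [cntU_zero]
    rcases Nat.lt_or_ge k (blockStart D.bernSizes i) with hk | hk
    · rw [bernLevel_of_lt hk, if_neg (by omega)]; rfl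
    · obtain ⟨s, rfl⟩ := Nat.exists_eq_add_of_le hk
      have hw := isWeights (D := D) (show 1 ≤ i + 1 by omega) hi
      have e := bern_left (D := D) (show 1 ≤ i + 1 by omega) hi q (Nat.zero_le _) hq s
      have hne := (hw.pos q hq _ (left_mem_Icc.2 hw.lt.le)).ne'
      rw [Nat.add_sub_cancel] at e hne
      rw [bernLevel_add, Nat.sub_self]
      simp only [bernChain]
      rw [e]
      by_cases hs : s = q
      · rw [if_pos hs, if_pos (by omega), div_self hne]
      · rw [if_neg hs, if_neg (by omega), zero_div]
  gap i _ _ q k _ h1 h2 i' e l _ := by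
    rw [bernLevel_eq_zero (i := i) h1 h2]
    rfl

lemma hasTower_bernBasis : D.HasTower 0 1 D.bernBasis := by
  refine ⟨fun k i => D.bernLevel 0 k (i - 1), D.levelGamma, _, ⟨fun k i h1 hi => ?_,
    fun k i h1 hi => ?_⟩, tower_bernLevel, fun k i l _ _ => ⟨by simp, by simp⟩⟩
  · obtain ⟨b, rfl⟩ : ∃ b, i = b + 1 := ⟨i - 1, by omega⟩
    rcases Nat.lt_or_ge k (blockStart D.bernSizes b) with hk | hk
    · refine ⟨fun l _ _ y _ => ?_, fun l _ => bernLevel_of_lt hk l⟩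
      simp only [Nat.add_sub_cancel, bernLevel_of_lt hk]
      simpa using! hasDerivWithinAt_const y _ (0 : ℝ)
    · obtain ⟨s, rfl⟩ := Nat.exists_eq_add_of_le hk
      have := isChain_bern (isWeights (D := D) h1 hi) s
      simp only [Nat.add_sub_cancel] at this ⊢
      have e : D.bernLevel 0 (blockStart D.bernSizes b + s) b = _ :=
        funext fun l => bernLevel_add 0 b s l
      rw [e]
      exact this
  · obtain ⟨b, rfl⟩ : ∃ b, i = b + 1 := ⟨i - 1, by omega⟩
    simp only [Nat.add_sub_cancel]
    by_cases hk : blockStart D.bernSizes b ≤ k ∧ k < blockStart D.bernSizes (b + 1)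
    · obtain ⟨s, rfl⟩ := Nat.exists_eq_add_of_le hk.1
      have h2 := hk.2
      rw [blockStart_succ, bernSizes] at h2
      rw [bernBasis_eq hi (by omega), bernLevel_add]
      exact indicator_eqOn h1 hi s
    · intro y hy
      have e1 : D.bernLevel 0 k b 0 = 0 := by
        rcases Nat.lt_or_ge k (blockStart D.bernSizes b) with h2 | h2
        · exact bernLevel_of_lt h2 0
        · obtain ⟨s, rfl⟩ := Nat.exists_eq_add_of_le h2
          rw [blockStart_succ, bernSizes] at hk
          rw [bernLevel_add]
          exact bernChain_eq_zero_of_not _ (Or.inr (by omega))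
      have e2 : D.bernBasis k y = 0 := by
        by_cases hM : k < D.M
        · obtain ⟨i, hi', s, hs, rfl⟩ := exists_bernIdx hM
          rw [bernBasis_eq hi' hs]
          refine indicator_of_notMem (fun h => ?_) _
          have := I_unique (D := D) hi' hi h (Ioo_subset_I (b + 1) hy)
          obtain rfl : i = b := by omega
          exact hk ⟨Nat.le_add_right _ _, by rw [blockStart_succ, bernSizes]; omega⟩
        · rw [bernBasis, if_neg hM]; rfl
      rw [e2, e1]
      simp

/-! ### Jumps and generalized derivatives -/

/-- For admissible weights, the first jump that does not vanish on all splines is a fixed positive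
multiple of the jump of the generalized derivative of the same order. -/
lemma CanAdd.exists_jump_eq (h : D.CanAdd c i₀) {r : ℕ → ℤ} (hw : D.Admissible r)
    (hr : (c i₀ : ℤ) ≤ r i₀) : ∃ W : ℝ, 0 < W ∧ ∀ f ∈ D.splines c, ∀ g₁ g₂ : ℕ → ℝ → ℝ,
    IsChain (D.w i₀) (D.p i₀) (D.x (i₀ - 1)) (D.x i₀) 0 g₁ →
    IsChain (D.w (i₀ + 1)) (D.p (i₀ + 1)) (D.x i₀) (D.x (i₀ + 1)) 0 g₂ →
    EqOn f (fun y => D.w i₀ 0 y * g₁ 0 y) (Ioo (D.x (i₀ - 1)) (D.x i₀)) →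
    EqOn f (fun y => D.w (i₀ + 1) 0 y * g₂ 0 y) (Ioo (D.x i₀) (D.x (i₀ + 1))) →
    jump (D.x i₀) (c i₀) f = W * (g₁ (c i₀) (D.x i₀) - g₂ (c i₀) (D.x i₀)) := by
  have hw₁ := isWeights (D := D) h.one_le h.lt.le
  have hw₂ : IsWeights (D.w (i₀ + 1)) (D.p (i₀ + 1)) (D.x i₀) (D.x (i₀ + 1)) :=
    isWeights (D := D) (show 1 ≤ i₀ + 1 by omega) h.lt
  have he₁ : D.x i₀ ∈ Icc (D.x (i₀ - 1)) (D.x i₀) := right_mem_Icc.2 hw₁.lt.le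
  have he₂ : D.x i₀ ∈ Icc (D.x i₀) (D.x (i₀ + 1)) := left_mem_Icc.2 hw₂.lt.le
  have hl := h.le_left
  have hr' := h.le_right
  refine ⟨∏ q ∈ Finset.range (c i₀ + 1), D.w i₀ q (D.x i₀), Finset.prod_pos fun q hq => ?_,
    fun f hf g₁ g₂ hg₁ hg₂ e₁ e₂ => ?_⟩
  · rw [Finset.mem_range] at hq
    exact hw₁.pos q (by omega) _ he₁
  have hle : ∀ {a b : ℕ}, a ≤ b → (a : WithTop ℕ∞) ≤ b := fun hab => by exact_mod_cast hab
  have J₁ := (hg₁.isJet hw₁ he₁).mono hl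
  -- by admissibility both jets satisfy the same relations, so that their difference is a jet
  have J₂ := ((hg₂.isJet hw₂ he₂).mono hr').congr_weights
    (W' := fun q s => iteratedDerivWithin s (D.w i₀ q) (Icc (D.x (i₀ - 1)) (D.x i₀)) (D.x i₀))
    fun q s hqs => by
      have := hw i₀ h.one_le h.lt q (by omega) s (by omega)
      rwa [leftDeriv_eq hw₁.lt ((hw₁.smooth q (by omega)).of_le (hle (by omega)))
        fun _ _ => rfl, rightDeriv_eq hw₂.lt ((hw₂.smooth q (by omega)).of_le (hle (by omega)))
        fun _ _ => rfl] at this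
  have hj : ∀ l ≤ c i₀, jump (D.x i₀) l f =
      iteratedDerivWithin l (fun y => D.w i₀ 0 y * g₁ 0 y) (Icc (D.x (i₀ - 1)) (D.x i₀)) (D.x i₀) -
      iteratedDerivWithin l (fun y => D.w (i₀ + 1) 0 y * g₂ 0 y) (Icc (D.x i₀) (D.x (i₀ + 1)))
        (D.x i₀) := by
    intro l hlc
    rw [jump, leftDeriv_eq hw₁.lt ((hg₁.contDiffOn_mul hw₁ (Nat.zero_le _)).of_le (hle (by omega)))
      e₁, rightDeriv_eq hw₂.lt ((hg₂.contDiffOn_mul hw₂ (Nat.zero_le _)).of_le (hle (by omega))) e₂]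
  have key := (J₁.sub J₂).deriv_eq (fun q hq => by
    rw [iteratedDerivWithin_zero]
    exact (hw₁.pos q (by omega) _ he₁).ne') (c i₀) 0 (by omega) fun l hlc => by
      simp only [Pi.sub_apply]
      rw [← hj l hlc.le]
      exact hf.2 i₀ h.one_le h.lt l hlc
  rw [hj _ le_rfl]
  simp only [Pi.sub_apply, zero_add, iteratedDerivWithin_zero] at key
  exact key

/-- One smoothness step, on the side of the coefficients: the towers continue, and the coefficients of
level `0` are positive and annihilate the new jump. -/
lemma HasTower.exists_step (H : D.HasTower c i₀ B) (h : D.CanAdd c i₀) (hB : ∀ k, B k ∈ D.splines c)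
    (hc : ∀ i, i₀ < i → c i = 0) {r : ℕ → ℤ} (hw : D.Admissible r) (hr : (c i₀ : ℤ) ≤ r i₀) {κ : ℕ}
    (hκ : κ + 1 + c i₀ = D.cntU c i₀) :
    ∃ α : ℕ → ℝ, (∀ k < D.cntU c i₀, 0 < α k) ∧ (∀ k, D.cntU c i₀ ≤ k → α k = 0) ∧
      (∀ k ≤ κ, α k = 1) ∧ (∀ k, κ < k → α k < 1) ∧
      (∀ k, α k * jump (D.x i₀) (c i₀) (B k) +
        (1 - α (k + 1)) * jump (D.x i₀) (c i₀) (B (k + 1)) = 0) ∧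
      D.HasTower (addOne c i₀) i₀ fun k => α k • B k + (1 - α (k + 1)) • B (k + 1) := by
  obtain ⟨g, γ, t, hg, T, ht⟩ := H
  have J := T.jumpTable h hκ
  obtain ⟨α, hα⟩ : ∃ α, α = stepCoeff κ (D.cntU c i₀) γ
      fun q k => t q k i₀ false (c i₀) - t q k i₀ true (c i₀) := ⟨_, rfl⟩
  obtain ⟨γ', T'⟩ := T.step h hc hκ hα
  obtain ⟨W, -, hW⟩ := h.exists_jump_eq hw hr
  have hjump : ∀ k, jump (D.x i₀) (c i₀) (B k) =
      W * (t 0 k i₀ false (c i₀) - t 0 k i₀ true (c i₀)) := by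
    intro k
    obtain ⟨t1, t2⟩ := ht k i₀ (c i₀) h.one_le h.lt
    rw [t1, t2]
    exact hW _ (hB k) _ _ (hg.chain k i₀ h.one_le h.lt.le)
      (hg.chain k (i₀ + 1) (by omega) h.lt) (hg.eqOn k i₀ h.one_le h.lt.le)
      (hg.eqOn k (i₀ + 1) (by omega) h.lt)
  refine ⟨α 0, fun k hk => hα ▸ J.coeff_pos (q := 0) hk, fun k hk => hα ▸ stepCoeff_of_le hk,
    fun k hk => hα ▸ stepCoeff_eq_one (by omega) (by omega),
    fun k hk => hα ▸ J.coeff_lt_one (by omega), fun k => ?_, ?_⟩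
  · rw [hjump, hjump, hα]
    linear_combination W * J.kernel (Nat.zero_le _) k
  · refine ⟨fun k i => α 0 k • g k i + (1 - α 0 (k + 1)) • g (k + 1) i, γ', _,
      ⟨fun k i h1 hi => ((hg.chain k i h1 hi).smul _).add ((hg.chain (k + 1) i h1 hi).smul _),
        fun k i h1 hi y hy => ?_⟩, T', fun k i l h1 hi => ?_⟩
    · have e1 := hg.eqOn k i h1 hi hy
      have e2 := hg.eqOn (k + 1) i h1 hi hy
      simp only [Pi.add_apply, Pi.smul_apply, smul_eq_mul] at e1 e2 ⊢
      rw [e1, e2]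
      ring
    · obtain ⟨t1, t2⟩ := ht k i l h1 hi
      obtain ⟨t3, t4⟩ := ht (k + 1) i l h1 hi
      simp [t1, t2, t3, t4]

end Data

namespace Data

variable {D : Data} {c : ℕ → ℕ} {i₀ : ℕ} {B : ℕ → ℝ → ℝ}

/-! ### Existence of the basis for admissible weights -/

/-- Closed conditions on a piecewise function extend from the open interval to the points that belong
to the same piece. -/
lemma mapsTo_I {i : ℕ} (h1 : 1 ≤ i) (hi : i ≤ D.m) {f : ℝ → ℝ} (hf : f ∈ D.pieceSpace)
    {C : Set ℝ} (hC : IsClosed C) (h : ∀ y ∈ Ioo (D.x (i - 1)) (D.x i), f y ∈ C) :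
    ∀ y ∈ D.I i, f y ∈ C := by
  obtain ⟨g, hg, he⟩ := exists_chain_of_mem_T h1 hi (hf.2 i h1 hi)
  have hw := isWeights (D := D) h1 hi
  have hcont : ContinuousOn f (D.I i) :=
    (((hw.continuousOn (Nat.zero_le _)).mul (hg.continuousOn (Nat.zero_le _))).mono
      (I_subset_Icc i)).congr he
  intro y hy
  have h2 : y ∈ closure (Ioo (D.x (i - 1)) (D.x i)) := by
    rw [closure_Ioo hw.lt.ne]
    exact I_subset_Icc i hy
  have h3 := ((hcont y hy).mono (Ioo_subset_I i)).mem_closure_image h2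
  refine hC.closure_subset_iff.2 ?_ h3
  rintro _ ⟨z, hz, rfl⟩
  exact h z hz

lemma IsGtb.nonneg (hc : D.Valid c) (hB : D.IsGtb c B) (k : ℕ) (y : ℝ) : 0 ≤ B k y := by
  rcases Nat.lt_or_ge k (D.cntU c D.m) with hk | hk
  · by_cases hy : y ∈ Icc (D.x 0) (D.x D.m)
    · obtain ⟨b, h1, hb, hyb⟩ := exists_mem_I hy
      refine mapsTo_I (C := Ici 0) h1 hb (hB.mem k).1 isClosed_Ici (fun z hz => ?_) y hyb
      obtain ⟨i, hi, s, e1, e2, e3⟩ := hc.exists_start hk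
      obtain ⟨j, hj1, hj, t, f1, f2, f3⟩ := hc.exists_finish hk
      have hpos := hB.pos i hi s e1 e2 j hj1 hj t f1 f2 (by omega)
      have hst := (hB.start i hi s e1 e2).1
      have hsp := (hB.finish j hj1 hj t f1 f2 k f3).1
      rw [← e3] at hpos hst
      rcases Nat.lt_or_ge (b - 1) i with h | h
      · exact (hst z (hz.2.trans_le (x_le_of_le (by omega) hi.le))).ge
      · rcases Nat.lt_or_ge j b with h' | h'
        · exact (hsp z ((x_le_of_le (by omega) (by omega)).trans_lt hz.1)).ge
        · exact (hpos z ⟨(x_le_of_le h (by omega)).trans_lt hz.1,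
            hz.2.trans_le (x_le_of_le h' hj)⟩).le
    · exact ((hB.mem k).1.1 y hy).ge
  · rw [hB.zero k hk]; rfl

/-- The intervals `I i` contain their left endpoints, so piecewise functions are continuous from the
right. -/
lemma right_value {i : ℕ} (hi : i < D.m) {f : ℝ → ℝ} (hf : f ∈ D.pieceSpace) :
    rightDeriv 0 f (D.x i) = f (D.x i) := by
  have hi' : i + 1 ≤ D.m := hi
  obtain ⟨g, hg, he⟩ := exists_chain_of_mem_T (by omega) hi' (hf.2 (i + 1) (by omega) hi')
  have hw : IsWeights (D.w (i + 1)) (D.p (i + 1)) (D.x i) (D.x (i + 1)) :=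
    isWeights (D := D) (show 1 ≤ i + 1 by omega) hi'
  have hmem : D.x i ∈ D.I (i + 1) := by
    unfold I
    split_ifs
    · exact left_mem_Icc.2 hw.lt.le
    · exact left_mem_Ico.2 hw.lt
  have hg' := hg.contDiffOn_mul (isWeights (D := D) (show 1 ≤ i + 1 by omega) hi') (Nat.zero_le _)
  rw [rightDeriv_eq hw.lt (hg'.of_le (by simp)) (he.mono (Ioo_subset_I (i + 1))),
    iteratedDerivWithin_zero]
  exact (he hmem).symm

/-- A function that starts with a jump of its values is not zero at its start. -/
lemma Starts.ne_zero {i : ℕ} (hi : i < D.m) {f : ℝ → ℝ} (hf : f ∈ D.pieceSpace)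
    (h : D.Starts f i 0) : f (D.x i) ≠ 0 := by
  have h1 := h.2.2
  rw [jump, leftDeriv_eq_zero (prev_lt hi.le) fun y hy => h.1 y hy.2, right_value hi hf] at h1
  simpa using h1

/-- The form in which the lemmas on starts and ends of linear combinations apply. -/
lemma bidiagonal_eq_sum (B : ℕ → ℝ → ℝ) (α β : ℝ) (k : ℕ) : α • B k + β • B (k + 1) =
    ∑ l ∈ Finset.range (k + 2), (if l = k then α else if l = k + 1 then β else 0) • B l := by
  rw [Finset.sum_range_succ, Finset.sum_range_succ, Finset.sum_eq_zero]
  · simp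
  · intro l hl
    rw [Finset.mem_range] at hl
    rw [if_neg (by omega), if_neg (by omega), zero_smul]

/-- The bidiagonal combinations with these coefficients are a basis after a smoothness step. -/
lemma IsGtb.step (h : D.CanAdd c i₀) (hB : D.IsGtb c B) {κ : ℕ}
    (hκ : κ + 1 + c i₀ = D.cntU c i₀) {α : ℕ → ℝ} (hpos : ∀ k < D.cntU c i₀, 0 < α k)
    (hzero : ∀ k, D.cntU c i₀ ≤ k → α k = 0) (hone : ∀ k ≤ κ, α k = 1)
    (hlt : ∀ k, κ < k → α k < 1)
    (hker : ∀ k, α k * jump (D.x i₀) (c i₀) (B k) +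
        (1 - α (k + 1)) * jump (D.x i₀) (c i₀) (B (k + 1)) = 0) :
    D.IsGtb (addOne c i₀) fun k => α k • B k + (1 - α (k + 1)) • B (k + 1) := by
  have hc := h.valid
  have hc' := h.valid_addOne
  have hK := h.cntU_last
  have hυ := h.cntU_lt
  have h1 := h.one_le
  have hm := h.lt
  have hl := h.le_left
  have hr := h.le_right
  have hV₀ := hc.cntU_eq hm.le
  have hS₀ := hc.cntU_succ hm
  have hP₀ := hc.cntU_succ (show i₀ - 1 < D.m by omega)
  rw [show i₀ - 1 + 1 = i₀ by omega] at hP₀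
  -- the positions of the knots before and after the step
  have hbefore : ∀ i < i₀, D.cntV (addOne c i₀) i = D.cntV c i ∧ addOne c i₀ i = c i ∧
      D.cntU c (i + 1) ≤ D.cntU c i₀ ∧ D.cntU c (i + 1) = D.cntV c i + (D.p (i + 1) + 1) ∧
      D.cntV c i ≤ κ := fun i hi => by
    have := cntV_mono (D := D) (c := c) (show i ≤ i₀ - 1 by omega)
    exact ⟨cntV_addOne_of_lt hi, addOne_of_ne (by omega),
      cntU_mono (D := D) (c := c) (show i + 1 ≤ i₀ from hi), hc.cntU_succ (by omega), by omega⟩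
  have hafter : ∀ i, i₀ ≤ i → i < D.m → D.cntV (addOne c i₀) i + 1 = D.cntV c i ∧
      c i ≤ addOne c i₀ i ∧ D.cntU c i₀ + 1 ≤ D.cntV c i + addOne c i₀ i ∧
      κ + 1 ≤ D.cntV c i := fun i hi him => by
    refine ⟨cntV_addOne_of_le h1 hl hi, ?_⟩
    have e1 := cntV_mono (D := D) (c := c) hi
    rcases Nat.eq_or_lt_of_le hi with rfl | hi
    · rw [addOne_self]; omega
    · rw [addOne_of_ne (by omega)]
      have e2 := cntU_mono (D := D) (c := c) (show i₀ + 1 ≤ i from hi)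
      have e3 := hc.cntU_eq him.le
      omega
  have hstop_le : ∀ j ≤ i₀, ∀ s, addOne c i₀ j ≤ s → ∀ k,
      k + 1 + s = D.cntU (addOne c i₀) j → k + 1 + s = D.cntU c j ∧ c j ≤ s ∧ k < κ := by
    intro j hj s hs k hk
    rw [cntU_addOne_of_le hj] at hk
    rcases Nat.eq_or_lt_of_le hj with rfl | hj
    · rw [addOne_self] at hs; omega
    · rw [addOne_of_ne (by omega)] at hs
      have e1 := hc.cntU_eq (show j ≤ D.m by omega)
      have e2 := hbefore j hj
      omega
  have hstop_gt : ∀ j, i₀ < j → j ≤ D.m → ∀ s, addOne c i₀ j ≤ s → s ≤ D.p j → ∀ k,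
      k + 1 + s = D.cntU (addOne c i₀) j → k + 1 + 1 + s = D.cntU c j ∧ c j ≤ s ∧ κ ≤ k := by
    intro j hj hjm s hs hsp k hk
    rw [addOne_of_ne (by omega)] at hs
    have e1 := cntU_addOne_of_lt (D := D) (c := c) hr hj
    have e2 := hc.cntU_succ (show j - 1 < D.m by omega)
    rw [show j - 1 + 1 = j by omega] at e2
    have e3 := cntV_mono (D := D) (c := c) (show i₀ ≤ j - 1 by omega)
    omega
  have hmem : ∀ k, α k • B k + (1 - α (k + 1)) • B (k + 1) ∈ D.splines (addOne c i₀) := by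
    intro k
    rw [h.mem_splines_addOne_iff]
    refine ⟨splines_smul_add hc (hB.mem k) (hB.mem (k + 1)) _ _, ?_⟩
    rw [jump_add_smul (prev_lt hm.le) (lt_next hm.le) _ _ (h.jumpSmooth (hB.mem k).1)
      (h.jumpSmooth (hB.mem (k + 1)).1)]
    exact hker k
  have hlt' : ∀ k, κ ≤ k → 0 < 1 - α (k + 1) := fun k hk => sub_pos.2 (hlt _ (by omega))
  refine ⟨⟨fun k hk => ?_, hmem, ?_, fun i hi s hs hs' => ?_, fun j hj1 hj s hs hs' k hk => ?_⟩,
    ?_, fun y hy => ?_, fun i hi => ?_⟩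
  · rw [hzero k (by omega), hB.zero (k + 1) (by omega)]
    simp
  · intro f hf
    -- the new functions and `B υ` span the old splines, and `B υ` has a jump
    set S := Submodule.span ℝ (range fun k => α k • B k + (1 - α (k + 1)) • B (k + 1)) with hS
    have hsub : ∀ k, α k • B k + (1 - α (k + 1)) • B (k + 1) ∈
        S ⊔ Submodule.span ℝ {B (D.cntU c i₀)} := fun k =>
      Submodule.mem_sup_left (Submodule.subset_span ⟨k, rfl⟩)
    have hall : ∀ k, B k ∈ S ⊔ Submodule.span ℝ {B (D.cntU c i₀)} := by
      intro k
      rcases Nat.lt_or_ge (D.cntU c i₀) k with hk | hk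
      · have := hsub (k - 1)
        rw [show k - 1 + 1 = k by omega, hzero (k - 1) (by omega), hzero k (by omega)] at this
        simpa using this
      · induction hk using Nat.decreasingInduction with
        | self => exact Submodule.mem_sup_right (Submodule.mem_span_singleton_self _)
        | of_succ k hk ih =>
          have h2 := Submodule.sub_mem _ (hsub k) (Submodule.smul_mem _ (1 - α (k + 1)) ih)
          rw [add_sub_cancel_right] at h2
          exact (Submodule.smul_mem_iff _ (hpos k hk).ne').1 h2
    have hf' : f ∈ S ⊔ Submodule.span ℝ {B (D.cntU c i₀)} := by
      refine Submodule.span_le.2 ?_ (hB.span f (CanAdd.splines_subset hf))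
      rintro _ ⟨k, rfl⟩
      exact hall k
    obtain ⟨g, hg, b, hb, rfl⟩ := Submodule.mem_sup.1 hf'
    obtain ⟨t, rfl⟩ := Submodule.mem_span_singleton.1 hb
    have hg' : g ∈ D.splines (addOne c i₀) := by
      refine span_le_splines hc' ?_ hg
      rintro _ ⟨k, rfl⟩
      exact hmem k
    have hj := ((h.mem_splines_addOne_iff).1 hf).2
    have hjg := ((h.mem_splines_addOne_iff).1 hg').2
    have hj' := jump_add_smul (prev_lt hm.le) (lt_next hm.le) 1 t (h.jumpSmooth hg'.1)
      (h.jumpSmooth (hB.mem (D.cntU c i₀)).1)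
    rw [one_smul, hj, hjg, mul_zero, zero_add] at hj'
    have ht : t = 0 := (mul_eq_zero.1 hj'.symm).resolve_right
      (h.jump_ne_zero hB.toHasEnds (Or.inr rfl))
    rw [ht, zero_smul, add_zero]
    exact hg
  · rw [bidiagonal_eq_sum]
    rcases Nat.lt_or_ge i i₀ with hii | hii
    · obtain ⟨e1, e2, e3, e4, -⟩ := hbefore i hii
      rw [e1]
      rw [e2] at hs
      refine hB.starts_sum hc hi hs hs' (fun l hl => ?_) ?_ (by omega)
      · rw [if_neg (by omega), if_neg (by omega)]
      · rw [if_pos rfl]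
        exact (hpos _ (by omega)).ne'
    · obtain ⟨e1, e2, e3, -⟩ := hafter i hii hi
      have e4 : D.cntV (addOne c i₀) i + s + 1 = D.cntV c i + s := by omega
      refine hB.starts_sum hc hi (e2.trans hs) hs' (fun l hl => ?_) ?_ (by omega)
      · split_ifs
        · exact hzero _ (by omega)
        · omega
        · rfl
      · rw [if_neg (by omega), if_pos e4.symm, hzero _ (by omega)]
        norm_num
  · rw [bidiagonal_eq_sum]
    rcases Nat.lt_or_ge i₀ j with hij | hij
    · obtain ⟨e1, e2, e3⟩ := hstop_gt j hij hj s hs hs' k hk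
      refine hB.stops_sum hc hj1 hj e2 hs' (k := k + 1) e1 (fun l hl => ?_) ?_ (by omega)
      · rw [if_neg (by omega), if_neg (by omega)]
      · rw [if_neg (by omega), if_pos rfl]
        exact (hlt' k e3).ne'
    · obtain ⟨e1, e2, e3⟩ := hstop_le j hij s hs k hk
      refine hB.stops_sum hc hj1 hj e2 hs' e1 (fun l hl => ?_) ?_ (by omega)
      · split_ifs
        · omega
        · rw [hone _ (by omega), sub_self]
        · rfl
      · rw [if_pos rfl]
        exact (hpos _ (by omega)).ne'
  · intro i hi s hs hs' j hj1 hj t ht ht' hst y hy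
    simp only [Pi.add_apply, Pi.smul_apply, smul_eq_mul]
    have hij : i < j := by
      by_contra! hij
      exact absurd (hy.1.trans hy.2) (not_lt.2 (x_le_of_le hij hi.le))
    obtain ⟨k, hk⟩ : ∃ k, k = D.cntV (addOne c i₀) i + s := ⟨_, rfl⟩
    rw [← hk] at hst ⊢
    rcases Nat.lt_or_ge i i₀ with hii | hii
    · obtain ⟨a1, a2, a3, a4, -⟩ := hbefore i hii
      rw [a1] at hk
      rw [a2] at hs
      have hp := hpos k (by omega)
      rcases Nat.lt_or_ge i₀ j with hij' | hij'
      · -- the supports of `B k` and `B (k + 1)` cover the interval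
        obtain ⟨b1, b2, b3⟩ := hstop_gt j hij' hj t ht ht' k hst
        have hq := hlt' k b3
        have hkK : k + 1 < D.cntU c D.m := by omega
        obtain ⟨i₁, hi₁, s₁, e1, e2, e3⟩ := hc.exists_start hkK
        obtain ⟨j₁, hj₁, hjm₁, t₁, f1, f2, f3⟩ := hc.exists_finish (show k < D.cntU c D.m by omega)
        have hP := hB.pos i hi s hs hs' j₁ hj₁ hjm₁ t₁ f1 f2 (by omega)
        have hQ := hB.pos i₁ hi₁ s₁ e1 e2 j hj1 hj t b2 ht' (by omega)
        rw [← hk] at hP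
        rw [← e3] at hQ
        have hj₁' : i₀ ≤ j₁ := by
          by_contra! hlt₁
          have g1 := hbefore j₁ hlt₁
          have g2 := hc.cntU_eq hjm₁
          omega
        have hi₁' : i₁ ≤ i₀ := by
          by_contra! hlt₁
          have g1 := hafter i₁ hlt₁.le hi₁
          rw [addOne_of_ne (by omega)] at g1
          omega
        have n1 := hB.nonneg hc k y
        have n2 := hB.nonneg hc (k + 1) y
        have hor : 0 < B k y ∨ 0 < B (k + 1) y := by
          rcases lt_trichotomy y (D.x i₀) with hlt₂ | heq | hgt
          · exact Or.inl (hP y ⟨hy.1, hlt₂.trans_le (x_le_of_le hj₁' hjm₁)⟩)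
          · -- at `x i₀` itself, if `B k` ends and `B (k + 1)` starts there, the latter starts with a jump
            rcases Nat.eq_or_lt_of_le hj₁' with hj₁' | hj₁'
            · rcases Nat.eq_or_lt_of_le hi₁' with hi₁' | hi₁'
              · subst hi₁' hj₁'
                have hs₁ : s₁ = 0 := by omega
                have hst₁ := hB.start i₁ hi₁ s₁ e1 e2
                rw [← e3, hs₁] at hst₁
                have := hst₁.ne_zero hi₁ (hB.mem _).1
                rw [← heq] at this
                exact Or.inr (lt_of_le_of_ne n2 this.symm)
              · exact Or.inr (hQ y ⟨heq ▸ x_lt_of_lt hi₁' hm.le, hy.2⟩)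
            · exact Or.inl (hP y ⟨hy.1, heq ▸ x_lt_of_lt hj₁' hjm₁⟩)
          · exact Or.inr (hQ y ⟨(x_le_of_le hi₁' hm.le).trans_lt hgt, hy.2⟩)
        rcases hor with h2 | h2
        · exact add_pos_of_pos_of_nonneg (mul_pos hp h2) (mul_nonneg hq.le n2)
        · exact add_pos_of_nonneg_of_pos (mul_nonneg hp.le n1) (mul_pos hq h2)
      · obtain ⟨b1, b2, b3⟩ := hstop_le j hij' t ht k hst
        rw [hone k b3.le, hone (k + 1) b3, sub_self, zero_mul, add_zero, one_mul, hk]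
        exact hB.pos i hi s hs hs' j hj1 hj t b2 ht' (by omega) y hy
    · obtain ⟨a1, a2, a3, -⟩ := hafter i hii hi
      obtain ⟨b1, b2, b3⟩ := hstop_gt j (by omega) hj t ht ht' k hst
      rw [hzero k (by omega), hzero (k + 1) (by omega), zero_mul, zero_add, sub_zero, one_mul,
        show k + 1 = D.cntV c i + s by omega]
      exact hB.pos i hi s (a2.trans hs) hs' j hj1 hj t b2 ht' (by omega) y hy
  · rw [← Finset.sum_apply, sum_bidiagonal (β := fun k => 1 - α (k + 1)) B _ (hzero _ (by omega)),
      hK, Finset.sum_apply]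
    refine (Finset.sum_congr rfl fun k _ => ?_).trans (hB.sum_one y hy)
    rcases Nat.eq_zero_or_pos k with rfl | hk
    · simp [hone 0 (Nat.zero_le _)]
    · rw [if_neg (by omega), show k - 1 + 1 = k by omega]
      simp
  · have hi' : i + 1 ≤ D.m := hi
    apply le_antisymm
    · refine Submodule.span_le.2 ?_
      rintro _ ⟨k, -, -, rfl⟩
      exact (hmem k).1.2 (i + 1) (by omega) hi'
    · rw [← hB.loc i hi]
      refine Submodule.span_le.2 ?_
      set S := Submodule.span ℝ {f | ∃ k, D.cntV (addOne c i₀) i ≤ k ∧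
        k < D.cntU (addOne c i₀) (i + 1) ∧ f = (D.I (i + 1)).domRestrict
          (α k • B k + (1 - α (k + 1)) • B (k + 1))} with hS
      have hsub : ∀ k, D.cntV (addOne c i₀) i ≤ k → k < D.cntU (addOne c i₀) (i + 1) →
          α k • (D.I (i + 1)).domRestrict (B k) +
            (1 - α (k + 1)) • (D.I (i + 1)).domRestrict (B (k + 1)) ∈ S := fun k h2 h3 =>
        Submodule.subset_span ⟨k, h2, h3, rfl⟩
      have hSi := hc.cntU_succ hi
      have hVi := hc.cntU_eq hi.le
      rcases Nat.lt_or_ge i i₀ with hii | hii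
      · -- the functions behind the window vanish on the interval
        obtain ⟨e1, e2, e3, e4, -⟩ := hbefore i hii
        have e5 := cntU_addOne_of_le (D := D) (c := c) (show i + 1 ≤ i₀ from hii)
        have hdown : ∀ l ≤ D.cntU c (i + 1), D.cntV c i ≤ l →
            (D.I (i + 1)).domRestrict (B l) ∈ S := by
          intro l hl
          induction hl using Nat.decreasingInduction with
          | self =>
            intro _
            have : (D.I (i + 1)).domRestrict (B (D.cntU c (i + 1))) = 0 := by
              funext ⟨y, hy⟩
              have hy' := hy
              rw [I, if_neg (by omega)] at hy'
              have e6 := hc.cntU_eq hi'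
              exact hB.zero_left hc (show i + 1 < D.m by omega) le_rfl e6.ge y hy'.2
            rw [this]
            exact Submodule.zero_mem _
          | of_succ l hl ih =>
            intro hl'
            have h2 := Submodule.sub_mem _ (hsub l (by omega) (by omega))
              (Submodule.smul_mem _ (1 - α (l + 1)) (ih (by omega)))
            rw [add_sub_cancel_right] at h2
            exact (Submodule.smul_mem_iff _ (hpos l (by omega)).ne').1 h2
        rintro _ ⟨l, h2, h3, rfl⟩
        exact hdown l h3.le h2
      · -- the functions before the window vanish on the interval
        obtain ⟨e1, e2, e3, e4⟩ := hafter i hii hi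
        have e5 := cntU_addOne_of_lt (D := D) (c := c) hr (show i₀ < i + 1 by omega)
        have hup : ∀ d l, l + 1 = D.cntV c i + d → l < D.cntU c (i + 1) →
            (D.I (i + 1)).domRestrict (B l) ∈ S := by
          intro d
          induction d with
          | zero =>
            intro l hl _
            have : (D.I (i + 1)).domRestrict (B l) = 0 := by
              funext y
              refine mapsTo_I (C := {0}) (by omega) hi' (hB.mem l).1 isClosed_singleton
                (fun z hz => ?_) y y.2
              exact hB.zero_right hc hi.le le_rfl (by omega) z hz.1
            rw [this]
            exact Submodule.zero_mem _
          | succ d ih =>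
            intro l hl hl'
            obtain ⟨k, rfl⟩ : ∃ k, l = k + 1 := ⟨l - 1, by omega⟩
            have h2 := Submodule.sub_mem _ (hsub k (by omega) (by omega))
              (Submodule.smul_mem _ (α k) (ih k (by omega) (by omega)))
            rw [add_sub_cancel_left] at h2
            exact (Submodule.smul_mem_iff _ (hlt' k (by omega)).ne').1 h2
        rintro _ ⟨l, h2, h3, rfl⟩
        exact hup (l + 1 - D.cntV c i) l (by omega) h3

/-- For admissible weights, the spline spaces of all initial sets of constraints have bases with
towers. -/
lemma exists_isGtb (hw : D.IsNormalized) {r : ℕ → ℤ} (hr : D.IsSmoothness r)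
    (hadm : D.Admissible r) {ρ : ℕ} (hρ : ρ ≤ D.O r) :
    ∃ B, D.IsGtb (firstConstraints r ρ) B ∧
      (ρ < D.O r → D.HasTower (firstConstraints r ρ) (blockOf (constraintSizes r) ρ + 1) B) := by
  induction ρ with
  | zero =>
    rw [firstConstraints_zero]
    exact ⟨_, isGtb_bernBasis hw, fun _ => hasTower_bernBasis.mono (by omega)⟩
  | succ ρ ih =>
    obtain ⟨B, hB, hT⟩ := ih (by omega)
    obtain ⟨hadd, -, hsucc, hlast, hle⟩ := firstConstraints_succ hr (show ρ < D.O r by omega) rfl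
    obtain ⟨κ, hκ⟩ := hadd.exists_kappa
    obtain ⟨α, h1, h2, h3, h4, h5, h6⟩ := (hT (by omega)).exists_step hadd hB.mem hlast hadm hle hκ
    rw [hsucc]
    refine ⟨_, hB.step hadd hκ h1 h2 h3 h4 h5, fun hρ' => h6.mono ?_⟩
    -- the breakpoint of the next constraint is the same or a later one
    obtain ⟨b, hb, b1, b2⟩ := exists_block (show ρ < D.O r by omega)
    obtain ⟨b', hb', b1', b2'⟩ := exists_block hρ'
    rw [blockOf_eq b1 b2, blockOf_eq b1' b2']
    by_contra! hlt
    have := blockStart_mono (constraintSizes r) (show b' + 1 ≤ b by omega)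
    omega

/-! ### The extraction theorem -/

lemma IsGTBBasis.isGtb {r : ℕ → ℤ} (hr : D.Agrees r c) (hc : D.Valid c)
    {B : Fin (D.N r) → ℝ → ℝ} (hB : D.IsGTBBasis r B) : D.IsGtb c (extend B) := by
  obtain ⟨h1, h2⟩ := hB.hasEnds hr hc
  have hN := hr.N_eq hc
  refine ⟨h1, fun i hi s hs hs' j hj1 hj t ht ht' hst y hy => ?_, h2, fun i hi => ?_⟩
  · have hm := cntU_mono (D := D) (c := c) hj
    have hk : D.cntV c i + s < D.N r := by omega
    rw [extend_of_lt B hk]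
    refine hB.pos ⟨_, hk⟩ y ?_
    rwa [u, v, hr.uIdx_eq hc hi hs hs', hr.vIdx_eq hc hj1 hj ht ht' hst]
  · have hi' : i + 1 ≤ D.m := hi
    have e1 := hc.cntU_succ hi
    have e2 := cntU_mono (D := D) (c := c) hi'
    have e3 := hr.uCount_eq hc hi'
    rw [← hB.local_span (i + 1) (by omega) hi']
    congr 1
    ext f
    constructor
    · rintro ⟨k, hk1, hk2, rfl⟩
      have hk : k < D.N r := by omega
      refine ⟨⟨k, hk⟩, ?_, ?_, by rw [extend_of_lt B hk]⟩ <;> rw [e3] <;> simp only <;> omega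
    · rintro ⟨k, hk1, hk2, rfl⟩
      rw [e3] at hk1 hk2
      exact ⟨k, by omega, by omega, by rw [extend_of_lt B k.2]⟩

end Data

end GTSpline

theorem mainTheorem1 (D : GTSpline.Data) (hw : D.IsNormalized) (r : ℕ → ℤ) (hr : D.IsSmoothness r)
    (hB : D.Admissible r ∨ ∀ ρ ≤ D.O r, ∃ B, D.IsGTBBasis (GTSpline.truncate r ρ) B) :
    (∃ B, D.IsGTBBasis r B) ∧
      ∀ B, D.IsGTBBasis r B → ∀ y : ℝ,
        (fun k => B k y) =
          (GTSpline.extractionOperator (D.jumpMatrix r)).mulVec (fun l => D.bernstein l y) := by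
  have hex : ∀ ρ ≤ D.O r, ∃ B, D.IsGtb (GTSpline.Data.firstConstraints r ρ) B := by
    intro ρ hρ
    rcases hB with hadm | hB
    · obtain ⟨B, hB, -⟩ := GTSpline.Data.exists_isGtb hw hr hadm hρ
      exact ⟨B, hB⟩
    · obtain ⟨B, hB⟩ := hB ρ hρ
      exact ⟨_, hB.isGtb (GTSpline.Data.agrees_truncate r ρ)
        (GTSpline.Data.valid_firstConstraints hr ρ)⟩
  have hagree := GTSpline.Data.agrees_firstConstraints hr
  have hvalid := GTSpline.Data.valid_firstConstraints (D := D) hr (D.O r)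
  obtain ⟨B₀, hB₀⟩ := hex _ le_rfl
  refine ⟨⟨_, hB₀.isGTBBasis hagree hvalid⟩, fun B hB y => ?_⟩
  obtain ⟨h1, h2⟩ := hB.hasEnds hagree hvalid
  obtain ⟨h3, -⟩ := GTSpline.Data.extraction hw hr
    (fun ρ hρ => (hex ρ hρ).imp fun B hB => ⟨hB.toHasEnds, hB.sum_one⟩) (D.O r) le_rfl _ h1 h2
  funext k
  have h4 := congrFun (h3 k) y
  rw [GTSpline.Data.extend_of_lt B k.2] at h4
  rw [h4, Finset.sum_apply]
  rfl
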